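/- Let $(M^n,g)$ be a compact Riemannian manifold (smooth, without boundary) of dimension $n\ge 2$, with Riemannian volume $dv_g$. Let $W:\mathbb R^2\to\mathbb R$ be smooth and bounded with $W(z)=\frac14(1-|z|^2)^2$ for $|z|<2$, $W(z)\ge 2$ for $|z|\ge 2$, and $\sup_{\mathbb R^2}|DW|<\infty$. For $\epsilon>0$ and $u\in H^1(M,\mathbb R^2)$ put $$E_\epsilon(u)=\int_M \tfrac12|du|^2+\tfrac1{\epsilon^2}W(u)\,dv_g .$$ Let $D\subset\mathbb R^2$ be the closed unit disk, let $$\Gamma(M)=\{F\in C^0(D,H^1(M,\mathbb R^2))\mid F(y)\equiv y\text{ for }|y|=1\},\qquad c_\epsilon(M)=\inf_{F\in\Gamma(M)}\max_{y\in D}E_\epsilon(F(y)),$$ and define $v_\epsilon,v_{y,\epsilon}:\mathbb R^2\to\mathbb R^2$ by $v_\epsilon(z)=z/|z|$ for $|z|>\epsilon$ and $v_\epsilon(z)=z/\epsilon$ for $|z|\le\epsilon$; $v_{y,\epsilon}(z)=v_\epsilon\bigl(z+\frac{y}{1-|y|}\bigr)$ for $|y|<1$ and $v_{y,\epsilon}(z)=y$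 for $|y|=1$. (1) Let $f=(f^1,f^2):M\to\mathbb R^2$ be a Lipschitz map such that, for some finite positive constants $C$, $|Jf|=|df^1\wedge df^2|\ge C^{-1}$ almost everywhere on $M$, and $\sup_{z\in\mathbb R^2}\mathcal H^{n-2}(f^{-1}(\{z\}))\le C$. Then for every $\epsilon>0$ the family $F^\epsilon(y):=v_{y,\epsilon}\circ f$ $(y\in D)$ belongs to $\Gamma(M)$, the maximum $\max_{y\in D}E_\epsilon(F^\epsilon(y))$ is attained, and $$\limsup_{\epsilon\to0}\frac1{|\log\epsilon|}\max_{y\in D}E_\epsilon(F^\epsilon(y))<\infty .$$ (2) For every such $M$ (without reference to any given $f$), $$\limsup_{\epsilon\to0}\frac{c_\epsilon(M)}{|\log\epsilon|}<\infty .$$ -/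

import Mathlib

open MeasureTheory Filter Topology Bundle
open scoped Manifold ContDiff NNReal ENNReal

namespace GinzburgLandau

/-- The Euclidean plane. -/
abbrev Plane : Type := EuclideanSpace ℝ (Fin 2)

/-- The closed unit disk `D`. -/
abbrev Disk : Type := Metric.closedBall (0 : Plane) 1

/-- The admissible potentials `W`. They are automatically nonnegative. -/
structure IsPotential (W : Plane → ℝ) : Prop where
  smooth : ContDiff ℝ ∞ W
  bounded : ∃ B : ℝ, ∀ z, |W z| ≤ B
  eq_of_norm_lt : ∀ z, ‖z‖ < 2 → W z = 1 / 4 * (1 - ‖z‖ ^ 2) ^ 2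
  two_le : ∀ z, 2 ≤ ‖z‖ → 2 ≤ W z
  bounded_fderiv : ∃ B : ℝ, ∀ z, ‖fderiv ℝ W z‖ ≤ B

lemma IsPotential.nonneg {W : Plane → ℝ} (hW : IsPotential W) (z : Plane) : 0 ≤ W z := by
  rcases lt_or_ge ‖z‖ 2 with h | h
  · rw [hW.eq_of_norm_lt z h]; positivity
  · linarith [hW.two_le z h]

/-- The model map `v_ε`. -/
noncomputable def vortex (ε : ℝ) (z : Plane) : Plane :=
  open Classical in if ε < ‖z‖ then ‖z‖⁻¹ • z else ε⁻¹ • z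

/-- The maps `v_{y,ε}`: translates of `v_ε` for `|y| < 1`, constants for `|y| = 1`. -/
noncomputable def vortexFamily (ε : ℝ) (y : Disk) (z : Plane) : Plane :=
  open Classical in
  if ‖(y : Plane)‖ < 1 then vortex ε (z + (1 - ‖(y : Plane)‖)⁻¹ • (y : Plane)) else (y : Plane)

section Manifold

variable {n : ℕ} {M : Type*} [EMetricSpace M] [ChartedSpace (EuclideanSpace ℝ (Fin n)) M]

variable (n) in
/-- The differential at `z` of the inverse of the chart around `x₀`; it sends the `i`-th standard
basis vector to the coordinate vector field `∂_i` at the point with coordinates `z`. -/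
noncomputable def coordFrame (x₀ : M) (z : EuclideanSpace ℝ (Fin n)) :
    EuclideanSpace ℝ (Fin n) →L[ℝ] TangentSpace (𝓡 n) ((extChartAt (𝓡 n) x₀).symm z) :=
  mfderiv 𝓘(ℝ, EuclideanSpace ℝ (Fin n)) (𝓡 n) (extChartAt (𝓡 n) x₀).symm z

/-- `U` is a weak differential of `u : M → ℝ²`: in each chart, the coordinate expression of `U` is
the distributional derivative of the coordinate expression of `u`. -/
def HasWeakDifferential (u : M → Plane) (U : ∀ x : M, TangentSpace (𝓡 n) x →L[ℝ] Plane) : Prop :=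
  ∀ x₀ : M,
    LocallyIntegrableOn (fun z ↦ u ((extChartAt (𝓡 n) x₀).symm z))
      (extChartAt (𝓡 n) x₀).target volume ∧
    LocallyIntegrableOn (fun z ↦ (U ((extChartAt (𝓡 n) x₀).symm z)).comp (coordFrame n x₀ z))
      (extChartAt (𝓡 n) x₀).target volume ∧
    ∀ η : EuclideanSpace ℝ (Fin n) → ℝ, ContDiff ℝ ∞ η → HasCompactSupport η →
      tsupport η ⊆ (extChartAt (𝓡 n) x₀).target → ∀ v : EuclideanSpace ℝ (Fin n),
        ∫ z, (fderiv ℝ η z v) • u ((extChartAt (𝓡 n) x₀).symm z) =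
          -∫ z, η z • U ((extChartAt (𝓡 n) x₀).symm z) (coordFrame n x₀ z v)

variable (n) in
/-- The weak differential `du` (unique almost everywhere when it exists). -/
noncomputable def weakDifferential (u : M → Plane) (x : M) : TangentSpace (𝓡 n) x →L[ℝ] Plane :=
  open Classical in
  if h : ∃ U : ∀ x : M, TangentSpace (𝓡 n) x →L[ℝ] Plane, HasWeakDifferential u U
  then h.choose x else 0

variable [RiemannianBundle (fun x : M ↦ TangentSpace (𝓡 n) x)]

/-- The squared Hilbert-Schmidt norm `|A|² = |A¹|² + |A²|²` of `A : T_xM → ℝ²`, where `|Aᵃ|` is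
the dual norm of the covector `Aᵃ`. -/
noncomputable def normSq {x : M} (A : TangentSpace (𝓡 n) x →L[ℝ] Plane) : ℝ :=
  ∑ a : Fin 2, ‖(EuclideanSpace.proj a : Plane →L[ℝ] ℝ).comp A‖ ^ 2

/-- The inner product of covectors (polarization of the dual norm). -/
noncomputable def covInner {x : M} (α β : TangentSpace (𝓡 n) x →L[ℝ] ℝ) : ℝ :=
  (‖α + β‖ ^ 2 - ‖α - β‖ ^ 2) / 4

/-- The norm `|α ∧ β|` of the wedge product of two covectors (Gram determinant). -/
noncomputable def wedgeNorm {x : M} (α β : TangentSpace (𝓡 n) x →L[ℝ] ℝ) : ℝ :=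
  √(covInner α α * covInner β β - covInner α β ^ 2)

variable (n) in
/-- The Jacobian `|Jf| = |df¹ ∧ df²|`. For Lipschitz `f` the differential exists almost
everywhere. -/
noncomputable def jacobian (f : M → Plane) (x : M) : ℝ :=
  wedgeNorm (n := n) (x := x)
    (mfderiv (𝓡 n) 𝓘(ℝ, ℝ) (fun p ↦ f p 0) x) (mfderiv (𝓡 n) 𝓘(ℝ, ℝ) (fun p ↦ f p 1) x)

variable (n) in
/-- The metric coefficients `g_{ij} = ⟨∂_i, ∂_j⟩` in the chart around `x₀`. -/
noncomputable def metricMatrix (x₀ : M) (z : EuclideanSpace ℝ (Fin n)) :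
    Matrix (Fin n) (Fin n) ℝ :=
  Matrix.of fun i j ↦ inner ℝ (coordFrame n x₀ z (EuclideanSpace.single i 1))
    (coordFrame n x₀ z (EuclideanSpace.single j 1))

variable [MeasurableSpace M]

variable (n) in
/-- The measure `√det(g_{ij}) dz` of the chart around `x₀`, as a measure on `M` carried by the
domain of that chart. -/
noncomputable def chartVolume (x₀ : M) : Measure M :=
  ((volume.restrict (extChartAt (𝓡 n) x₀).target).withDensity
    fun z ↦ ENNReal.ofReal √(metricMatrix n x₀ z).det).map (extChartAt (𝓡 n) x₀).symm

variable (n M) in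
/-- The Riemannian volume measure `dv_g`: the chart measures agree on overlaps, and `dv_g` is the
smallest measure that dominates all of them, that is, the one that restricts to each of them. -/
noncomputable def riemannianVolume : Measure M := ⨆ x₀ : M, chartVolume n x₀

variable (n) in
/-- Membership in the Sobolev space `H¹(M, ℝ²)`. -/
def MemH1 (u : M → Plane) : Prop :=
  MemLp u 2 (riemannianVolume n M) ∧
    ∃ U : ∀ x : M, TangentSpace (𝓡 n) x →L[ℝ] Plane, HasWeakDifferential u U ∧
      ∫⁻ x, ENNReal.ofReal (normSq (U x)) ∂(riemannianVolume n M) < ⊤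

variable (n) in
/-- The norm of `H¹(M, ℝ²)`, `‖u‖² = ∫ |u|² + |du|²`. -/
noncomputable def h1Norm (u : M → Plane) : ℝ≥0∞ :=
  (∫⁻ x, ‖u x‖ₑ ^ 2 ∂(riemannianVolume n M) +
    ∫⁻ x, ENNReal.ofReal (normSq (weakDifferential n u x)) ∂(riemannianVolume n M)) ^ (1 / 2 : ℝ)

variable (n M) in
/-- The class `Γ(M)` of continuous families `D → H¹(M, ℝ²)` with `F(y) ≡ y` for `|y| = 1`. Elements
of `H¹` are represented by functions, to be identified when they agree almost everywhere. -/
def families : Set (Disk → M → Plane) :=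
  {F | (∀ y, MemH1 n (F y)) ∧
    (∀ y₀, Tendsto (fun y ↦ h1Norm n (F y - F y₀)) (𝓝 y₀) (𝓝 0)) ∧
    ∀ y : Disk, ‖(y : Plane)‖ = 1 → ∀ᵐ x ∂(riemannianVolume n M), F y x = y}

variable (n) in
/-- The Ginzburg-Landau energy `E_ε(u) = ∫ ½|du|² + ε⁻² W(u)`, whose integrand is nonnegative. -/
noncomputable def energy (W : Plane → ℝ) (ε : ℝ) (u : M → Plane) : ℝ≥0∞ :=
  ∫⁻ x, ENNReal.ofReal (1 / 2 * normSq (weakDifferential n u x) + W (u x) / ε ^ 2)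
    ∂(riemannianVolume n M)

variable (n M) in
/-- The min-max constant `c_ε(M)`. -/
noncomputable def minMax (W : Plane → ℝ) (ε : ℝ) : ℝ≥0∞ :=
  ⨅ F ∈ families n M, ⨆ y : Disk, energy n W ε (F y)

end Manifold

end GinzburgLandau

/-! Both parts rest on one property of $f$, recorded in `IsSpread`: $f$ is Lipschitz and the
push-forward $\nu=f_*dv_g$ is at most a multiple of Lebesgue measure on the plane.

Energy bound. For $|y|<1$ put $a=y/(1-|y|)$. Both $|d(v_{y,\epsilon}\circ f)|^2$ and
$\epsilon^{-2}W(v_{y,\epsilon}\circ f)$ are at most a constant times $\max(\epsilon,|f+a|)^{-2}$, so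
the energy is controlled by $\int\max(\epsilon,|w+a|)^{-2}d\nu(w)$. Each of the roughly
$\log_2(1/\epsilon)$ dyadic scales contributes a bounded amount, uniformly in $a$
(`lintegral_one_div_max_sq_le`). For $|y|=1$ the map is a constant of norm one, with zero energy.

Continuity in $y$. Rescaling the argument by $1-|y|$ gives a formula for $v_{y,\epsilon}$ that is
regular up to $|y|=1$ (`vortexFamily_eq`). Its derivative jumps only on a circle, a null set for
$\nu$, so dominated convergence gives continuity in $H^1$ and upper semicontinuity of the energy,
and the maximum over the compact disk is attained.

Part (1) needs $\nu\le C\,\mathcal L^2$, a coarea inequality. The Jacobian bound makes some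
$2\times2$ minor of $df$ in a chart bounded below at almost every point. Replacing the two
coordinates of that minor by the components of $f$ is a map whose Jacobian is the minor; the area
formula and Fubini then bound volume by an integral of projected fibres, and these are controlled by
$\mathcal H^{n-2}(f^{-1}(z))$ (`exists_pieces_mul_volume_le`, `tsum_sliceVolume_le`).

Part (2) needs some spread map on every $M$. A smooth submersion to the plane need not exist, but a
folded one does: a Lipschitz map which near each point takes its values among finitely many $C^1$
submersions (`IsSubmersiveSelection`). Such a map is spread, because each submersion is. It is built
one component at a time. A component is a maximum of bumps in charts, each bump carrying a steep
sawtooth in a direction transverse to the kernels of the earlier differentials; the sawtooth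
dominates the slope of the bump, so no critical point appears where the bump is active
(`exists_submersiveSelection_prod`). -/

namespace GinzburgLandau

section

open Manifold

/-! ### Charts and the Riemannian distance -/

section Geometry

variable {n : ℕ} {M : Type*} [EMetricSpace M] [ChartedSpace (EuclideanSpace ℝ (Fin n)) M]

lemma mfderiv_extChartAt_comp_coordFrame [IsManifold (𝓡 n) ∞ M] (x₀ : M)
    {z : EuclideanSpace ℝ (Fin n)} (hz : z ∈ (extChartAt (𝓡 n) x₀).target)
    (v : EuclideanSpace ℝ (Fin n)) :
    mfderiv (𝓡 n) 𝓘(ℝ, EuclideanSpace ℝ (Fin n)) (extChartAt (𝓡 n) x₀)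
      ((extChartAt (𝓡 n) x₀).symm z) (coordFrame n x₀ z v) = v := by
  have := mfderiv_extChartAt_comp_mfderivWithin_extChartAt_symm (I := 𝓡 n) hz
  rw [ModelWithCorners.range_eq_univ, mfderivWithin_univ] at this
  exact congr($this v)

lemma coordFrame_comp_mfderiv_extChartAt [IsManifold (𝓡 n) ∞ M] (x₀ : M)
    {z : EuclideanSpace ℝ (Fin n)} (hz : z ∈ (extChartAt (𝓡 n) x₀).target)
    (w : TangentSpace (𝓡 n) ((extChartAt (𝓡 n) x₀).symm z)) :
    coordFrame n x₀ z (mfderiv (𝓡 n) 𝓘(ℝ, EuclideanSpace ℝ (Fin n)) (extChartAt (𝓡 n) x₀)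
      ((extChartAt (𝓡 n) x₀).symm z) w) = w := by
  have := mfderivWithin_extChartAt_symm_comp_mfderiv_extChartAt (I := 𝓡 n) hz
  rw [ModelWithCorners.range_eq_univ, mfderivWithin_univ] at this
  exact congr($this w)

variable [RiemannianBundle (fun x : M ↦ TangentSpace (𝓡 n) x)]

lemma isContinuousRiemannianBundle_of_isContMDiff
    [IsManifold (𝓡 n) ∞ M] [IsContMDiffRiemannianBundle (𝓡 n) ∞ (EuclideanSpace ℝ (Fin n))
      (fun x : M ↦ TangentSpace (𝓡 n) x)] :
    IsContinuousRiemannianBundle (EuclideanSpace ℝ (Fin n))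
      (fun x : M ↦ TangentSpace (𝓡 n) x) := by
  obtain ⟨g, hg, h⟩ := IsContMDiffRiemannianBundle.exists_contMDiff (IB := 𝓡 n) (n := ∞)
    (F := EuclideanSpace ℝ (Fin n)) (E := fun x : M ↦ TangentSpace (𝓡 n) x)
  exact ⟨g, hg.continuous, h⟩

variable [IsManifold (𝓡 n) ∞ M]
    [IsContinuousRiemannianBundle (EuclideanSpace ℝ (Fin n))
      (fun x : M ↦ TangentSpace (𝓡 n) x)]

section

attribute [local instance] normedAddCommGroupTangentSpaceVectorSpace
attribute [local instance] normedSpaceTangentSpaceVectorSpace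

lemma eventually_coordFrame_le (x₀ : M) : ∃ C : ℝ≥0, 0 < C ∧
    ∀ᶠ z in 𝓝 (extChartAt (𝓡 n) x₀ x₀), ∀ v, ‖coordFrame n x₀ z v‖ ≤ C * ‖v‖ := by
  obtain ⟨C, hC, h⟩ := eventually_norm_mfderivWithin_symm_extChartAt_lt (𝓡 n) x₀
  refine ⟨⟨C, hC.le⟩, hC, ?_⟩
  rw [ModelWithCorners.range_eq_univ, nhdsWithin_univ] at h
  filter_upwards [h] with z hz v
  rw [mfderivWithin_univ] at hz
  exact ContinuousLinearMap.le_of_opNorm_le _ hz.le v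

lemma eventually_mfderiv_extChartAt_le (x₀ : M) : ∃ C : ℝ≥0, 0 < C ∧
    ∀ᶠ x in 𝓝 x₀, ∀ v : TangentSpace (𝓡 n) x,
      ‖(mfderiv (𝓡 n) 𝓘(ℝ, EuclideanSpace ℝ (Fin n)) (extChartAt (𝓡 n) x₀) x v :
        EuclideanSpace ℝ (Fin n))‖ ≤ C * ‖v‖ := by
  obtain ⟨C, hC, h⟩ := eventually_norm_mfderiv_extChartAt_lt (𝓡 n) x₀
  refine ⟨⟨C, hC.le⟩, hC, ?_⟩
  filter_upwards [h] with z hz v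
  exact ContinuousLinearMap.le_of_opNorm_le _ hz.le v

end

lemma eventually_norm_le_coordFrame (x₀ : M) : ∃ C : ℝ≥0, 0 < C ∧
    ∀ᶠ z in 𝓝 (extChartAt (𝓡 n) x₀ x₀), ∀ v, ‖v‖ ≤ C * ‖coordFrame n x₀ z v‖ := by
  obtain ⟨C, hC, h⟩ := eventually_mfderiv_extChartAt_le (n := n) x₀
  refine ⟨C, hC, ?_⟩
  have h1 : Tendsto (extChartAt (𝓡 n) x₀).symm (𝓝 (extChartAt (𝓡 n) x₀ x₀)) (𝓝 x₀) := by
    have := continuousAt_extChartAt_symm (I := 𝓡 n) x₀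
    rwa [ContinuousAt, extChartAt_to_inv] at this
  filter_upwards [h1.eventually h, extChartAt_target_mem_nhds (I := 𝓡 n) x₀] with z hz hz' v
  have := hz (coordFrame n x₀ z v)
  rwa [mfderiv_extChartAt_comp_coordFrame x₀ hz'] at this

section Distance

variable [IsRiemannianManifold (𝓡 n) M]

/-- The inverse chart carries the segment between two points of a small ball, which stays in the
ball by convexity, to a path at most $C$ times as long. -/
lemma eventually_edist_symm_le (x₀ : M) : ∃ C : ℝ≥0, 0 < C ∧ ∃ r > 0,
    LipschitzOnWith C (extChartAt (𝓡 n) x₀).symm (Metric.ball (extChartAt (𝓡 n) x₀ x₀) r) := by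
  obtain ⟨C, hC, h⟩ := eventually_coordFrame_le (n := n) x₀
  refine ⟨C, hC, ?_⟩
  obtain ⟨r, r_pos, hr⟩ := Metric.mem_nhds_iff.1
    (inter_mem (extChartAt_target_mem_nhds (I := 𝓡 n) x₀) h)
  refine ⟨r, r_pos, fun y hy y' hy' ↦ ?_⟩
  let η := ContinuousAffineMap.lineMap (R := ℝ) y y'
  set γ := (extChartAt (𝓡 n) x₀).symm ∘ η
  have hη : Set.Icc 0 1 ⊆ ⇑η ⁻¹' (Metric.ball (extChartAt (𝓡 n) x₀ x₀) r) := by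
    simp only [← Set.image_subset_iff, ContinuousAffineMap.coe_lineMap_eq,
     ← segment_eq_image_lineMap, η]
    exact (convex_ball _ _).segment_subset hy hy'
  have η_smooth : ContMDiffOn 𝓘(ℝ, ℝ) 𝓘(ℝ, EuclideanSpace ℝ (Fin n)) 1 η (Set.Icc 0 1) := by
    apply ContMDiff.contMDiffOn
    rw [contMDiff_iff_contDiff]
    exact ContinuousAffineMap.contDiff _
  have hη1 : Set.Icc 0 1 ⊆ ⇑η ⁻¹' (extChartAt (𝓡 n) x₀).target := fun t ht ↦ (hr (hη ht)).1
  rw [IsRiemannianManifold.out (I := 𝓡 n)]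
  have : riemannianEDist (𝓡 n) ((extChartAt (𝓡 n) x₀).symm y) ((extChartAt (𝓡 n) x₀).symm y')
      ≤ pathELength (𝓡 n) γ 0 1 := by
    apply riemannianEDist_le_pathELength _ _ _ zero_le_one
    · exact (contMDiffOn_extChartAt_symm x₀).comp η_smooth hη1
    · simp [γ, η, ContinuousAffineMap.coe_lineMap_eq]
    · simp [γ, η, ContinuousAffineMap.coe_lineMap_eq]
  apply this.trans
  rw [← lintegral_fderiv_lineMap_eq_edist, pathELength_eq_lintegral_mfderivWithin_Icc,
    ← lintegral_const_mul' _ _ ENNReal.coe_ne_top]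
  apply setLIntegral_mono' measurableSet_Icc (fun t ht ↦ ?_)
  have h2 : mfderivWithin 𝓘(ℝ, ℝ) (𝓡 n) γ (Set.Icc 0 1) t =
      (coordFrame n x₀ (η t)) ∘L (mfderivWithin 𝓘(ℝ, ℝ) 𝓘(ℝ, EuclideanSpace ℝ (Fin n)) η (Set.Icc 0 1) t) := by
    apply mfderiv_comp_mfderivWithin
    · have := mdifferentiableWithinAt_extChartAt_symm (I := 𝓡 n) (hη1 ht)
      rwa [ModelWithCorners.range_eq_univ, mdifferentiableWithinAt_univ] at this
    · exact η_smooth.mdifferentiableOn one_ne_zero t ht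
    · rw [uniqueMDiffWithinAt_iff_uniqueDiffWithinAt]
      exact uniqueDiffOn_Icc zero_lt_one t ht
  have h3 := congr($h2 1)
  have h4 : ‖mfderivWithin 𝓘(ℝ, ℝ) (𝓡 n) γ (Set.Icc 0 1) t 1‖ ≤
      C * ‖fderivWithin ℝ η (Set.Icc 0 1) t 1‖ := by
    rw [h3, ← mfderivWithin_eq_fderivWithin]
    exact (hr (hη ht)).2 _
  rw [← ofReal_norm, ← ofReal_norm]
  refine (ENNReal.ofReal_le_ofReal h4).trans_eq ?_
  rw [ENNReal.ofReal_mul C.coe_nonneg, ENNReal.ofReal_coe_nnreal]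

/-- Almost shortest paths between points close to `x₀` cannot leave a larger ball on which the
derivative of the chart is bounded, so their chart images are at most $C$ times as long. -/
lemma eventually_edist_extChartAt_le (x₀ : M) : ∃ C : ℝ≥0, 0 < C ∧ ∃ U ∈ 𝓝 x₀,
    LipschitzOnWith C (extChartAt (𝓡 n) x₀) U := by
  obtain ⟨C, hC, h⟩ := eventually_mfderiv_extChartAt_le (n := n) x₀
  refine ⟨C, hC, ?_⟩
  obtain ⟨r, r_pos, hr⟩ := EMetric.mem_nhds_iff.1
    (inter_mem (extChartAt_source_mem_nhds (I := 𝓡 n) x₀) h)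
  -- A path shorter than `2 * s` that starts within `s` of `x₀` stays within `r`.
  obtain ⟨s, hs0, hs⟩ : ∃ s : ℝ≥0∞, 0 < s ∧ s + 2 * s ≤ r := by
    refine ⟨r / 3, ENNReal.div_pos r_pos.ne' (by simp), ?_⟩
    rw [← one_add_mul, show (1 + 2 : ℝ≥0∞) = 3 by norm_num,
      ENNReal.mul_div_cancel (by simp) (by simp)]
  refine ⟨_, Metric.eball_mem_nhds x₀ hs0, fun y hy y' hy' ↦ ?_⟩
  have hyy : edist y y' < 2 * s := by
    refine (edist_triangle_right y y' x₀).trans_lt ?_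
    rw [two_mul]
    exact ENNReal.add_lt_add hy hy'
  have key : ∀ L : ℝ≥0∞, edist y y' < L → L ≤ 2 * s →
      edist (extChartAt (𝓡 n) x₀ y) (extChartAt (𝓡 n) x₀ y') ≤ C * L := by
    intro L hL hL2
    rw [IsRiemannianManifold.out (I := 𝓡 n)] at hL
    obtain ⟨γ, γ0, γ1, γs, hγ⟩ := exists_lt_of_riemannianEDist_lt hL
    have hin : ∀ t ∈ Set.Icc (0 : ℝ) 1, γ t ∈ Metric.eball x₀ r := by
      intro t ht
      have h1 : edist y (γ t) < L := by
        rw [IsRiemannianManifold.out (I := 𝓡 n)]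
        refine lt_of_le_of_lt ?_ hγ
        refine (riemannianEDist_le_pathELength (b := t) (γs.mono (Set.Icc_subset_Icc_right ht.2)) γ0 rfl
          ht.1).trans ?_
        exact pathELength_mono le_rfl ht.2
      rw [Metric.mem_eball]
      calc edist (γ t) x₀ ≤ edist x₀ y + edist y (γ t) := by
            rw [edist_comm (γ t)]; exact edist_triangle _ _ _
        _ < s + 2 * s := by
            rw [edist_comm x₀]
            exact ENNReal.add_lt_add hy (h1.trans_le hL2)
        _ ≤ r := hs
    have hsrc : ∀ t ∈ Set.Icc (0 : ℝ) 1, γ t ∈ (chartAt (EuclideanSpace ℝ (Fin n)) x₀).source :=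
      fun t ht ↦ by simpa [extChartAt_source] using (hr (hin t ht)).1
    let γ' := extChartAt (𝓡 n) x₀ ∘ γ
    have hC' : ContMDiffOn 𝓘(ℝ, ℝ) 𝓘(ℝ, EuclideanSpace ℝ (Fin n)) 1 γ' (Set.Icc 0 1) :=
      contMDiffOn_extChartAt.comp γs hsrc
    rw [← γ0, ← γ1, edist_comm, edist_eq_enorm_sub]
    calc
      ‖γ' 1 - γ' 0‖ₑ
    _ ≤ ∫⁻ t' in Set.Icc 0 1, ‖derivWithin γ' (Set.Icc 0 1) t'‖ₑ := by
      apply enorm_sub_le_lintegral_derivWithin_Icc_of_contDiffOn_Icc _ zero_le_one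
      rwa [← contMDiffOn_iff_contDiffOn]
    _ ≤ ∫⁻ t' in Set.Icc 0 1, C * ‖mfderivWithin 𝓘(ℝ, ℝ) (𝓡 n) γ (Set.Icc 0 1) t' 1‖ₑ := by
      apply setLIntegral_mono' measurableSet_Icc (fun t' ht' ↦ ?_)
      have h2 : mfderivWithin 𝓘(ℝ, ℝ) 𝓘(ℝ, EuclideanSpace ℝ (Fin n)) γ' (Set.Icc 0 1) t' =
          (mfderiv (𝓡 n) 𝓘(ℝ, EuclideanSpace ℝ (Fin n)) (extChartAt (𝓡 n) x₀) (γ t')) ∘L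
            (mfderivWithin 𝓘(ℝ, ℝ) (𝓡 n) γ (Set.Icc 0 1) t') := by
        apply mfderiv_comp_mfderivWithin
        · exact mdifferentiableAt_extChartAt (hsrc t' ht')
        · exact (γs.mdifferentiableOn one_ne_zero) _ ht'
        · rw [uniqueMDiffWithinAt_iff_uniqueDiffWithinAt]
          exact uniqueDiffOn_Icc zero_lt_one _ ht'
      have h3 := congr($h2 1)
      have h4 : ‖derivWithin γ' (Set.Icc 0 1) t'‖ ≤
          C * ‖mfderivWithin 𝓘(ℝ, ℝ) (𝓡 n) γ (Set.Icc 0 1) t' 1‖ := by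
        rw [← fderivWithin_derivWithin, ← mfderivWithin_eq_fderivWithin]
        refine le_trans (le_of_eq ?_) ((hr (hin t' ht')).2 _)
        exact congrArg (fun w : EuclideanSpace ℝ (Fin n) ↦ ‖w‖) h3
      rw [← ofReal_norm, ← ofReal_norm]
      refine (ENNReal.ofReal_le_ofReal h4).trans_eq ?_
      rw [ENNReal.ofReal_mul C.coe_nonneg, ENNReal.ofReal_coe_nnreal]
    _ = C * pathELength (𝓡 n) γ 0 1 := by
      rw [lintegral_const_mul' _ _ ENNReal.coe_ne_top,
          pathELength_eq_lintegral_mfderivWithin_Icc]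
    _ ≤ C * L := by gcongr
  -- The distance need not be realized by a path: lengths `L` strictly above it are used, and the
  -- excess tends to zero.
  refine ENNReal.le_of_forall_pos_le_add fun ε hε hlt ↦ ?_
  obtain ⟨L, hL1, hL2⟩ := exists_between (lt_min hyy
    (ENNReal.lt_add_right (a := edist y y') (b := ε / C) (hyy.ne_top)
      (ENNReal.div_pos (by simpa using hε.ne') (by simp)).ne'))
  have := key L hL1 (hL2.le.trans (min_le_left _ _))
  refine this.trans ((mul_le_mul_right (hL2.le.trans (min_le_right _ _)) _).trans_eq ?_)
  rw [mul_add, ENNReal.mul_div_cancel (by simpa using hC.ne') (by simp)]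

end Distance

end Geometry

/-! ### Covectors, wedge norms and minors -/

section Dual

variable {E : Type*} [NormedAddCommGroup E] [InnerProductSpace ℝ E]

lemma polarization_dual [CompleteSpace E] (α β : E →L[ℝ] ℝ) :
    (‖α + β‖ ^ 2 - ‖α - β‖ ^ 2) / 4 =
      inner ℝ ((InnerProductSpace.toDual ℝ E).symm α) ((InnerProductSpace.toDual ℝ E).symm β) := by
  rw [← LinearIsometryEquiv.norm_map (InnerProductSpace.toDual ℝ E).symm (α + β),
    ← LinearIsometryEquiv.norm_map (InnerProductSpace.toDual ℝ E).symm (α - β),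
    map_add, map_sub, norm_add_sq_real, norm_sub_sq_real]
  ring

/-- The Gram determinant is $|\alpha|^2$ times the squared distance from $\beta$ to the line
$\mathbb R\alpha$; the two sides differ by $(\langle\alpha,\beta\rangle-t|\alpha|^2)^2$. -/
lemma gram_dual_le [CompleteSpace E] (α β : E →L[ℝ] ℝ) (t : ℝ) :
    (‖α + α‖ ^ 2 - ‖α - α‖ ^ 2) / 4 * ((‖β + β‖ ^ 2 - ‖β - β‖ ^ 2) / 4) -
      ((‖α + β‖ ^ 2 - ‖α - β‖ ^ 2) / 4) ^ 2 ≤ (‖α‖ * ‖β - t • α‖) ^ 2 := by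
  simp only [polarization_dual]
  rw [← LinearIsometryEquiv.norm_map (InnerProductSpace.toDual ℝ E).symm α,
    ← LinearIsometryEquiv.norm_map (InnerProductSpace.toDual ℝ E).symm (β - t • α)]
  set a := (InnerProductSpace.toDual ℝ E).symm α
  set b := (InnerProductSpace.toDual ℝ E).symm β
  have h1 : (InnerProductSpace.toDual ℝ E).symm (β - t • α) = b - t • a := by simp [a, b]
  rw [h1, mul_pow, ← real_inner_self_eq_norm_sq, ← real_inner_self_eq_norm_sq]
  simp only [inner_sub_left, inner_sub_right, inner_smul_left, inner_smul_right,
    RCLike.conj_to_real]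
  rw [real_inner_comm b a]
  nlinarith [sq_nonneg (inner ℝ b a - t * inner ℝ a a)]

lemma norm_proj_comp_le {A : E →L[ℝ] Plane} {C : ℝ} (hC : 0 ≤ C)
    (h : ∀ v, ‖A v‖ ≤ C * ‖v‖) (a : Fin 2) :
    ‖(EuclideanSpace.proj a : Plane →L[ℝ] ℝ).comp A‖ ≤ C :=
  ContinuousLinearMap.opNorm_le_bound _ hC fun v ↦
    (PiLp.norm_apply_le (A v) a).trans (h v)

lemma sum_norm_proj_comp_sq_le {A : E →L[ℝ] Plane} {C : ℝ} (hC : 0 ≤ C)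
    (h : ∀ v, ‖A v‖ ≤ C * ‖v‖) :
    ∑ a : Fin 2, ‖(EuclideanSpace.proj a : Plane →L[ℝ] ℝ).comp A‖ ^ 2 ≤ 2 * C ^ 2 := by
  have := fun a ↦ pow_le_pow_left₀ (norm_nonneg _) (norm_proj_comp_le hC h a) 2
  simp only [Fin.sum_univ_two]
  linarith [this 0, this 1]

lemma sum_norm_proj_comp_sq_le_add {A B : E →L[ℝ] Plane} {C δ : ℝ} (hC : 0 ≤ C)
    (hδ : 0 ≤ δ) (hA : ∀ v, ‖A v‖ ≤ C * ‖v‖) (hB : ∀ v, ‖B v‖ ≤ C * ‖v‖)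
    (hAB : ∀ v, ‖A v - B v‖ ≤ δ * ‖v‖) :
    ∑ a : Fin 2, ‖(EuclideanSpace.proj a : Plane →L[ℝ] ℝ).comp A‖ ^ 2 ≤
      ∑ a : Fin 2, ‖(EuclideanSpace.proj a : Plane →L[ℝ] ℝ).comp B‖ ^ 2 + 4 * C * δ := by
  have key : ∀ a : Fin 2, ‖(EuclideanSpace.proj a : Plane →L[ℝ] ℝ).comp A‖ ^ 2 ≤
      ‖(EuclideanSpace.proj a : Plane →L[ℝ] ℝ).comp B‖ ^ 2 + 2 * C * δ := by
    intro a
    have h1 := norm_proj_comp_le hC hA a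
    have h2 := norm_proj_comp_le hC hB a
    have h3 := norm_proj_comp_le hδ (A := A - B) hAB a
    have h4 : (EuclideanSpace.proj a : Plane →L[ℝ] ℝ).comp A =
        (EuclideanSpace.proj a : Plane →L[ℝ] ℝ).comp B +
        (EuclideanSpace.proj a : Plane →L[ℝ] ℝ).comp (A - B) := by
      rw [← ContinuousLinearMap.comp_add]; congr 1; abel
    have h5 := norm_add_le ((EuclideanSpace.proj a : Plane →L[ℝ] ℝ).comp B)
      ((EuclideanSpace.proj a : Plane →L[ℝ] ℝ).comp (A - B))
    rw [← h4] at h5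
    nlinarith [norm_nonneg ((EuclideanSpace.proj a : Plane →L[ℝ] ℝ).comp A),
      norm_nonneg ((EuclideanSpace.proj a : Plane →L[ℝ] ℝ).comp B),
      norm_nonneg ((EuclideanSpace.proj a : Plane →L[ℝ] ℝ).comp (A - B))]
  simp only [Fin.sum_univ_two]
  linarith [key 0, key 1]

/-- Take the frame vector $e_i$ on which $|\alpha|$ is largest and subtract from $\beta$ the
multiple of $\alpha$ that makes it vanish on $e_i$. The values of the difference on the frame are
minors divided by $\alpha(e_i)$, and this factor cancels against the bound for $|\alpha|$. -/
lemma exists_smul_norm_mul_norm_sub_le {n : ℕ} {P : EuclideanSpace ℝ (Fin n) →L[ℝ] E}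
    {Q : E → EuclideanSpace ℝ (Fin n)} (hPQ : ∀ w, P (Q w) = w) {C η : ℝ} (hC : 0 ≤ C) (hη : 0 ≤ η)
    (h : ∀ v, ‖v‖ ≤ C * ‖P v‖) (α β : E →L[ℝ] ℝ)
    (hm : ∀ i j : Fin n,
      |α (P (EuclideanSpace.single i 1)) * β (P (EuclideanSpace.single j 1)) -
        α (P (EuclideanSpace.single j 1)) * β (P (EuclideanSpace.single i 1))| ≤ η) :
    ∃ t : ℝ, ‖α‖ * ‖β - t • α‖ ≤ n ^ 2 * C ^ 2 * η := by
  set e : Fin n → E := fun i ↦ P (EuclideanSpace.single i 1) with he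
  have bound : ∀ (γ : E →L[ℝ] ℝ) (L : ℝ), 0 ≤ L →
      (∀ j, |γ (e j)| ≤ L) → ‖γ‖ ≤ n * C * L := by
    intro γ L hL hj
    refine ContinuousLinearMap.opNorm_le_bound _ (by positivity) fun w ↦ ?_
    have hw := hPQ w
    set v := Q w
    have hsum : w = ∑ j, v j • e j := by
      rw [← hw]
      conv_lhs => rw [← (EuclideanSpace.basisFun (Fin n) ℝ).sum_repr v]
      rw [map_sum]
      simp [he]
    have hvw : ‖v‖ ≤ C * ‖w‖ := by simpa [hw] using h v
    calc ‖γ w‖ = ‖∑ j, v j * γ (e j)‖ := by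
          conv_lhs => rw [hsum]
          rw [map_sum]; simp
      _ ≤ ∑ j : Fin n, ‖v j * γ (e j)‖ := norm_sum_le _ _
      _ ≤ ∑ j : Fin n, ‖v‖ * L := by
          refine Finset.sum_le_sum fun j _ ↦ ?_
          rw [norm_mul]
          exact mul_le_mul (PiLp.norm_apply_le v j) (hj j) (norm_nonneg _) (norm_nonneg _)
      _ = n * ‖v‖ * L := by simp [mul_assoc]
      _ ≤ n * (C * ‖w‖) * L := by gcongr
      _ = n * C * L * ‖w‖ := by ring
  rcases isEmpty_or_nonempty (Fin n) with hn | hn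
  · have h0 : ‖α‖ ≤ 0 := by simpa using bound α 0 le_rfl (fun j ↦ hn.elim j)
    refine ⟨0, ?_⟩
    rw [le_antisymm h0 (norm_nonneg _)]
    simp; positivity
  obtain ⟨i, hi⟩ := Finite.exists_max (fun i ↦ |α (e i)|)
  have hα := bound α |α (e i)| (abs_nonneg _) hi
  rcases eq_or_ne (α (e i)) 0 with h0 | h0
  · rw [h0] at hα
    refine ⟨0, ?_⟩
    rw [le_antisymm (hα.trans_eq (by simp)) (norm_nonneg _)]
    simp; positivity
  refine ⟨β (e i) / α (e i), ?_⟩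
  have h1 := bound (β - (β (e i) / α (e i)) • α) (η / |α (e i)|) (by positivity) (fun j ↦ by
    rw [le_div_iff₀ (abs_pos.2 h0), ← abs_mul]
    refine le_trans (le_of_eq ?_) (hm i j)
    congr 1
    change (β (e j) - (β (e i) / α (e i)) * α (e j)) * α (e i) = α (e i) * β (e j) - α (e j) * β (e i)
    field_simp)
  calc _ ≤ (n * C * |α (e i)|) * (n * C * (η / |α (e i)|)) := by
        gcongr
    _ = n ^ 2 * C ^ 2 * η := by
        have := abs_pos.2 h0
        field_simp

end Dual

section Geometry

variable {n : ℕ} {M : Type*} [EMetricSpace M] [ChartedSpace (EuclideanSpace ℝ (Fin n)) M]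
  [RiemannianBundle (fun x : M ↦ TangentSpace (𝓡 n) x)]

lemma normSq_le {x : M} {A : TangentSpace (𝓡 n) x →L[ℝ] Plane} {C : ℝ} (hC : 0 ≤ C)
    (h : ∀ v, ‖A v‖ ≤ C * ‖v‖) : normSq A ≤ 2 * C ^ 2 :=
  sum_norm_proj_comp_sq_le hC h

lemma normSq_le_add {x : M} {A B : TangentSpace (𝓡 n) x →L[ℝ] Plane} {C δ : ℝ} (hC : 0 ≤ C)
    (hδ : 0 ≤ δ) (hA : ∀ v, ‖A v‖ ≤ C * ‖v‖) (hB : ∀ v, ‖B v‖ ≤ C * ‖v‖)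
    (hAB : ∀ v, ‖A v - B v‖ ≤ δ * ‖v‖) : normSq A ≤ normSq B + 4 * C * δ :=
  sum_norm_proj_comp_sq_le_add hC hδ hA hB hAB

lemma completeSpace_tangentSpace (x : M) : CompleteSpace (TangentSpace (𝓡 n) x) :=
  have : FiniteDimensional ℝ (TangentSpace (𝓡 n) x) :=
    inferInstanceAs (FiniteDimensional ℝ (EuclideanSpace ℝ (Fin n)))
  FiniteDimensional.complete ℝ _

lemma wedgeNorm_le {x : M} (α β : TangentSpace (𝓡 n) x →L[ℝ] ℝ) (t : ℝ) :
    wedgeNorm α β ≤ ‖α‖ * ‖β - t • α‖ :=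
  have := completeSpace_tangentSpace (n := n) x
  Real.sqrt_le_iff.2 ⟨mul_nonneg (norm_nonneg (E := TangentSpace (𝓡 n) x →L[ℝ] ℝ) α)
    (norm_nonneg (E := TangentSpace (𝓡 n) x →L[ℝ] ℝ) _), gram_dual_le α β t⟩

lemma wedgeNorm_le_of_minors_le [IsManifold (𝓡 n) ∞ M] {x₀ : M} {z : EuclideanSpace ℝ (Fin n)}
    (hz : z ∈ (extChartAt (𝓡 n) x₀).target) {C η : ℝ} (hC : 0 ≤ C) (hη : 0 ≤ η)
    (h : ∀ v, ‖v‖ ≤ C * ‖coordFrame n x₀ z v‖)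
    (α β : TangentSpace (𝓡 n) ((extChartAt (𝓡 n) x₀).symm z) →L[ℝ] ℝ)
    (hm : ∀ i j : Fin n,
      |α (coordFrame n x₀ z (EuclideanSpace.single i 1)) *
          β (coordFrame n x₀ z (EuclideanSpace.single j 1)) -
        α (coordFrame n x₀ z (EuclideanSpace.single j 1)) *
          β (coordFrame n x₀ z (EuclideanSpace.single i 1))| ≤ η) :
    wedgeNorm α β ≤ n ^ 2 * C ^ 2 * η := by
  obtain ⟨t, ht⟩ := exists_smul_norm_mul_norm_sub_le
    (E := TangentSpace (𝓡 n) ((extChartAt (𝓡 n) x₀).symm z)) (P := coordFrame n x₀ z)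
    (Q := mfderiv (𝓡 n) 𝓘(ℝ, EuclideanSpace ℝ (Fin n)) (extChartAt (𝓡 n) x₀)
      ((extChartAt (𝓡 n) x₀).symm z)) (coordFrame_comp_mfderiv_extChartAt x₀ hz) hC hη h α β hm
  exact (wedgeNorm_le α β t).trans ht

end Geometry

/-! ### Gram determinants and change of chart -/

section Gram

variable {E : Type*} [NormedAddCommGroup E] [InnerProductSpace ℝ E] {n : ℕ}

lemma det_gram_comp (P : EuclideanSpace ℝ (Fin n) →L[ℝ] E)
    (J : EuclideanSpace ℝ (Fin n) →L[ℝ] EuclideanSpace ℝ (Fin n)) :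
    (Matrix.gram ℝ fun i ↦ P (J (EuclideanSpace.single i 1))).det =
      J.det ^ 2 * (Matrix.gram ℝ fun i ↦ P (EuclideanSpace.single i 1)).det := by
  set b := (EuclideanSpace.basisFun (Fin n) ℝ).toBasis
  have hdet : J.det = (LinearMap.toMatrix b b (J : EuclideanSpace ℝ (Fin n) →ₗ[ℝ] _)).det := by
    rw [LinearMap.det_toMatrix]
  have hJ : ∀ i, J (EuclideanSpace.single i 1) =
      ∑ k, (LinearMap.toMatrix b b (J : EuclideanSpace ℝ (Fin n) →ₗ[ℝ] _)) k i •
        EuclideanSpace.single k 1 := by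
    intro i
    conv_lhs => rw [← (EuclideanSpace.basisFun (Fin n) ℝ).sum_repr (J (EuclideanSpace.single i 1))]
    simp [b, LinearMap.toMatrix_apply]
  have : (Matrix.gram ℝ fun i ↦ P (J (EuclideanSpace.single i 1))) =
      (LinearMap.toMatrix b b (J : EuclideanSpace ℝ (Fin n) →ₗ[ℝ] _)).transpose *
        (Matrix.gram ℝ fun i ↦ P (EuclideanSpace.single i 1)) *
        (LinearMap.toMatrix b b (J : EuclideanSpace ℝ (Fin n) →ₗ[ℝ] _)) := by
    ext i j
    simp only [Matrix.gram_apply, Matrix.mul_apply, Matrix.transpose_apply, hJ, map_sum, map_smul,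
      sum_inner, inner_sum, inner_smul_left, inner_smul_right, RCLike.conj_to_real]
    exact Finset.sum_congr rfl fun k _ ↦ mul_comm _ _
  rw [this, Matrix.det_mul, Matrix.det_mul, Matrix.det_transpose, hdet]
  ring

lemma det_gram_pos {P : EuclideanSpace ℝ (Fin n) →L[ℝ] E} (hP : Function.Injective P) :
    0 < (Matrix.gram ℝ fun i ↦ P (EuclideanSpace.single i 1)).det := by
  have h := (EuclideanSpace.basisFun (Fin n) ℝ).toBasis.linearIndependent.map'
    (P : EuclideanSpace ℝ (Fin n) →ₗ[ℝ] E) (LinearMap.ker_eq_bot.2 hP)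
  have e : (fun i ↦ P (EuclideanSpace.single i 1)) =
      (P : EuclideanSpace ℝ (Fin n) →ₗ[ℝ] E) ∘ (EuclideanSpace.basisFun (Fin n) ℝ).toBasis :=
    funext fun i ↦ by simp
  rw [e]
  exact (Matrix.posDef_gram_of_linearIndependent (𝕜 := ℝ) h).det_pos

end Gram

section Chart

variable {n : ℕ} {M : Type*} [EMetricSpace M] [ChartedSpace (EuclideanSpace ℝ (Fin n)) M]
  [IsManifold (𝓡 n) ∞ M]

lemma coordFrame_eq_comp_fderiv (x₀ x₁ : M) {z : EuclideanSpace ℝ (Fin n)}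
    (hz : z ∈ (extChartAt (𝓡 n) x₀).target)
    (hz' : (extChartAt (𝓡 n) x₀).symm z ∈ (extChartAt (𝓡 n) x₁).source) :
    HasFDerivAt (fun w ↦ extChartAt (𝓡 n) x₁ ((extChartAt (𝓡 n) x₀).symm w))
      (fderiv ℝ (fun w ↦ extChartAt (𝓡 n) x₁ ((extChartAt (𝓡 n) x₀).symm w)) z) z ∧
    (coordFrame n x₀ z : EuclideanSpace ℝ (Fin n) →L[ℝ] EuclideanSpace ℝ (Fin n)) =
      (coordFrame n x₁ (extChartAt (𝓡 n) x₁ ((extChartAt (𝓡 n) x₀).symm z)) :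
        EuclideanSpace ℝ (Fin n) →L[ℝ] EuclideanSpace ℝ (Fin n)).comp
      (fderiv ℝ (fun w ↦ extChartAt (𝓡 n) x₁ ((extChartAt (𝓡 n) x₀).symm w)) z) := by
  have hs : MDifferentiableAt 𝓘(ℝ, EuclideanSpace ℝ (Fin n)) (𝓡 n) (extChartAt (𝓡 n) x₀).symm z :=
    ((contMDiffOn_extChartAt_symm (n := ∞) (I := 𝓡 n) x₀).mdifferentiableOn (by simp)).mdifferentiableAt
      ((isOpen_extChartAt_target x₀).mem_nhds hz)
  have he : MDifferentiableAt (𝓡 n) 𝓘(ℝ, EuclideanSpace ℝ (Fin n)) (extChartAt (𝓡 n) x₁)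
      ((extChartAt (𝓡 n) x₀).symm z) :=
    mdifferentiableAt_extChartAt (by simpa [extChartAt_source] using hz')
  have hτ := he.comp z hs
  refine ⟨?_, ?_⟩
  · exact (mdifferentiableAt_iff_differentiableAt.1 hτ).hasFDerivAt
  have hs' : MDifferentiableAt 𝓘(ℝ, EuclideanSpace ℝ (Fin n)) (𝓡 n) (extChartAt (𝓡 n) x₁).symm
      (extChartAt (𝓡 n) x₁ ((extChartAt (𝓡 n) x₀).symm z)) :=
    ((contMDiffOn_extChartAt_symm (n := ∞) (I := 𝓡 n) x₁).mdifferentiableOn (by simp)).mdifferentiableAt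
      ((isOpen_extChartAt_target x₁).mem_nhds ((extChartAt (𝓡 n) x₁).map_source hz'))
  have h1 := mfderiv_comp z hs' hτ
  have h2 : (extChartAt (𝓡 n) x₀).symm =ᶠ[𝓝 z]
      (extChartAt (𝓡 n) x₁).symm ∘ ((extChartAt (𝓡 n) x₁) ∘ (extChartAt (𝓡 n) x₀).symm) := by
    have : (extChartAt (𝓡 n) x₀).symm ⁻¹' (extChartAt (𝓡 n) x₁).source ∈ 𝓝 z :=
      hs.continuousAt.preimage_mem_nhds ((isOpen_extChartAt_source x₁).mem_nhds hz')
    filter_upwards [this] with w hw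
    exact ((extChartAt (𝓡 n) x₁).left_inv hw).symm
  have h3 := h2.mfderiv_eq (I := 𝓘(ℝ, EuclideanSpace ℝ (Fin n))) (I' := 𝓡 n)
  rw [← mfderiv_eq_fderiv]
  exact h3.trans h1

end Chart

section Geometry

variable {n : ℕ} {M : Type*} [EMetricSpace M] [ChartedSpace (EuclideanSpace ℝ (Fin n)) M]
  [RiemannianBundle (fun x : M ↦ TangentSpace (𝓡 n) x)]

/-- The Gram matrix of a frame of the tangent space at `p`. -/
noncomputable def frameGram (p : M)
    (A : EuclideanSpace ℝ (Fin n) →L[ℝ] EuclideanSpace ℝ (Fin n)) : Matrix (Fin n) (Fin n) ℝ :=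
  Matrix.gram ℝ fun i ↦ (show TangentSpace (𝓡 n) p from A (EuclideanSpace.single i 1))

/-- In `frameGram` the base point is separate from the frame, which is read in the model space; the
base points of two charts can thus be identified by rewriting although the tangent space depends on
them. -/
lemma metricMatrix_eq (x₀ : M) (z : EuclideanSpace ℝ (Fin n)) :
    metricMatrix n x₀ z = frameGram ((extChartAt (𝓡 n) x₀).symm z) (coordFrame n x₀ z) := rfl

lemma det_frameGram_comp (p : M)
    (A J : EuclideanSpace ℝ (Fin n) →L[ℝ] EuclideanSpace ℝ (Fin n)) :
    (frameGram p (A.comp J)).det = J.det ^ 2 * (frameGram p A).det :=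
  det_gram_comp (E := TangentSpace (𝓡 n) p) A J

variable [IsManifold (𝓡 n) ∞ M]

lemma det_metricMatrix_pos (x₀ : M) {z : EuclideanSpace ℝ (Fin n)}
    (hz : z ∈ (extChartAt (𝓡 n) x₀).target) : 0 < (metricMatrix n x₀ z).det := by
  have hinj : Function.Injective (coordFrame n x₀ z) :=
    Function.LeftInverse.injective (mfderiv_extChartAt_comp_coordFrame x₀ hz)
  exact det_gram_pos (E := TangentSpace (𝓡 n) ((extChartAt (𝓡 n) x₀).symm z))
    (P := coordFrame n x₀ z) hinj

lemma continuousOn_metricMatrix [IsContinuousRiemannianBundle (EuclideanSpace ℝ (Fin n))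
      (fun x : M ↦ TangentSpace (𝓡 n) x)] (x₀ : M) :
    ContinuousOn (metricMatrix n x₀) (extChartAt (𝓡 n) x₀).target := by
  have hopen : IsOpen (extChartAt (𝓡 n) x₀).target := isOpen_extChartAt_target x₀
  have key : ∀ v : EuclideanSpace ℝ (Fin n), ContinuousOn (fun z ↦
      (⟨(extChartAt (𝓡 n) x₀).symm z, coordFrame n x₀ z v⟩ : TangentBundle (𝓡 n) M))
      (extChartAt (𝓡 n) x₀).target := by
    intro v
    have h1 := (contMDiffOn_extChartAt_symm (n := ∞) (I := 𝓡 n) x₀).continuousOn_tangentMapWithin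
      (by simp) hopen.uniqueMDiffOn
    have h2 : ContinuousOn (fun z : EuclideanSpace ℝ (Fin n) ↦
        (⟨z, v⟩ : TangentBundle 𝓘(ℝ, EuclideanSpace ℝ (Fin n)) (EuclideanSpace ℝ (Fin n))))
        (extChartAt (𝓡 n) x₀).target :=
      ((tangentBundleModelSpaceHomeomorph (𝓘(ℝ, EuclideanSpace ℝ (Fin n)))).symm.continuous.comp
        (continuous_id.prodMk continuous_const : Continuous fun z ↦ (z, v))).continuousOn
    have h3 := h1.comp h2 (fun z hz ↦ hz)
    refine h3.congr fun z hz ↦ ?_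
    simp only [Function.comp_apply, tangentMapWithin, coordFrame]
    rw [mfderivWithin_of_isOpen hopen hz]
    rfl
  refine continuousOn_pi.2 fun i ↦ continuousOn_pi.2 fun j ↦ ?_
  exact ContinuousOn.inner_bundle (key _) (key _)

lemma det_metricMatrix_transition (x₀ x₁ : M) {z : EuclideanSpace ℝ (Fin n)}
    (hz : z ∈ (extChartAt (𝓡 n) x₀).target)
    (hz' : (extChartAt (𝓡 n) x₀).symm z ∈ (extChartAt (𝓡 n) x₁).source) :
    √(metricMatrix n x₀ z).det =
      |(fderiv ℝ (fun w ↦ extChartAt (𝓡 n) x₁ ((extChartAt (𝓡 n) x₀).symm w)) z).det| *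
        √(metricMatrix n x₁ (extChartAt (𝓡 n) x₁ ((extChartAt (𝓡 n) x₀).symm z))).det := by
  rw [metricMatrix_eq, metricMatrix_eq, (extChartAt (𝓡 n) x₁).left_inv hz',
    (coordFrame_eq_comp_fderiv x₀ x₁ hz hz').2]
  refine (congrArg Real.sqrt (det_frameGram_comp _ _ _)).trans ?_
  rw [Real.sqrt_mul (sq_nonneg _), Real.sqrt_sq_eq_abs]

end Geometry

/-! ### The Riemannian measure in charts -/

section Volume

variable {n : ℕ} {M : Type*} [EMetricSpace M] [ChartedSpace (EuclideanSpace ℝ (Fin n)) M]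
  [MeasurableSpace M] [BorelSpace M]

lemma _root_.ContinuousOn.measurableSet_inter_preimage {X Y : Type*} [TopologicalSpace X]
    [MeasurableSpace X] [BorelSpace X] [TopologicalSpace Y] [MeasurableSpace Y] [BorelSpace Y]
    {f : X → Y} {s : Set X} (hf : ContinuousOn f s) (hs : MeasurableSet s) {A : Set Y}
    (hA : MeasurableSet A) : MeasurableSet (s ∩ f ⁻¹' A) := by
  have h := hs.subtype_image (hf.domRestrict.measurable hA)
  convert h using 1
  ext x
  simp [and_comm]

lemma measurableSet_target_inter_preimage (x₀ : M) {A : Set M} (hA : MeasurableSet A) :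
    MeasurableSet ((extChartAt (𝓡 n) x₀).target ∩ (extChartAt (𝓡 n) x₀).symm ⁻¹' A) :=
  (continuousOn_extChartAt_symm x₀).measurableSet_inter_preimage
    (isOpen_extChartAt_target x₀).measurableSet hA

lemma measurableSet_source_inter_preimage (x₀ : M) {T : Set (EuclideanSpace ℝ (Fin n))}
    (hT : MeasurableSet T) :
    MeasurableSet ((extChartAt (𝓡 n) x₀).source ∩ (extChartAt (𝓡 n) x₀) ⁻¹' T) :=
  (continuousOn_extChartAt x₀).measurableSet_inter_preimage
    (isOpen_extChartAt_source x₀).measurableSet hT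

lemma aemeasurable_extChartAt_symm (x₀ : M) (μ : Measure (EuclideanSpace ℝ (Fin n))) :
    AEMeasurable (extChartAt (𝓡 n) x₀).symm (μ.restrict (extChartAt (𝓡 n) x₀).target) :=
  (continuousOn_extChartAt_symm x₀).aemeasurable (isOpen_extChartAt_target x₀).measurableSet

variable [RiemannianBundle (fun x : M ↦ TangentSpace (𝓡 n) x)]

lemma chartVolume_apply (x₀ : M) {A : Set M} (hA : MeasurableSet A) :
    chartVolume n x₀ A =
      ∫⁻ z in (extChartAt (𝓡 n) x₀).target ∩ (extChartAt (𝓡 n) x₀).symm ⁻¹' A,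
        ENNReal.ofReal √(metricMatrix n x₀ z).det := by
  have hT := (isOpen_extChartAt_target (I := 𝓡 n) x₀).measurableSet
  rw [chartVolume, Measure.map_apply_of_aemeasurable _ hA, withDensity_apply',
    Measure.restrict_restrict' hT, Set.inter_comm]
  exact (aemeasurable_extChartAt_symm x₀ volume).mono_ac (withDensity_absolutelyContinuous _ _)

/-- Change of variables along the transition map, whose Jacobian is the ratio of the two densities.
Only an inequality is needed, so the part of `A` outside the first chart does no harm. -/
lemma chartVolume_le_of_subset_source [IsManifold (𝓡 n) ∞ M] (x₀ x₁ : M) {A : Set M} (hA : MeasurableSet A)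
    (hs : A ⊆ (extChartAt (𝓡 n) x₁).source) : chartVolume n x₀ A ≤ chartVolume n x₁ A := by
  rw [chartVolume_apply x₀ hA, chartVolume_apply x₁ hA]
  set S := (extChartAt (𝓡 n) x₀).target ∩ (extChartAt (𝓡 n) x₀).symm ⁻¹' A
  have hS : MeasurableSet S := measurableSet_target_inter_preimage x₀ hA
  set τ := fun w ↦ extChartAt (𝓡 n) x₁ ((extChartAt (𝓡 n) x₀).symm w)
  have hinj : Set.InjOn τ S := by
    intro z hz w hw h
    exact (extChartAt (𝓡 n) x₀).symm.injOn hz.1 hw.1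
      ((extChartAt (𝓡 n) x₁).injOn (hs hz.2) (hs hw.2) h)
  have himg : τ '' S ⊆ (extChartAt (𝓡 n) x₁).target ∩ (extChartAt (𝓡 n) x₁).symm ⁻¹' A := by
    rintro _ ⟨z, hz, rfl⟩
    refine ⟨(extChartAt (𝓡 n) x₁).map_source (hs hz.2), ?_⟩
    simp only [Set.mem_preimage, τ]
    rw [(extChartAt (𝓡 n) x₁).left_inv (hs hz.2)]
    exact hz.2
  refine le_trans (le_of_eq ?_) (lintegral_mono_set himg)
  rw [lintegral_image_eq_lintegral_abs_det_fderiv_mul volume hS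
    (fun z hz ↦ (coordFrame_eq_comp_fderiv x₀ x₁ hz.1 (hs hz.2)).1.hasFDerivWithinAt) hinj]
  refine setLIntegral_congr_fun hS fun z hz ↦ ?_
  rw [det_metricMatrix_transition x₀ x₁ hz.1 (hs hz.2), ENNReal.ofReal_mul (abs_nonneg _)]

/-- Since $dv_g$ is a supremum of measures, it suffices to find one measure that dominates every
chart measure and agrees with that of `x₀` on its domain. -/
lemma riemannianVolume_le_chartVolume [IsManifold (𝓡 n) ∞ M] (x₀ : M) {A : Set M} (hA : MeasurableSet A)
    (hs : A ⊆ (extChartAt (𝓡 n) x₀).source) : riemannianVolume n M A ≤ chartVolume n x₀ A := by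
  set S := (extChartAt (𝓡 n) x₀).source
  have hS : MeasurableSet S := (isOpen_extChartAt_source x₀).measurableSet
  -- Off the chart domain every nonempty set gets infinite mass, so domination is automatic there.
  set ν : Measure M := (chartVolume n x₀).restrict S + (⊤ : ℝ≥0∞) • Measure.count.restrict Sᶜ
  have hle : riemannianVolume n M ≤ ν := by
    refine iSup_le fun x ↦ Measure.le_iff.2 fun B hB ↦ ?_
    rw [← measure_inter_add_sdiff B hS]
    simp only [ν, Measure.add_apply, Measure.smul_apply, Measure.restrict_apply hB, smul_eq_mul]
    refine add_le_add (chartVolume_le_of_subset_source x x₀ (hB.inter hS) Set.inter_subset_right) ?_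
    rcases (B \ S).eq_empty_or_nonempty with h | h
    · simp [h]
    · rw [← Set.sdiff_eq, ENNReal.top_mul]
      · exact le_top
      · rwa [Ne, Measure.count_eq_zero_iff, ← Ne, ← Set.nonempty_iff_ne_empty]
  refine (hle A).trans_eq ?_
  simp only [ν, Measure.add_apply, Measure.smul_apply, Measure.restrict_apply hA, smul_eq_mul]
  rw [Set.inter_eq_left.2 hs, ← Set.sdiff_eq, Set.sdiff_eq_empty.2 hs]
  simp

variable [IsManifold (𝓡 n) ∞ M] [IsContinuousRiemannianBundle (EuclideanSpace ℝ (Fin n))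
      (fun x : M ↦ TangentSpace (𝓡 n) x)]

/-- The density is positive on the chart, so null sets of the chart measure are Lebesgue null in
coordinates. -/
lemma ae_chart_of_ae_riemannianVolume {P : M → Prop} (h : ∀ᵐ x ∂(riemannianVolume n M), P x)
    (x₀ : M) : ∀ᵐ z ∂(volume.restrict (extChartAt (𝓡 n) x₀).target),
      P ((extChartAt (𝓡 n) x₀).symm z) := by
  have hT := (isOpen_extChartAt_target (I := 𝓡 n) x₀).measurableSet
  have h1 : ∀ᵐ x ∂(chartVolume n x₀), P x :=
    ae_mono (le_iSup (fun x₀ : M ↦ chartVolume n x₀) x₀) h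
  have hd : AEMeasurable (fun z ↦ ENNReal.ofReal √(metricMatrix n x₀ z).det)
      (volume.restrict (extChartAt (𝓡 n) x₀).target) := by
    refine ContinuousOn.aemeasurable ?_ hT
    refine ENNReal.continuous_ofReal.comp_continuousOn
      (Real.continuous_sqrt.comp_continuousOn ?_)
    exact (Continuous.matrix_det continuous_id).comp_continuousOn (continuousOn_metricMatrix x₀)
  have h2 := ae_of_ae_map
    ((aemeasurable_extChartAt_symm (n := n) x₀ volume).mono_ac (withDensity_absolutelyContinuous _ _)) h1
  rw [ae_withDensity_iff' hd] at h2
  filter_upwards [h2, ae_restrict_mem hT] with z hz hz'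
  refine hz ?_
  rw [Ne, ENNReal.ofReal_eq_zero, not_le, Real.sqrt_pos]
  exact det_metricMatrix_pos x₀ hz'

omit [IsContinuousRiemannianBundle (EuclideanSpace ℝ (Fin n))
      (fun x : M ↦ TangentSpace (𝓡 n) x)] in
lemma ae_riemannianVolume_of_ae_chart [CompactSpace M] {P : M → Prop}
    (h : ∀ x₀ : M, ∀ᵐ z ∂(volume.restrict (extChartAt (𝓡 n) x₀).target),
      P ((extChartAt (𝓡 n) x₀).symm z)) : ∀ᵐ x ∂(riemannianVolume n M), P x := by
  obtain ⟨t, ht⟩ := isCompact_univ.elim_nhds_subcover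
    (fun x₀ : M ↦ (extChartAt (𝓡 n) x₀).source) (fun x₀ _ ↦ extChartAt_source_mem_nhds x₀)
  have key : ∀ x₀ : M, ∀ᵐ x ∂(riemannianVolume n M), x ∈ (extChartAt (𝓡 n) x₀).source → P x := by
    intro x₀
    have h0 := h x₀
    rw [ae_iff] at h0
    set N := toMeasurable (volume.restrict (extChartAt (𝓡 n) x₀).target)
      {z | ¬ P ((extChartAt (𝓡 n) x₀).symm z)}
    have hN : MeasurableSet N := measurableSet_toMeasurable _ _
    have hN0 : volume.restrict (extChartAt (𝓡 n) x₀).target N = 0 := by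
      rw [measure_toMeasurable, h0]
    have hB := measurableSet_source_inter_preimage (n := n) x₀ hN
    refine measure_mono_null (t := (extChartAt (𝓡 n) x₀).source ∩ (extChartAt (𝓡 n) x₀) ⁻¹' N) ?_ ?_
    · intro x hx
      simp only [Set.mem_compl_iff, Set.mem_ofPred_eq, Classical.not_imp] at hx
      refine ⟨hx.1, subset_toMeasurable _ _ ?_⟩
      simp only [Set.mem_ofPred_eq, (extChartAt (𝓡 n) x₀).left_inv hx.1]
      exact hx.2
    · refine le_antisymm ((riemannianVolume_le_chartVolume x₀ hB Set.inter_subset_left).trans ?_)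
        zero_le
      rw [chartVolume_apply x₀ hB]
      refine le_of_eq (setLIntegral_measure_zero _ _ (measure_mono_null ?_ (?_ : volume (N ∩ (extChartAt (𝓡 n) x₀).target) = 0)))
      · rintro z ⟨hz, -, hz'⟩
        refine ⟨?_, hz⟩
        rwa [Set.mem_preimage, (extChartAt (𝓡 n) x₀).right_inv hz] at hz'
      · rwa [Measure.restrict_apply hN] at hN0
  have := (t.eventually_all).2 (fun x₀ _ ↦ key x₀)
  filter_upwards [this] with x hx
  obtain ⟨x₀, hx₀, hxs⟩ := Set.mem_iUnion₂.1 (ht.2 (Set.mem_univ x))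
  exact hx x₀ hx₀ hxs

/-- Turns local volume estimates in charts into global ones: compactness leaves finitely many closed
coordinate balls, on which the continuous density is bounded. The neighbourhoods `N` say how small
the balls must be. -/
lemma exists_chart_cover [CompactSpace M] (N : M → Set (EuclideanSpace ℝ (Fin n)))
    (hN : ∀ x, N x ∈ 𝓝 (extChartAt (𝓡 n) x x)) :
    ∃ (t : Finset M) (r : M → ℝ) (C : ℝ≥0),
      (∀ x, 0 < r x ∧ Metric.closedBall (extChartAt (𝓡 n) x x) (r x) ⊆
        (extChartAt (𝓡 n) x).target ∩ N x) ∧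
      (∀ p, ∃ x ∈ t, p ∈ (extChartAt (𝓡 n) x).source ∧
        extChartAt (𝓡 n) x p ∈ Metric.closedBall (extChartAt (𝓡 n) x x) (r x)) ∧
      ∀ A, MeasurableSet A → riemannianVolume n M A ≤ C * ∑ x ∈ t,
        volume (Metric.closedBall (extChartAt (𝓡 n) x x) (r x) ∩
          (extChartAt (𝓡 n) x).symm ⁻¹' A) := by
  have h1 : ∀ x : M, ∃ r : ℝ, 0 < r ∧ Metric.closedBall (extChartAt (𝓡 n) x x) r ⊆
        (extChartAt (𝓡 n) x).target ∩ N x := fun x ↦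
    Metric.nhds_basis_closedBall.mem_iff.1 (inter_mem (extChartAt_target_mem_nhds x) (hN x))
  choose r hr0 hr using h1
  have h2 : ∀ x : M, ∃ C : ℝ≥0, ∀ z ∈ Metric.closedBall (extChartAt (𝓡 n) x x) (r x),
      ENNReal.ofReal √(metricMatrix n x z).det ≤ C := by
    intro x
    have hc : ContinuousOn (fun z ↦ √(metricMatrix n x z).det)
        (Metric.closedBall (extChartAt (𝓡 n) x x) (r x)) :=
      Real.continuous_sqrt.comp_continuousOn ((Continuous.matrix_det continuous_id).comp_continuousOn
        ((continuousOn_metricMatrix x).mono ((hr x).trans Set.inter_subset_left)))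
    obtain ⟨C, hC⟩ := (isCompact_closedBall _ _).exists_bound_of_continuousOn hc
    refine ⟨C.toNNReal, fun z hz ↦ ENNReal.ofReal_le_ofReal ((le_abs_self _).trans (hC z hz))⟩
  choose C hC using h2
  obtain ⟨t, ht⟩ := isCompact_univ.elim_nhds_subcover
    (fun x : M ↦ (extChartAt (𝓡 n) x).source ∩
      extChartAt (𝓡 n) x ⁻¹' (Metric.closedBall (extChartAt (𝓡 n) x x) (r x)))
    (fun x _ ↦ inter_mem (extChartAt_source_mem_nhds x)
      ((continuousAt_extChartAt x).preimage_mem_nhds (Metric.closedBall_mem_nhds _ (hr0 x))))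
  refine ⟨t, r, t.sup C, fun x ↦ ⟨hr0 x, hr x⟩, fun p ↦ ?_, fun A hA ↦ ?_⟩
  · obtain ⟨x, hx, hp⟩ := Set.mem_iUnion₂.1 (ht.2 (Set.mem_univ p))
    exact ⟨x, hx, hp⟩
  rw [Finset.mul_sum]
  have hcov : A ⊆ ⋃ x ∈ t, A ∩ ((extChartAt (𝓡 n) x).source ∩
      extChartAt (𝓡 n) x ⁻¹' (Metric.closedBall (extChartAt (𝓡 n) x x) (r x))) := by
    intro p hp
    obtain ⟨x, hx, hp'⟩ := Set.mem_iUnion₂.1 (ht.2 (Set.mem_univ p))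
    exact Set.mem_iUnion₂.2 ⟨x, hx, hp, hp'⟩
  refine (measure_mono hcov).trans ((measure_biUnion_finset_le _ _).trans
    (Finset.sum_le_sum fun x hx ↦ ?_))
  have hm : MeasurableSet (A ∩ ((extChartAt (𝓡 n) x).source ∩
      extChartAt (𝓡 n) x ⁻¹' (Metric.closedBall (extChartAt (𝓡 n) x x) (r x)))) :=
    hA.inter (measurableSet_source_inter_preimage x Metric.isClosed_closedBall.measurableSet)
  refine (riemannianVolume_le_chartVolume x hm (fun p hp ↦ hp.2.1)).trans ?_
  rw [chartVolume_apply x hm]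
  have hsub : (extChartAt (𝓡 n) x).target ∩ (extChartAt (𝓡 n) x).symm ⁻¹' (A ∩
      ((extChartAt (𝓡 n) x).source ∩
      extChartAt (𝓡 n) x ⁻¹' (Metric.closedBall (extChartAt (𝓡 n) x x) (r x)))) ⊆
      Metric.closedBall (extChartAt (𝓡 n) x x) (r x) ∩ (extChartAt (𝓡 n) x).symm ⁻¹' A := by
    rintro z ⟨hz, hzA, -, hzb⟩
    rw [Set.mem_preimage, (extChartAt (𝓡 n) x).right_inv hz] at hzb
    exact ⟨hzb, hzA⟩
  have hmeas : MeasurableSet (Metric.closedBall (extChartAt (𝓡 n) x x) (r x) ∩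
      (extChartAt (𝓡 n) x).symm ⁻¹' A) := by
    have := (measurableSet_target_inter_preimage (n := n) x hA).inter
      (Metric.isClosed_closedBall (x := extChartAt (𝓡 n) x x) (ε := r x)).measurableSet
    convert this using 1
    ext z
    exact ⟨fun h ↦ ⟨⟨(hr x h.1).1, h.2⟩, h.1⟩, fun h ↦ ⟨h.2, h.1.2⟩⟩
  refine (lintegral_mono_set hsub).trans ((setLIntegral_mono' hmeas
    (g := fun _ ↦ ((t.sup C : ℝ≥0) : ℝ≥0∞)) fun z hz ↦ ?_).trans_eq ?_)
  · exact (hC x z hz.1).trans (by exact_mod_cast Finset.le_sup hx)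
  · rw [setLIntegral_const]

lemma isFiniteMeasure_riemannianVolume [CompactSpace M] :
    IsFiniteMeasure (riemannianVolume n M) := by
  obtain ⟨t, r, C, -, -, h⟩ := exists_chart_cover (n := n) (M := M) (fun _ ↦ Set.univ) (fun _ ↦ univ_mem)
  refine ⟨(h _ MeasurableSet.univ).trans_lt (ENNReal.mul_lt_top ENNReal.coe_lt_top ?_)⟩
  refine ENNReal.sum_lt_top.2 fun x _ ↦ (measure_mono Set.inter_subset_left).trans_lt ?_
  exact Metric.isBounded_closedBall.measure_lt_top

end Volume

/-! ### Locally Lipschitz maps on Euclidean domains -/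

section Euclidean

variable {E : Type*} [NormedAddCommGroup E] [NormedSpace ℝ E]

lemma _root_.LocallyLipschitzOn.exists_norm_fderiv_le {F : Type*} [NormedAddCommGroup F]
    [NormedSpace ℝ F] {w : E → F} {Ω : Set E} (hw : LocallyLipschitzOn Ω w) (hΩ : IsOpen Ω) {z : E}
    (hz : z ∈ Ω) : ∃ C : ℝ≥0, ∃ V ∈ 𝓝 z, IsOpen V ∧ V ⊆ Ω ∧ LipschitzOnWith C w V ∧
      ∀ y ∈ V, ‖fderiv ℝ w y‖ ≤ C := by
  obtain ⟨C, V, hV, hC⟩ := hw hz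
  rw [hΩ.nhdsWithin_eq hz] at hV
  obtain ⟨V', hV', hV'o, hzV'⟩ := mem_nhds_iff.1 (inter_mem hV (hΩ.mem_nhds hz))
  refine ⟨C, V', hV'o.mem_nhds hzV', hV'o, fun x hx ↦ (hV' hx).2,
    hC.mono fun x hx ↦ (hV' hx).1, fun y hy ↦ ?_⟩
  exact norm_fderiv_le_of_lipschitzOn ℝ (mem_of_superset (hV'o.mem_nhds hy) fun x hx ↦ (hV' hx).1) hC

variable [FiniteDimensional ℝ E] [MeasurableSpace E] [BorelSpace E]

lemma _root_.LocallyLipschitzOn.ae_differentiableAt {F : Type*} [NormedAddCommGroup F]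
    [NormedSpace ℝ F] [FiniteDimensional ℝ F] {w : E → F} {Ω : Set E} (μ : Measure E)
    [μ.IsAddHaarMeasure] (hw : LocallyLipschitzOn Ω w) (hΩ : IsOpen Ω) :
    ∀ᵐ z ∂(μ.restrict Ω), DifferentiableAt ℝ w z := by
  rw [ae_restrict_iff' hΩ.measurableSet]
  have h1 : ∀ z ∈ Ω, ∃ V ∈ 𝓝[Ω] z, ∀ᵐ y ∂μ, y ∈ V → DifferentiableAt ℝ w y := by
    intro z hz
    obtain ⟨C, V, hV, hVo, hVΩ, hC, -⟩ := hw.exists_norm_fderiv_le hΩ hz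
    refine ⟨V, mem_nhdsWithin_of_mem_nhds hV, ?_⟩
    filter_upwards [hC.ae_differentiableWithinAt_of_mem (μ := μ)] with y hy hyV
    exact (hy hyV).differentiableAt (hVo.mem_nhds hyV)
  choose! V hV hVd using h1
  obtain ⟨t, htΩ, htc, ht⟩ := TopologicalSpace.countable_cover_nhdsWithin hV
  have := (ae_ball_iff htc).2 fun z hz ↦ hVd z (htΩ hz)
  filter_upwards [this] with y hy hyΩ
  obtain ⟨z, hz, hyz⟩ := Set.mem_iUnion₂.1 (ht hyΩ)
  exact hy z hz hyz

lemma _root_.LocallyLipschitzOn.locallyIntegrableOn_fderiv {F : Type*} [NormedAddCommGroup F]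
    [NormedSpace ℝ F] [FiniteDimensional ℝ F] {w : E → F} {Ω : Set E} (μ : Measure E)
    [IsLocallyFiniteMeasure μ] (hw : LocallyLipschitzOn Ω w) (hΩ : IsOpen Ω) :
    LocallyIntegrableOn (fderiv ℝ w) Ω μ := by
  intro z hz
  obtain ⟨C, V, hV, hVo, hVΩ, -, hC⟩ := hw.exists_norm_fderiv_le hΩ hz
  obtain ⟨W, hW, hWμ⟩ := μ.finiteAt_nhds z
  have : FiniteDimensional ℝ (E →L[ℝ] F) := inferInstance
  refine ⟨V ∩ W, mem_nhdsWithin_of_mem_nhds (inter_mem hV hW), ?_⟩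
  borelize F
  refine Measure.integrableOn_of_bounded (M := C) ((measure_mono Set.inter_subset_right).trans_lt hWμ).ne ?_ ?_
  · exact (measurable_fderiv ℝ w).aestronglyMeasurable
  · exact ae_restrict_of_ae_restrict_of_subset Set.inter_subset_left
      ((ae_restrict_iff' hVo.measurableSet).2 (.of_forall hC))

/-- On a compact neighbourhood of the support of `η` the function is Lipschitz and extends to a
global Lipschitz function, for which integration by parts is known. The support lies in the interior
of that neighbourhood, so the derivatives of `w` and its extension agree there. -/
lemma _root_.LocallyLipschitzOn.integral_fderiv_smul {w : E → ℝ} {Ω : Set E} (μ : Measure E)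
    [μ.IsAddHaarMeasure] (hw : LocallyLipschitzOn Ω w) (hΩ : IsOpen Ω) {η : E → ℝ}
    (hη : ContDiff ℝ ∞ η) (hηc : HasCompactSupport η) (hηΩ : tsupport η ⊆ Ω) (v : E) :
    ∫ z, fderiv ℝ η z v * w z ∂μ = -∫ z, η z * fderiv ℝ w z v ∂μ := by
  obtain ⟨K, hK, hKη, hKΩ⟩ := exists_compact_between hηc.isCompact hΩ hηΩ
  obtain ⟨C, hC⟩ := (hw.mono hKΩ).exists_lipschitzOnWith_of_compact hK
  obtain ⟨g, hg, hgw⟩ := hC.extend_real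
  obtain ⟨D, hD⟩ := hη.lipschitzWith_of_hasCompactSupport hηc (by simp)
  have h := LipschitzWith.integral_lineDeriv_mul_eq (μ := μ) hg hD hηc v
  have hdη : ∀ z v, lineDeriv ℝ η z v = fderiv ℝ η z v := fun z v ↦
    (hη.differentiable (by simp) z).lineDeriv_eq_fderiv
  have h1 : ∫ z, lineDeriv ℝ g z v * η z ∂μ = ∫ z, η z * fderiv ℝ w z v ∂μ := by
    refine integral_congr_ae ?_
    filter_upwards [hg.ae_differentiableAt (μ := μ)] with z hz
    by_cases hzη : z ∈ tsupport η
    · have : g =ᶠ[𝓝 z] w := by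
        filter_upwards [mem_interior_iff_mem_nhds.1 (hKη hzη)] with y hy using (hgw hy).symm
      rw [hz.lineDeriv_eq_fderiv, this.fderiv_eq, mul_comm]
    · simp [image_eq_zero_of_notMem_tsupport hzη]
  have h2 : ∫ z, lineDeriv ℝ η z (-v) * g z ∂μ = -∫ z, fderiv ℝ η z v * w z ∂μ := by
    rw [← integral_neg]
    refine integral_congr_ae (.of_forall fun z ↦ ?_)
    simp only [hdη, map_neg, neg_mul]
    by_cases hzη : z ∈ tsupport η
    · rw [hgw (interior_subset (hKη hzη))]
    · have : fderiv ℝ η z = 0 :=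
        image_eq_zero_of_notMem_tsupport (fun h ↦ hzη (tsupport_fderiv_subset ℝ h))
      simp [this]
  rw [h1, h2] at h
  rw [h, neg_neg]

lemma _root_.LocallyLipschitzOn.integral_fderiv_smul_euclidean {m : ℕ}
    {w : E → EuclideanSpace ℝ (Fin m)} {Ω : Set E} (μ : Measure E)
    [μ.IsAddHaarMeasure] (hw : LocallyLipschitzOn Ω w) (hΩ : IsOpen Ω) {η : E → ℝ}
    (hη : ContDiff ℝ ∞ η) (hηc : HasCompactSupport η) (hηΩ : tsupport η ⊆ Ω) (v : E) :
    ∫ z, fderiv ℝ η z v • w z ∂μ = -∫ z, η z • fderiv ℝ w z v ∂μ := by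
  have hΩm := hΩ.measurableSet
  have hi1 : Integrable (fun z ↦ fderiv ℝ η z v • w z) μ := by
    have hs : Function.support (fun z ↦ fderiv ℝ η z v • w z) ⊆ tsupport η := by
      intro z hz
      by_contra hzη
      have : fderiv ℝ η z = 0 :=
        image_eq_zero_of_notMem_tsupport (fun h ↦ hzη (tsupport_fderiv_subset ℝ h))
      simp [this] at hz
    rw [← integrableOn_iff_integrable_of_support_subset hs]
    refine ContinuousOn.integrableOn_compact hηc.isCompact ?_
    exact (((hη.continuous_fderiv (by simp)).clm_apply continuous_const).continuousOn).smul
      (hw.continuousOn.mono hηΩ)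
  have hi2 : Integrable (fun z ↦ η z • fderiv ℝ w z v) μ := by
    have hs : Function.support (fun z ↦ η z • fderiv ℝ w z v) ⊆ tsupport η := by
      intro z hz
      by_contra hzη
      simp [image_eq_zero_of_notMem_tsupport hzη] at hz
    rw [← integrableOn_iff_integrable_of_support_subset hs]
    have h1 := (hw.locallyIntegrableOn_fderiv μ hΩ).integrableOn_compact_subset hηΩ hηc.isCompact
    have h2 : IntegrableOn (fun z ↦ fderiv ℝ w z v) (tsupport η) μ :=
      (ContinuousLinearMap.apply ℝ (EuclideanSpace ℝ (Fin m)) v).integrable_comp h1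
    exact h2.continuousOn_smul hη.continuous.continuousOn hηc.isCompact
  ext a
  have hwa : LocallyLipschitzOn Ω (fun z ↦ w z a) := by
    intro z hz
    obtain ⟨C, V, hV, hC⟩ := hw hz
    exact ⟨_, V, hV, (EuclideanSpace.proj (𝕜 := ℝ) a).lipschitz.comp_lipschitzOnWith hC⟩
  rw [eval_integral_piLp (fun i ↦ (EuclideanSpace.proj (𝕜 := ℝ) i).integrable_comp hi1), PiLp.neg_apply,
    eval_integral_piLp (fun i ↦ (EuclideanSpace.proj (𝕜 := ℝ) i).integrable_comp hi2)]
  simp only [PiLp.smul_apply, smul_eq_mul]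
  rw [hwa.integral_fderiv_smul μ hΩ hη hηc hηΩ v]
  congr 1
  refine integral_congr_ae ?_
  have := hw.ae_differentiableAt μ hΩ
  rw [ae_restrict_iff' hΩm] at this
  filter_upwards [this] with z hz
  by_cases hzη : z ∈ tsupport η
  · have h3 := ((EuclideanSpace.proj (𝕜 := ℝ) a).hasFDerivAt.comp z (hz (hηΩ hzη)).hasFDerivAt).fderiv
    congr 1
    exact congr($h3 v)
  · simp [image_eq_zero_of_notMem_tsupport hzη]

end Euclidean

/-! ### Weak and classical differentials of Lipschitz maps -/

section Differential

variable {n : ℕ} {M : Type*} [EMetricSpace M] [ChartedSpace (EuclideanSpace ℝ (Fin n)) M]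

variable (n) in
/-- The classical differential, with junk value `0` at points of nondifferentiability. -/
noncomputable def differential (u : M → Plane) (x : M) : TangentSpace (𝓡 n) x →L[ℝ] Plane :=
  mfderiv (𝓡 n) 𝓘(ℝ, Plane) u x

variable [IsManifold (𝓡 n) ∞ M]

lemma mdifferentiableAt_extChartAt_symm (x₀ : M) {z : EuclideanSpace ℝ (Fin n)}
    (hz : z ∈ (extChartAt (𝓡 n) x₀).target) :
    MDifferentiableAt 𝓘(ℝ, EuclideanSpace ℝ (Fin n)) (𝓡 n) (extChartAt (𝓡 n) x₀).symm z :=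
  ((contMDiffOn_extChartAt_symm (n := ∞) (I := 𝓡 n) x₀).mdifferentiableOn
    (by simp)).mdifferentiableAt ((isOpen_extChartAt_target x₀).mem_nhds hz)

lemma mdifferentiableAt_iff_chart {F : Type*} [NormedAddCommGroup F] [NormedSpace ℝ F]
    (u : M → F) (x₀ : M) {z : EuclideanSpace ℝ (Fin n)} (hz : z ∈ (extChartAt (𝓡 n) x₀).target) :
    MDifferentiableAt (𝓡 n) 𝓘(ℝ, F) u ((extChartAt (𝓡 n) x₀).symm z) ↔
      DifferentiableAt ℝ (fun z ↦ u ((extChartAt (𝓡 n) x₀).symm z)) z := by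
  have hs := mdifferentiableAt_extChartAt_symm x₀ hz
  have hsrc := (extChartAt (𝓡 n) x₀).map_target hz
  refine ⟨fun h ↦ mdifferentiableAt_iff_differentiableAt.1 (h.comp z hs), fun h ↦ ?_⟩
  have he : MDifferentiableAt (𝓡 n) 𝓘(ℝ, EuclideanSpace ℝ (Fin n)) (extChartAt (𝓡 n) x₀)
      ((extChartAt (𝓡 n) x₀).symm z) :=
    mdifferentiableAt_extChartAt (by simpa [extChartAt_source] using hsrc)
  have h' : MDifferentiableAt 𝓘(ℝ, EuclideanSpace ℝ (Fin n)) 𝓘(ℝ, F)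
      (fun z ↦ u ((extChartAt (𝓡 n) x₀).symm z))
      (extChartAt (𝓡 n) x₀ ((extChartAt (𝓡 n) x₀).symm z)) := by
    rw [(extChartAt (𝓡 n) x₀).right_inv hz]
    exact h.mdifferentiableAt
  refine (h'.comp _ he).congr_of_eventuallyEq ?_
  filter_upwards [(isOpen_extChartAt_source (I := 𝓡 n) x₀).mem_nhds hsrc] with p hp
  simp only [Function.comp_apply, (extChartAt (𝓡 n) x₀).left_inv hp]

lemma mfderiv_comp_coordFrame {F : Type*} [NormedAddCommGroup F] [NormedSpace ℝ F]
    (u : M → F) (x₀ : M) {z : EuclideanSpace ℝ (Fin n)}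
    (hz : z ∈ (extChartAt (𝓡 n) x₀).target) (v : EuclideanSpace ℝ (Fin n)) :
    mfderiv (𝓡 n) 𝓘(ℝ, F) u ((extChartAt (𝓡 n) x₀).symm z) (coordFrame n x₀ z v) =
      fderiv ℝ (fun z ↦ u ((extChartAt (𝓡 n) x₀).symm z)) z v := by
  by_cases h : MDifferentiableAt (𝓡 n) 𝓘(ℝ, F) u ((extChartAt (𝓡 n) x₀).symm z)
  · have h1 := mfderiv_comp z h (mdifferentiableAt_extChartAt_symm x₀ hz)
    rw [mfderiv_eq_fderiv] at h1
    exact congr($h1.symm v)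
  · rw [mfderiv_zero_of_not_mdifferentiableAt h,
      fderiv_zero_of_not_differentiableAt (fun h' ↦ h ((mdifferentiableAt_iff_chart u x₀ hz).2 h'))]
    rfl

lemma differential_comp_coordFrame (u : M → Plane) (x₀ : M) {z : EuclideanSpace ℝ (Fin n)}
    (hz : z ∈ (extChartAt (𝓡 n) x₀).target) :
    (differential n u ((extChartAt (𝓡 n) x₀).symm z)).comp (coordFrame n x₀ z) =
      fderiv ℝ (fun z ↦ u ((extChartAt (𝓡 n) x₀).symm z)) z :=
  ContinuousLinearMap.ext fun v ↦ mfderiv_comp_coordFrame u x₀ hz v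

/-- The fundamental lemma of the calculus of variations, applied to each coordinate vector field;
these fields span the tangent space. -/
lemma HasWeakDifferential.ae_eq_chart {u : M → Plane}
    {U V : ∀ x : M, TangentSpace (𝓡 n) x →L[ℝ] Plane} (hU : HasWeakDifferential u U)
    (hV : HasWeakDifferential u V) (x₀ : M) :
    ∀ᵐ z ∂(volume.restrict (extChartAt (𝓡 n) x₀).target),
      U ((extChartAt (𝓡 n) x₀).symm z) = V ((extChartAt (𝓡 n) x₀).symm z) := by
  have hΩ : IsOpen (extChartAt (𝓡 n) x₀).target := isOpen_extChartAt_target x₀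
  obtain ⟨-, hU1, hU2⟩ := hU x₀
  obtain ⟨-, hV1, hV2⟩ := hV x₀
  have h1 := hU1.sub hV1
  have key : ∀ i : Fin n, ∀ᵐ z ∂(volume : Measure (EuclideanSpace ℝ (Fin n))),
      z ∈ (extChartAt (𝓡 n) x₀).target →
      U ((extChartAt (𝓡 n) x₀).symm z) (coordFrame n x₀ z (EuclideanSpace.single i 1)) -
      V ((extChartAt (𝓡 n) x₀).symm z) (coordFrame n x₀ z (EuclideanSpace.single i 1)) = 0 := by
    intro i
    have apply_int : ∀ {W : EuclideanSpace ℝ (Fin n) → EuclideanSpace ℝ (Fin n) →L[ℝ] Plane} ,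
        LocallyIntegrableOn W (extChartAt (𝓡 n) x₀).target volume →
        LocallyIntegrableOn (fun z ↦ W z (EuclideanSpace.single i 1))
          (extChartAt (𝓡 n) x₀).target volume := by
      intro W hW z hz
      obtain ⟨S, hS, h⟩ := hW z hz
      exact ⟨S, hS, (ContinuousLinearMap.apply ℝ Plane
        (EuclideanSpace.single i 1 : EuclideanSpace ℝ (Fin n))).integrable_comp h⟩
    refine hΩ.ae_eq_zero_of_integral_contDiff_smul_eq_zero (apply_int h1) fun η hη hηc hηΩ ↦ ?_
    have int : ∀ {w : EuclideanSpace ℝ (Fin n) → Plane},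
        LocallyIntegrableOn w (extChartAt (𝓡 n) x₀).target volume →
        Integrable (fun z ↦ η z • w z) := by
      intro w hw
      have hs : Function.support (fun z ↦ η z • w z) ⊆ tsupport η := by
        intro z hz
        by_contra hzη
        simp [image_eq_zero_of_notMem_tsupport hzη] at hz
      rw [← integrableOn_iff_integrable_of_support_subset hs]
      exact (hw.integrableOn_compact_subset hηΩ hηc.isCompact).continuousOn_smul
        hη.continuous.continuousOn hηc.isCompact
    have e := (hU2 η hη hηc hηΩ (EuclideanSpace.single i 1)).symm.trans
      (hV2 η hη hηc hηΩ (EuclideanSpace.single i 1))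
    have e2 := integral_sub (int (apply_int hU1)) (int (apply_int hV1))
    refine Eq.trans ?_ (e2.trans (sub_eq_zero.2 (neg_injective e)))
    refine integral_congr_ae (.of_forall fun z ↦ ?_)
    exact smul_sub _ _ _
  rw [ae_restrict_iff' hΩ.measurableSet]
  filter_upwards [ae_all_iff.2 key] with z hz hzt
  have e : (U ((extChartAt (𝓡 n) x₀).symm z)).comp (coordFrame n x₀ z) =
      (V ((extChartAt (𝓡 n) x₀).symm z)).comp (coordFrame n x₀ z) := by
    have := (EuclideanSpace.basisFun (Fin n) ℝ).toBasis.ext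
      (f₁ := ((U ((extChartAt (𝓡 n) x₀).symm z)).comp (coordFrame n x₀ z) :
        EuclideanSpace ℝ (Fin n) →ₗ[ℝ] Plane))
      (f₂ := ((V ((extChartAt (𝓡 n) x₀).symm z)).comp (coordFrame n x₀ z) :
        EuclideanSpace ℝ (Fin n) →ₗ[ℝ] Plane)) (fun i ↦ by
          simp only [OrthonormalBasis.coe_toBasis, EuclideanSpace.basisFun_apply]
          exact sub_eq_zero.1 (hz i hzt))
    exact ContinuousLinearMap.coe_injective this
  refine ContinuousLinearMap.ext fun w ↦ ?_
  have := congr($e (mfderiv (𝓡 n) 𝓘(ℝ, EuclideanSpace ℝ (Fin n)) (extChartAt (𝓡 n) x₀)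
    ((extChartAt (𝓡 n) x₀).symm z) w))
  have h2 := coordFrame_comp_mfderiv_extChartAt x₀ hzt w
  exact (congrArg (U ((extChartAt (𝓡 n) x₀).symm z)) h2).symm.trans
    (this.trans (congrArg (V ((extChartAt (𝓡 n) x₀).symm z)) h2))

variable [RiemannianBundle (fun x : M ↦ TangentSpace (𝓡 n) x)]
  [IsContinuousRiemannianBundle (EuclideanSpace ℝ (Fin n)) (fun x : M ↦ TangentSpace (𝓡 n) x)]
  [IsRiemannianManifold (𝓡 n) M]

variable (n) in
-- The Lipschitz bound is available only near the centre of a chart; elsewhere the inverse chart is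
-- factored through the chart centred at the point in question and a $C^1$ transition map.
lemma locallyLipschitzOn_extChartAt_symm (x₀ : M) :
    LocallyLipschitzOn (extChartAt (𝓡 n) x₀).target (extChartAt (𝓡 n) x₀).symm := by
  intro z hz
  set p := (extChartAt (𝓡 n) x₀).symm z
  obtain ⟨C, -, r, hr, hC⟩ := eventually_edist_symm_le (n := n) p
  have hτ : ContDiffAt ℝ 1 (fun w ↦ extChartAt (𝓡 n) p ((extChartAt (𝓡 n) x₀).symm w)) z := by
    rw [← contMDiffAt_iff_contDiffAt]
    have h1 : ContMDiffAt 𝓘(ℝ, EuclideanSpace ℝ (Fin n)) (𝓡 n) 1 (extChartAt (𝓡 n) x₀).symm z :=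
      (contMDiffOn_extChartAt_symm (n := 1) (I := 𝓡 n) x₀).contMDiffAt
        ((isOpen_extChartAt_target x₀).mem_nhds hz)
    exact (contMDiffAt_extChartAt (n := 1) (I := 𝓡 n) (x := p)).comp z h1
  obtain ⟨D, V, hV, hD⟩ := hτ.exists_lipschitzOnWith
  have hcont : ContinuousAt (extChartAt (𝓡 n) x₀).symm z :=
    (mdifferentiableAt_extChartAt_symm x₀ hz).continuousAt
  have h1 : (extChartAt (𝓡 n) x₀).symm ⁻¹' (extChartAt (𝓡 n) p).source ∈ 𝓝 z :=
    hcont.preimage_mem_nhds (extChartAt_source_mem_nhds p)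
  have h2 : (fun w ↦ extChartAt (𝓡 n) p ((extChartAt (𝓡 n) x₀).symm w)) ⁻¹'
      (Metric.ball (extChartAt (𝓡 n) p p) r) ∈ 𝓝 z :=
    hτ.continuousAt.preimage_mem_nhds (Metric.ball_mem_nhds _ hr)
  refine ⟨C * D, _, mem_nhdsWithin_of_mem_nhds (inter_mem hV (inter_mem h1 h2)), ?_⟩
  have h3 := hC.comp (hD.mono Set.inter_subset_left)
    (s := V ∩ ((extChartAt (𝓡 n) x₀).symm ⁻¹' (extChartAt (𝓡 n) p).source ∩ _)) (fun w hw ↦ hw.2.2)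
  intro x hx y hy
  have := h3 hx hy
  simp only [Function.comp_apply, (extChartAt (𝓡 n) p).left_inv hx.2.1,
    (extChartAt (𝓡 n) p).left_inv hy.2.1] at this
  exact this

lemma _root_.LipschitzWith.locallyLipschitzOn_chart {u : M → Plane} {K : ℝ≥0}
    (hu : LipschitzWith K u) (x₀ : M) : LocallyLipschitzOn (extChartAt (𝓡 n) x₀).target
      (fun z ↦ u ((extChartAt (𝓡 n) x₀).symm z)) := by
  intro z hz
  obtain ⟨C, V, hV, hC⟩ := locallyLipschitzOn_extChartAt_symm n x₀ hz
  exact ⟨K * C, V, hV, hu.comp_lipschitzOnWith hC⟩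

lemma hasWeakDifferential_differential {u : M → Plane} {K : ℝ≥0} (hu : LipschitzWith K u) :
    HasWeakDifferential u (differential n u) := by
  intro x₀
  have hw := hu.locallyLipschitzOn_chart (n := n) x₀
  have hΩ : IsOpen (extChartAt (𝓡 n) x₀).target := isOpen_extChartAt_target x₀
  refine ⟨hw.continuousOn.locallyIntegrableOn hΩ.measurableSet, ?_, ?_⟩
  · intro z hz
    obtain ⟨S, hS, h⟩ := hw.locallyIntegrableOn_fderiv volume hΩ z hz
    refine ⟨S ∩ (extChartAt (𝓡 n) x₀).target, inter_mem hS self_mem_nhdsWithin,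
      (h.mono_set Set.inter_subset_left).congr_fun_ae ?_⟩
    refine ae_restrict_of_ae_restrict_of_subset Set.inter_subset_right
      ((ae_restrict_iff' hΩ.measurableSet).2 (.of_forall fun y hy ↦ ?_))
    exact (differential_comp_coordFrame u x₀ hy).symm
  · intro η hη hηc hηΩ v
    rw [hw.integral_fderiv_smul_euclidean volume hΩ hη hηc hηΩ v]
    congr 1
    refine integral_congr_ae (.of_forall fun z ↦ ?_)
    by_cases hz : z ∈ tsupport η
    · exact congrArg (fun w : Plane ↦ η z • w) (mfderiv_comp_coordFrame u x₀ (hηΩ hz) v).symm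
    · simp [image_eq_zero_of_notMem_tsupport hz]

lemma weakDifferential_ae_eq [CompactSpace M] [MeasurableSpace M] [BorelSpace M]
    {u : M → Plane} {K : ℝ≥0} (hu : LipschitzWith K u) :
    ∀ᵐ x ∂(riemannianVolume n M), weakDifferential n u x = differential n u x := by
  have h := hasWeakDifferential_differential (n := n) hu
  have hex : ∃ U : ∀ x : M, TangentSpace (𝓡 n) x →L[ℝ] Plane, HasWeakDifferential u U := ⟨_, h⟩
  have h2 : weakDifferential n u = hex.choose := by
    funext x; simp only [weakDifferential, dif_pos hex]
  rw [h2]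
  exact ae_riemannianVolume_of_ae_chart fun x₀ ↦ hex.choose_spec.ae_eq_chart h x₀

lemma _root_.LipschitzWith.ae_mdifferentiableAt [CompactSpace M] [MeasurableSpace M] [BorelSpace M]
    {u : M → Plane} {K : ℝ≥0} (hu : LipschitzWith K u) :
    ∀ᵐ x ∂(riemannianVolume n M), MDifferentiableAt (𝓡 n) 𝓘(ℝ, Plane) u x := by
  refine ae_riemannianVolume_of_ae_chart fun x₀ ↦ ?_
  have hΩ : IsOpen (extChartAt (𝓡 n) x₀).target := isOpen_extChartAt_target x₀
  filter_upwards [(hu.locallyLipschitzOn_chart (n := n) x₀).ae_differentiableAt volume hΩ,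
    ae_restrict_mem hΩ.measurableSet] with z hz hzt
  exact (mdifferentiableAt_iff_chart u x₀ hzt).2 hz

variable (n M) in
-- The constant comes from the charts alone and is made uniform by compactness. The bound holds at
-- every point, since the differential is zero by convention where `u` is not differentiable.
lemma exists_norm_differential_le [CompactSpace M] : ∃ C : ℝ≥0, ∀ (u : M → Plane) (K : ℝ≥0),
    LipschitzWith K u → ∀ x v, ‖differential n u x v‖ ≤ C * K * ‖v‖ := by
  have h1 : ∀ x₀ : M, ∃ C : ℝ≥0, ∃ V ∈ 𝓝 x₀, ∀ (u : M → Plane) (K : ℝ≥0),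
    LipschitzWith K u → ∀ x ∈ V, ∀ v, ‖differential n u x v‖ ≤ C * K * ‖v‖ := by
    intro x₀
    obtain ⟨C, -, r, hr, hC⟩ := eventually_edist_symm_le (n := n) x₀
    obtain ⟨D, -, hD⟩ := eventually_mfderiv_extChartAt_le (n := n) x₀
    refine ⟨C * D, _, inter_mem hD (inter_mem (extChartAt_source_mem_nhds (I := 𝓡 n) x₀)
      ((continuousAt_extChartAt (I := 𝓡 n) x₀).preimage_mem_nhds (Metric.ball_mem_nhds _ hr))),
      fun u K hu x ⟨hxD, hxs, hxb⟩ v ↦ ?_⟩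
    set z := extChartAt (𝓡 n) x₀ x
    have hzt : z ∈ (extChartAt (𝓡 n) x₀).target := (extChartAt (𝓡 n) x₀).map_source hxs
    have hzx : (extChartAt (𝓡 n) x₀).symm z = x := (extChartAt (𝓡 n) x₀).left_inv hxs
    have hf : ‖fderiv ℝ (fun z ↦ u ((extChartAt (𝓡 n) x₀).symm z)) z‖ ≤ ((K * C : ℝ≥0) : ℝ) :=
      norm_fderiv_le_of_lipschitzOn ℝ (Metric.isOpen_ball.mem_nhds hxb)
        (hu.comp_lipschitzOnWith hC)
    -- A variable base point allows `x` to be replaced by the image of `z` together with its tangent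
    -- space.
    have h2 : ∀ p (_ : p = x) (v : TangentSpace (𝓡 n) p), p = (extChartAt (𝓡 n) x₀).symm z → 
        ‖differential n u p v‖ ≤ (K * C : ℝ≥0) * (D * ‖v‖) := by
      rintro p hp v hpz
      subst hpz
      obtain ⟨w, hw⟩ : ∃ w : EuclideanSpace ℝ (Fin n), w = mfderiv (𝓡 n)
        𝓘(ℝ, EuclideanSpace ℝ (Fin n)) (extChartAt (𝓡 n) x₀) ((extChartAt (𝓡 n) x₀).symm z) v :=
        ⟨_, rfl⟩
      have h3 := mfderiv_comp_coordFrame u x₀ hzt w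
      rw [hw, coordFrame_comp_mfderiv_extChartAt x₀ hzt, ← hw] at h3
      have h4 : ‖w‖ ≤ D * ‖v‖ := by
        have hxD' : (extChartAt (𝓡 n) x₀).symm z ∈ _ := hzx.symm ▸ hxD
        rw [hw]
        exact hxD' v
      refine (le_of_eq (congrArg (fun w : Plane ↦ ‖w‖) h3)).trans ?_
      exact (ContinuousLinearMap.le_opNorm _ _).trans
        (mul_le_mul hf h4 (norm_nonneg _) (NNReal.coe_nonneg _))
    refine (h2 x rfl v hzx.symm).trans_eq ?_
    push_cast; ring
  choose C V hV hC using h1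
  obtain ⟨t, ht⟩ := isCompact_univ.elim_nhds_subcover V (fun x _ ↦ hV x)
  refine ⟨t.sup C, fun u K hu x v ↦ ?_⟩
  obtain ⟨x₀, hx₀, hx⟩ := Set.mem_iUnion₂.1 (ht.2 (Set.mem_univ x))
  refine (hC x₀ u K hu x hx v).trans ?_
  have : C x₀ ≤ t.sup C := Finset.le_sup hx₀
  exact mul_le_mul_of_nonneg_right (mul_le_mul_of_nonneg_right (by exact_mod_cast this) K.2)
    (norm_nonneg (E := TangentSpace (𝓡 n) x) v)

end Differential

/-! ### The maps $v_{y,\epsilon}$ -/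

section Vortex

/-- The retraction `z ↦ z / max s |z|` onto the unit disk. -/
noncomputable def unitScale (s : ℝ) (z : Plane) : Plane := (max s ‖z‖)⁻¹ • z

lemma vortex_eq {ε : ℝ} (z : Plane) : vortex ε z = unitScale ε z := by
  unfold vortex unitScale
  split_ifs with h
  · rw [max_eq_right h.le]
  · rw [max_eq_left (not_lt.1 h)]

lemma norm_unitScale_le {s : ℝ} (z : Plane) : ‖unitScale s z‖ ≤ 1 := by
  rw [unitScale, norm_smul, norm_inv, Real.norm_eq_abs]
  rcases le_or_gt (max s ‖z‖) 0 with h | h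
  · have : ‖z‖ = 0 := le_antisymm ((le_max_right _ _).trans h) (norm_nonneg _)
    simp [this]
  · rw [abs_of_pos h, inv_mul_le_one₀ h]
    exact le_max_right _ _

/-- The denominator involves `z` only, so this also bounds the derivative at `z` by $2/\max(s,|z|)$,
which decays away from the vortex. One unit of the factor 2 comes from moving the numerator, the
other from the denominator. -/
lemma norm_unitScale_sub_le {s : ℝ} (hs : 0 < s) (z z' : Plane) :
    ‖unitScale s z' - unitScale s z‖ ≤ 2 / max s ‖z‖ * ‖z' - z‖ := by
  have hm : 0 < max s ‖z‖ := lt_max_of_lt_left hs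
  have hm' : 0 < max s ‖z'‖ := lt_max_of_lt_left hs
  have e : unitScale s z' - unitScale s z = (max s ‖z‖)⁻¹ • ((z' - z) +
      ((max s ‖z‖ - max s ‖z'‖) / max s ‖z'‖) • z') := by
    unfold unitScale
    rw [smul_add, smul_sub, smul_smul]
    have : (max s ‖z‖)⁻¹ * ((max s ‖z‖ - max s ‖z'‖) / max s ‖z'‖) =
        (max s ‖z'‖)⁻¹ - (max s ‖z‖)⁻¹ := by field_simp
    rw [this, sub_smul]
    abel
  have h1 : |max s ‖z‖ - max s ‖z'‖| ≤ ‖z' - z‖ :=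
    (abs_max_sub_max_le_max _ _ _ _).trans (by
      rw [sub_self, abs_zero, norm_sub_rev, max_eq_right (abs_nonneg _)]
      exact abs_norm_sub_norm_le z z')
  rw [e, norm_smul, norm_inv, Real.norm_eq_abs, abs_of_pos hm]
  have h2 : ‖((max s ‖z‖ - max s ‖z'‖) / max s ‖z'‖) • z'‖ ≤ ‖z' - z‖ := by
    rw [norm_smul, norm_div, Real.norm_eq_abs, Real.norm_eq_abs, abs_of_pos hm', div_mul_eq_mul_div,
      div_le_iff₀ hm']
    exact mul_le_mul h1 (le_max_right _ _) (norm_nonneg _) (norm_nonneg _)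
  calc _ ≤ (max s ‖z‖)⁻¹ * (‖z' - z‖ + ‖z' - z‖) := by
        gcongr
        exact (norm_add_le _ _).trans (by gcongr)
    _ = _ := by ring

lemma Disk.norm_le (y : Disk) : ‖(y : Plane)‖ ≤ 1 := mem_closedBall_zero_iff.1 y.2

/-- The argument `z + y / (1 - |y|)` rescaled by `1 - |y|`. -/
noncomputable def diskTranslate (y : Disk) (w : Plane) : Plane :=
  (1 - ‖(y : Plane)‖) • w + (y : Plane)

lemma continuous_diskTranslate (w : Plane) : Continuous fun y ↦ diskTranslate y w := by
  unfold diskTranslate; fun_prop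

lemma diskTranslate_eq_smul {y : Disk} (hy : ‖(y : Plane)‖ < 1) (w : Plane) :
    diskTranslate y w =
      (1 - ‖(y : Plane)‖) • (w + (1 - ‖(y : Plane)‖)⁻¹ • (y : Plane)) := by
  rw [smul_add, smul_smul, mul_inv_cancel₀ (by linarith), one_smul, diskTranslate]

lemma max_diskTranslate_pos {ε : ℝ} (hε : 0 < ε) (y : Disk) (w : Plane) :
    0 < max (ε * (1 - ‖(y : Plane)‖)) ‖diskTranslate y w‖ := by
  rcases y.norm_le.lt_or_eq with h | h
  · exact lt_max_of_lt_left (mul_pos hε (by linarith))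
  · exact lt_max_of_lt_right (by simp [diskTranslate, h])

/-- The retraction $z/\max(s,|z|)$ is unchanged when $s$ and $z$ are scaled together; scaling by
$1-|y|$ removes the blow-up of $y/(1-|y|)$, and at $|y|=1$ the formula returns $y$. The denominator
never vanishes, so continuity in $y$ is immediate. -/
lemma vortexFamily_eq {ε : ℝ} (y : Disk) (w : Plane) :
    vortexFamily ε y w = unitScale (ε * (1 - ‖(y : Plane)‖)) (diskTranslate y w) := by
  unfold vortexFamily
  split_ifs with h
  · have ht : 0 < 1 - ‖(y : Plane)‖ := by linarith
    rw [vortex_eq, diskTranslate_eq_smul h, unitScale, unitScale, norm_smul, Real.norm_eq_abs,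
      abs_of_pos ht, mul_comm ε, ← mul_max_of_nonneg _ _ ht.le, smul_smul, mul_inv,
      mul_comm _⁻¹ _⁻¹, mul_assoc, inv_mul_cancel₀ ht.ne', mul_one]
  · have h1 : ‖(y : Plane)‖ = 1 := le_antisymm y.norm_le (not_lt.1 h)
    simp [unitScale, diskTranslate, h1]

lemma norm_vortexFamily_le {ε : ℝ} (y : Disk) (w : Plane) : ‖vortexFamily ε y w‖ ≤ 1 := by
  rw [vortexFamily_eq]; exact norm_unitScale_le _

lemma vortexFamily_of_norm_eq_one {ε : ℝ} {y : Disk} (hy : ‖(y : Plane)‖ = 1) (w : Plane) :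
    vortexFamily ε y w = y := by
  simp [vortexFamily, hy]

lemma norm_vortexFamily_sub_le {ε : ℝ} (hε : 0 < ε) {y : Disk} (hy : ‖(y : Plane)‖ < 1)
    (w w' : Plane) : ‖vortexFamily ε y w' - vortexFamily ε y w‖ ≤
      2 / max ε ‖w + (1 - ‖(y : Plane)‖)⁻¹ • (y : Plane)‖ * ‖w' - w‖ := by
  simp only [vortexFamily, hy, if_true, vortex_eq]
  refine (norm_unitScale_sub_le hε _ _).trans_eq ?_
  rw [add_sub_add_right_eq_sub]

lemma lipschitzWith_vortexFamily {ε : ℝ} (hε : 0 < ε) (y : Disk) :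
    LipschitzWith (2 / ε).toNNReal (vortexFamily ε y) := by
  refine LipschitzWith.of_dist_le_mul fun w' w ↦ ?_
  rw [Real.coe_toNNReal _ (by positivity), dist_eq_norm, dist_eq_norm]
  rcases y.norm_le.lt_or_eq with h | h
  · refine (norm_vortexFamily_sub_le hε h w w').trans ?_
    gcongr
    exact le_max_left _ _
  · rw [vortexFamily_of_norm_eq_one h, vortexFamily_of_norm_eq_one h, sub_self, norm_zero]
    positivity

lemma continuous_vortexFamily_left {ε : ℝ} (hε : 0 < ε) (w : Plane) :
    Continuous fun y ↦ vortexFamily ε y w := by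
  simp only [vortexFamily_eq, unitScale]
  have h := continuous_diskTranslate w
  refine Continuous.smul (Continuous.inv₀ (by fun_prop) fun y ↦ (max_diskTranslate_pos hε y w).ne') h

/-- The set where `v_{y,ε}` may fail to be differentiable. -/
def criticalSet (ε : ℝ) (y : Disk) : Set Plane :=
  {w | ‖diskTranslate y w‖ = ε * (1 - ‖(y : Plane)‖)}

lemma measurableSet_criticalSet (ε : ℝ) (y : Disk) : MeasurableSet (criticalSet ε y) := by
  refine (isClosed_eq ?_ continuous_const).measurableSet
  unfold diskTranslate; fun_prop

lemma volume_criticalSet (ε : ℝ) (hε : 0 < ε) (y : Disk) : volume (criticalSet ε y) = 0 := by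
  rcases y.norm_le.lt_or_eq with h | h
  · have ht : 0 < 1 - ‖(y : Plane)‖ := by linarith
    have : criticalSet ε y = Metric.sphere (-((1 - ‖(y : Plane)‖)⁻¹ • (y : Plane))) ε := by
      ext w
      simp only [criticalSet, Set.mem_ofPred_eq, mem_sphere_iff_norm, sub_neg_eq_add]
      rw [diskTranslate_eq_smul h, norm_smul, Real.norm_eq_abs, abs_of_pos ht, mul_comm,
        mul_left_inj' ht.ne']
    rw [this]
    exact Measure.addHaar_sphere_of_ne_zero _ _ hε.ne'
  · have : criticalSet ε y = ∅ := by
      ext w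
      simp [criticalSet, diskTranslate, h]
    simp [this]

lemma hasFDerivAt_diskTranslate (y : Disk) (w : Plane) :
    HasFDerivAt (diskTranslate y) ((1 - ‖(y : Plane)‖) • ContinuousLinearMap.id ℝ Plane) w := by
  unfold diskTranslate
  exact ((hasFDerivAt_id (𝕜 := ℝ) w).const_smul (1 - ‖(y : Plane)‖)).add_const _

lemma contDiffAt_inv_norm_smul {z : Plane} (hz : z ≠ 0) :
    ContDiffAt ℝ 2 (fun z : Plane ↦ ‖z‖⁻¹ • z) z :=
  ((contDiffAt_norm ℝ hz).inv (norm_ne_zero_iff.2 hz)).smul contDiffAt_id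

lemma hasFDerivAt_vortexFamily_of_lt {ε : ℝ} (hε : 0 < ε) {y : Disk} {w : Plane}
    (h : ε * (1 - ‖(y : Plane)‖) < ‖diskTranslate y w‖) :
    HasFDerivAt (vortexFamily ε y)
      ((1 - ‖(y : Plane)‖) • fderiv ℝ (fun z : Plane ↦ ‖z‖⁻¹ • z) (diskTranslate y w)) w := by
  have h0 : diskTranslate y w ≠ 0 := by
    rw [← norm_pos_iff]
    exact lt_of_le_of_lt (mul_nonneg hε.le (by linarith [y.norm_le])) h
  have h1 := ((contDiffAt_inv_norm_smul h0).differentiableAt (by simp)).hasFDerivAt.comp w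
    (hasFDerivAt_diskTranslate y w)
  have h2 : vortexFamily ε y =ᶠ[𝓝 w] (fun z : Plane ↦ ‖z‖⁻¹ • z) ∘ diskTranslate y := by
    have hc : ContinuousAt (fun w ↦ ‖diskTranslate y w‖) w :=
      (hasFDerivAt_diskTranslate y w).continuousAt.norm
    filter_upwards [hc.eventually (lt_mem_nhds h)] with x hx
    rw [vortexFamily_eq, unitScale, max_eq_right hx.le]
    rfl
  refine (h1.congr_of_eventuallyEq h2).congr_fderiv ?_
  ext v; simp

lemma hasFDerivAt_vortexFamily_of_gt {ε : ℝ} {y : Disk} {w : Plane}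
    (h : ‖diskTranslate y w‖ < ε * (1 - ‖(y : Plane)‖)) :
    HasFDerivAt (vortexFamily ε y) (ε⁻¹ • ContinuousLinearMap.id ℝ Plane) w := by
  have h0 : ε * (1 - ‖(y : Plane)‖) ≠ 0 := (lt_of_le_of_lt (norm_nonneg _) h).ne'
  have h1 := (hasFDerivAt_diskTranslate y w).const_smul (ε * (1 - ‖(y : Plane)‖))⁻¹
  have h2 : vortexFamily ε y =ᶠ[𝓝 w] fun x ↦ (ε * (1 - ‖(y : Plane)‖))⁻¹ • diskTranslate y x := by
    have hc : ContinuousAt (fun w ↦ ‖diskTranslate y w‖) w :=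
      (hasFDerivAt_diskTranslate y w).continuousAt.norm
    filter_upwards [hc.eventually (gt_mem_nhds h)] with x hx
    rw [vortexFamily_eq, unitScale, max_eq_left hx.le]
  refine (h1.congr_of_eventuallyEq h2).congr_fderiv ?_
  rw [smul_smul, mul_inv, mul_assoc, inv_mul_cancel₀ (right_ne_zero_of_mul h0), mul_one]

lemma differentiableAt_vortexFamily {ε : ℝ} (hε : 0 < ε) {y : Disk} {w : Plane}
    (h : w ∉ criticalSet ε y) : DifferentiableAt ℝ (vortexFamily ε y) w := by
  rcases lt_or_gt_of_ne h with h | h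
  · exact (hasFDerivAt_vortexFamily_of_gt h).differentiableAt
  · exact (hasFDerivAt_vortexFamily_of_lt hε h).differentiableAt

lemma eventually_notMem_criticalSet {ε : ℝ} {y₀ : Disk} {w : Plane}
    (h : w ∉ criticalSet ε y₀) : ∀ᶠ y in 𝓝 y₀, w ∉ criticalSet ε y :=
  (isClosed_eq (continuous_diskTranslate w).norm
    (continuous_const.mul (continuous_const.sub continuous_subtype_val.norm))).isOpen_compl.mem_nhds h

/-- Off the critical circle the same branch of the definition stays in force for nearby $y$. At
$|y_0|=1$ this is the outer branch, whose derivative carries the factor $1-|y|$ and tends to zero.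
-/
lemma tendsto_fderiv_vortexFamily {ε : ℝ} (hε : 0 < ε) {y₀ : Disk} {w : Plane}
    (h : w ∉ criticalSet ε y₀) : Tendsto (fun y ↦ fderiv ℝ (vortexFamily ε y) w) (𝓝 y₀)
      (𝓝 (fderiv ℝ (vortexFamily ε y₀) w)) := by
  have hc1 : Continuous fun y : Disk ↦ ‖diskTranslate y w‖ := (continuous_diskTranslate w).norm
  have hc2 : Continuous fun y : Disk ↦ ε * (1 - ‖(y : Plane)‖) := by fun_prop
  rcases lt_or_gt_of_ne h with h | h
  · rw [(hasFDerivAt_vortexFamily_of_gt h).fderiv]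
    refine tendsto_const_nhds.congr' ?_
    filter_upwards [hc1.continuousAt.eventually_lt hc2.continuousAt h] with y hy
    exact (hasFDerivAt_vortexFamily_of_gt hy).fderiv.symm
  · have h0 : diskTranslate y₀ w ≠ 0 := by
      rw [← norm_pos_iff]
      exact lt_of_le_of_lt (mul_nonneg hε.le (by linarith [y₀.norm_le])) h
    rw [(hasFDerivAt_vortexFamily_of_lt hε h).fderiv]
    have h3 : Tendsto (fun y : Disk ↦ (1 - ‖(y : Plane)‖) •
        fderiv ℝ (fun z : Plane ↦ ‖z‖⁻¹ • z) (diskTranslate y w)) (𝓝 y₀)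
        (𝓝 ((1 - ‖(y₀ : Plane)‖) •
          fderiv ℝ (fun z : Plane ↦ ‖z‖⁻¹ • z) (diskTranslate y₀ w))) := by
      have h4 : ContinuousAt (fderiv ℝ (fun z : Plane ↦ ‖z‖⁻¹ • z)) (diskTranslate y₀ w) :=
        ((contDiffAt_inv_norm_smul h0).fderiv_right (m := 1) (by norm_num)).continuousAt
      have h5 : ContinuousAt (fun y : Disk ↦ 1 - ‖(y : Plane)‖) y₀ := by fun_prop
      exact h5.tendsto.smul (h4.tendsto.comp (continuous_diskTranslate w).continuousAt)
    refine h3.congr' ?_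
    filter_upwards [hc2.continuousAt.eventually_lt hc1.continuousAt h] with y hy
    exact (hasFDerivAt_vortexFamily_of_lt hε hy).fderiv.symm

end Vortex

/-! ### The potential on the unit disk -/

section Potential

variable {W : Plane → ℝ}

lemma IsPotential.abs_sub_le (hW : IsPotential W) {p q : Plane} (hp : ‖p‖ ≤ 1) (hq : ‖q‖ ≤ 1) :
    |W p - W q| ≤ ‖p - q‖ := by
  rw [hW.eq_of_norm_lt p (by linarith), hW.eq_of_norm_lt q (by linarith)]
  have h := abs_norm_sub_norm_le p q
  refine le_trans ?_ h
  have e : 1 / 4 * (1 - ‖p‖ ^ 2) ^ 2 - 1 / 4 * (1 - ‖q‖ ^ 2) ^ 2 =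
      (‖p‖ - ‖q‖) * (1 / 4 * (-(‖p‖ + ‖q‖) * (2 - ‖p‖ ^ 2 - ‖q‖ ^ 2))) := by ring
  rw [e, abs_mul]
  have hp0 := norm_nonneg p
  have hq0 := norm_nonneg q
  refine mul_le_of_le_one_right (abs_nonneg _) (abs_le.2 ⟨?_, ?_⟩)
  · nlinarith [mul_nonneg hp0 hq0, sq_nonneg (‖p‖), sq_nonneg ‖q‖,
      mul_nonneg (add_nonneg hp0 hq0) (add_nonneg (sq_nonneg ‖p‖) (sq_nonneg ‖q‖))]
  · nlinarith [mul_nonneg (add_nonneg hp0 hq0)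
      (by nlinarith : (0 : ℝ) ≤ 2 - ‖p‖ ^ 2 - ‖q‖ ^ 2)]

lemma IsPotential.eq_zero_of_norm_eq_one (hW : IsPotential W) {p : Plane} (hp : ‖p‖ = 1) :
    W p = 0 := by
  rw [hW.eq_of_norm_lt p (by linarith), hp]; norm_num

/-- Outside the core $|v|=1$ and $W$ vanishes; inside, the maximum is $\epsilon$ and $W\le1$. -/
lemma IsPotential.vortexFamily_div_le (hW : IsPotential W) {ε : ℝ} (hε : 0 < ε) {y : Disk}
    (hy : ‖(y : Plane)‖ < 1) (w : Plane) : W (vortexFamily ε y w) / ε ^ 2 ≤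
      1 / max ε ‖w + (1 - ‖(y : Plane)‖)⁻¹ • (y : Plane)‖ ^ 2 := by
  set z := w + (1 - ‖(y : Plane)‖)⁻¹ • (y : Plane)
  have e : vortexFamily ε y w = unitScale ε z := by simp [vortexFamily, hy, vortex_eq, z]
  rcases le_or_gt ε ‖z‖ with h | h
  · have : ‖vortexFamily ε y w‖ = 1 := by
      have : ‖z‖ ≠ 0 := (hε.trans_le h).ne'
      rw [e, unitScale, max_eq_right h, norm_smul, norm_inv, norm_norm, inv_mul_cancel₀ this]
    rw [hW.eq_zero_of_norm_eq_one this, zero_div]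
    positivity
  · rw [max_eq_left h.le]
    have h1 := norm_vortexFamily_le (ε := ε) y w
    rw [hW.eq_of_norm_lt _ (by linarith)]
    gcongr
    have := norm_nonneg (vortexFamily ε y w)
    nlinarith [sq_nonneg ‖vortexFamily ε y w‖, (by nlinarith : ‖vortexFamily ε y w‖ ^ 2 ≤ 1)]

end Potential

/-! ### The logarithmic integral -/

section Dyadic

/-- For $m=\max(\epsilon,|w|)<1$ choose $k$ with $2^{-k-1}<m\le2^{-k}$; the term of index $k$ alone
is large enough, and $k\le N$ because $2^{-N}\le\epsilon\le m$. The summand 1 takes care of $m\ge1$.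
-/
lemma one_div_max_sq_le {ε : ℝ} (hε : 0 < ε) (w : Plane) :
    ENNReal.ofReal (1 / max ε ‖w‖ ^ 2) ≤ 1 + ∑ k ∈ Finset.range (⌈Real.logb 2 ε⁻¹⌉₊ + 1),
      (4 : ℝ≥0∞) ^ (k + 1) * (Metric.closedBall (0 : Plane) ((2 : ℝ)⁻¹ ^ k)).indicator 1 w := by
  set N := ⌈Real.logb 2 ε⁻¹⌉₊
  have hm : 0 < max ε ‖w‖ := lt_max_of_lt_left hε
  have hN : (2 : ℝ)⁻¹ ^ N ≤ ε := by
    have h1 : Real.logb 2 ε⁻¹ ≤ N := Nat.le_ceil _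
    rw [Real.logb_le_iff_le_rpow (by norm_num) (inv_pos.2 hε), Real.rpow_natCast] at h1
    rw [inv_pow]
    exact inv_le_of_inv_le₀ hε h1
  rcases le_or_gt 1 (max ε ‖w‖) with h | h
  · refine le_trans ?_ le_self_add
    rw [ENNReal.ofReal_le_one, div_le_one (by positivity)]
    exact one_le_pow₀ h
  have hex : ∃ k, (2 : ℝ)⁻¹ ^ (k + 1) < max ε ‖w‖ := by
    obtain ⟨k, hk⟩ := exists_pow_lt_of_lt_one hm (by norm_num : (2 : ℝ)⁻¹ < 1)
    exact ⟨k, (pow_le_pow_of_le_one (by norm_num) (by norm_num) k.le_succ).trans_lt hk⟩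
  set k := Nat.find hex
  have hk : (2 : ℝ)⁻¹ ^ (k + 1) < max ε ‖w‖ := Nat.find_spec hex
  have hk' : max ε ‖w‖ ≤ (2 : ℝ)⁻¹ ^ k := by
    rcases Nat.eq_zero_or_pos k with h0 | h0
    · simp [h0, h.le]
    · have := Nat.find_min hex (Nat.sub_lt h0 one_pos)
      rw [show Nat.find hex - 1 + 1 = k from Nat.sub_add_cancel h0] at this
      exact not_lt.1 this
  have hkN : k ∈ Finset.range (N + 1) := by
    rw [Finset.mem_range]
    have : k ≤ N := Nat.find_min' hex (lt_of_lt_of_le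
      (lt_of_lt_of_le (pow_lt_pow_right_of_lt_one₀ (by norm_num) (by norm_num) N.lt_succ_self) hN)
      (le_max_left _ _))
    omega
  refine le_trans ?_ (le_trans (Finset.single_le_sum (f := fun k ↦ (4 : ℝ≥0∞) ^ (k + 1) *
    (Metric.closedBall (0 : Plane) ((2 : ℝ)⁻¹ ^ k)).indicator 1 w) (fun _ _ ↦ zero_le) hkN) le_add_self)
  have hmem : w ∈ Metric.closedBall (0 : Plane) ((2 : ℝ)⁻¹ ^ k) :=
    mem_closedBall_zero_iff.2 ((le_max_right _ _).trans hk')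
  simp only [Set.indicator_of_mem hmem, Pi.one_apply, mul_one]
  have h4 : (4 : ℝ≥0∞) ^ (k + 1) = ENNReal.ofReal (4 ^ (k + 1)) := by
    rw [ENNReal.ofReal_pow (by norm_num)]; norm_num
  rw [h4]
  refine ENNReal.ofReal_le_ofReal ?_
  rw [div_le_iff₀ (by positivity)]
  have : (4 : ℝ) ^ (k + 1) * ((2 : ℝ)⁻¹ ^ (k + 1)) ^ 2 = 1 := by
    rw [← pow_mul, mul_comm (k + 1) 2, pow_mul, ← mul_pow]; norm_num
  rw [← this]
  gcongr

/-- In the plane a ball of radius $2^{-k}$ has mass of order $4^{-k}$, which balances the weight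
$4^{k+1}$: every scale costs the same, and counting the scales gives the logarithm. -/
lemma lintegral_one_div_max_sq_le {ν : Measure Plane} {C : ℝ≥0∞}
    (hν : ν ≤ C • volume) {ε : ℝ} (hε : 0 < ε) (a : Plane) :
    ∫⁻ w, ENNReal.ofReal (1 / max ε ‖w + a‖ ^ 2) ∂ν ≤ ν Set.univ +
      4 * C * volume (Metric.closedBall (0 : Plane) 1) * (⌈Real.logb 2 ε⁻¹⌉₊ + 1 : ℕ) := by
  have hball : ∀ k : ℕ, ν (Metric.closedBall (-a) ((2 : ℝ)⁻¹ ^ k)) ≤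
      C * ((4 : ℝ≥0∞)⁻¹ ^ k * volume (Metric.closedBall (0 : Plane) 1)) := by
    intro k
    refine (hν _).trans ?_
    rw [Measure.smul_apply, smul_eq_mul, Measure.addHaar_closedBall' _ _ (by positivity)]
    gcongr
    rw [finrank_euclideanSpace_fin, ← pow_mul, mul_comm k 2, pow_mul,
      ENNReal.ofReal_pow (by positivity)]
    gcongr
    rw [show (2 : ℝ)⁻¹ ^ 2 = (4 : ℝ)⁻¹ by norm_num, ENNReal.ofReal_inv_of_pos (by norm_num)]
    norm_num
  calc ∫⁻ w, ENNReal.ofReal (1 / max ε ‖w + a‖ ^ 2) ∂ν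
      ≤ ∫⁻ w, (1 + ∑ k ∈ Finset.range (⌈Real.logb 2 ε⁻¹⌉₊ + 1), (4 : ℝ≥0∞) ^ (k + 1) *
          (Metric.closedBall (-a) ((2 : ℝ)⁻¹ ^ k)).indicator 1 w) ∂ν := by
        refine lintegral_mono fun w ↦ (one_div_max_sq_le hε (w + a)).trans_eq ?_
        congr 1
        refine Finset.sum_congr rfl fun k _ ↦ ?_
        congr 1
        simp only [Set.indicator, mem_closedBall_iff_norm, sub_neg_eq_add, sub_zero,
          Pi.one_apply]
    _ = ν Set.univ + ∑ k ∈ Finset.range (⌈Real.logb 2 ε⁻¹⌉₊ + 1), (4 : ℝ≥0∞) ^ (k + 1) *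
          ν (Metric.closedBall (-a) ((2 : ℝ)⁻¹ ^ k)) := by
        have hmeas : ∀ k : ℕ, Measurable
            ((Metric.closedBall (-a) ((2 : ℝ)⁻¹ ^ k)).indicator (1 : Plane → ℝ≥0∞)) := fun k ↦
          measurable_one.indicator Metric.isClosed_closedBall.measurableSet
        rw [lintegral_add_left measurable_const, lintegral_one,
          lintegral_finsetSum _ (fun k _ ↦ (hmeas k).const_mul _)]
        congr 1
        refine Finset.sum_congr rfl fun k _ ↦ ?_
        rw [lintegral_const_mul _ (hmeas k),
          lintegral_indicator_one Metric.isClosed_closedBall.measurableSet]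
    _ ≤ ν Set.univ + ∑ k ∈ Finset.range (⌈Real.logb 2 ε⁻¹⌉₊ + 1),
          4 * C * volume (Metric.closedBall (0 : Plane) 1) := by
        refine add_le_add le_rfl (Finset.sum_le_sum fun k _ ↦ ?_)
        refine (mul_le_mul_right (hball k) _).trans_eq ?_
        have : (4 : ℝ≥0∞) ^ k * (4 : ℝ≥0∞)⁻¹ ^ k = 1 := by
          rw [← mul_pow, ENNReal.mul_inv_cancel (by simp) (by simp), one_pow]
        calc (4 : ℝ≥0∞) ^ (k + 1) * (C * ((4 : ℝ≥0∞)⁻¹ ^ k * volume (Metric.closedBall (0 : Plane) 1)))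
            = ((4 : ℝ≥0∞) ^ k * (4 : ℝ≥0∞)⁻¹ ^ k) *
              (4 * C * volume (Metric.closedBall (0 : Plane) 1)) := by rw [pow_succ]; ring
          _ = _ := by rw [this, one_mul]
    _ = _ := by
        rw [Finset.sum_const, Finset.card_range, nsmul_eq_mul, mul_comm (((_ : ℕ) : ℝ≥0∞))]

end Dyadic

/-! ### Continuity of the family in $y$ -/

section Convergence

lemma norm_fderiv_vortexFamily_sub_le {ε : ℝ} (hε : 0 < ε) (y y₀ : Disk) (w : Plane) :
    ‖fderiv ℝ (vortexFamily ε y - vortexFamily ε y₀) w‖ ≤ 4 / ε := by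
  have h := norm_fderiv_le_of_lipschitz (x₀ := w) ℝ
    ((lipschitzWith_vortexFamily hε y).sub (lipschitzWith_vortexFamily hε y₀))
  refine h.trans_eq ?_
  rw [NNReal.coe_add, Real.coe_toNNReal _ (by positivity)]
  ring

lemma norm_vortexFamily_sub_le_two {ε : ℝ} (y y₀ : Disk) (w : Plane) :
    ‖vortexFamily ε y w - vortexFamily ε y₀ w‖ ≤ 2 := by
  linarith [norm_sub_le (vortexFamily ε y w) (vortexFamily ε y₀ w),
    norm_vortexFamily_le (ε := ε) y w, norm_vortexFamily_le (ε := ε) y₀ w]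

/-- A pointwise measure of the `C¹`-distance of two members of the family. -/
noncomputable def familyDist (ε : ℝ) (y₀ y : Disk) (w : Plane) : ℝ :=
  ‖fderiv ℝ (vortexFamily ε y - vortexFamily ε y₀) w‖ + ‖vortexFamily ε y w - vortexFamily ε y₀ w‖

lemma measurable_familyDist {ε : ℝ} (hε : 0 < ε) (y₀ y : Disk) :
    Measurable (familyDist ε y₀ y) := by
  refine (measurable_fderiv ℝ _).norm.add ?_
  exact ((lipschitzWith_vortexFamily hε y).continuous.sub
    (lipschitzWith_vortexFamily hε y₀).continuous).measurable.norm

lemma familyDist_nonneg (ε : ℝ) (y₀ y : Disk) (w : Plane) : 0 ≤ familyDist ε y₀ y w := by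
  unfold familyDist; positivity

/-- Dominated convergence: the integrand is at most $4/\epsilon+2$ and tends to zero off the
critical circle of $y_0$, which is a null set. -/
lemma tendsto_lintegral_familyDist {ε : ℝ} (hε : 0 < ε) (y₀ : Disk) {ν : Measure Plane}
    [IsFiniteMeasure ν] (hν : ν ≪ volume) :
    Tendsto (fun y ↦ ∫⁻ w, ENNReal.ofReal (familyDist ε y₀ y w) ∂ν) (𝓝 y₀) (𝓝 0) := by
  have h := tendsto_lintegral_filter_of_dominated_convergence (μ := ν) (l := 𝓝 y₀)
    (F := fun y w ↦ ENNReal.ofReal (familyDist ε y₀ y w)) (f := fun _ ↦ 0)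
    (fun _ ↦ ENNReal.ofReal (4 / ε + 2))
    (.of_forall fun y ↦ (measurable_familyDist hε y₀ y).ennreal_ofReal)
    (.of_forall fun y ↦ .of_forall fun w ↦ ENNReal.ofReal_le_ofReal
      (add_le_add (norm_fderiv_vortexFamily_sub_le hε y y₀ w) (norm_vortexFamily_sub_le_two y y₀ w)))
    (by simpa using ENNReal.mul_ne_top ENNReal.ofReal_ne_top (measure_ne_top ν _)) ?_
  · simpa using h
  have h0 : ∀ᵐ w ∂ν, w ∉ criticalSet ε y₀ := by
    rw [ae_iff]
    simpa using hν (volume_criticalSet ε hε y₀)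
  filter_upwards [h0] with w hw
  rw [← ENNReal.ofReal_zero]
  refine (ENNReal.continuous_ofReal.tendsto _).comp ?_
  have h1 : Tendsto (fun y ↦ ‖fderiv ℝ (vortexFamily ε y - vortexFamily ε y₀) w‖) (𝓝 y₀) (𝓝 0) := by
    have h2 := ((tendsto_fderiv_vortexFamily hε hw).sub_const (fderiv ℝ (vortexFamily ε y₀) w)).norm
    rw [sub_self, norm_zero] at h2
    refine h2.congr' ?_
    filter_upwards [eventually_notMem_criticalSet hw] with y hy
    rw [fderiv_sub (differentiableAt_vortexFamily hε hy) (differentiableAt_vortexFamily hε hw)]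
  have h3 : Tendsto (fun y ↦ ‖vortexFamily ε y w - vortexFamily ε y₀ w‖) (𝓝 y₀) (𝓝 0) := by
    have := (((continuous_vortexFamily_left hε w).tendsto y₀).sub_const (vortexFamily ε y₀ w)).norm
    rwa [sub_self, norm_zero] at this
  simpa [familyDist] using h1.add h3

end Convergence

/-! ### Energy estimates for a spread map -/

section Core

variable {n : ℕ} {M : Type*} [EMetricSpace M] [ChartedSpace (EuclideanSpace ℝ (Fin n)) M]


lemma differential_comp {f : M → Plane} {g : Plane → Plane} {x : M}
    (hf : MDifferentiableAt (𝓡 n) 𝓘(ℝ, Plane) f x) (hg : DifferentiableAt ℝ g (f x))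
    (v : TangentSpace (𝓡 n) x) :
    differential n (g ∘ f) x v = fderiv ℝ g (f x) (differential n f x v) := by
  have h := mfderiv_comp x hg.mdifferentiableAt hf
  rw [mfderiv_eq_fderiv] at h
  exact congr($h v)

/-- The hypotheses on `f` that the energy estimates use. -/
structure IsSpread (n : ℕ) {M : Type*} [EMetricSpace M]
    [ChartedSpace (EuclideanSpace ℝ (Fin n)) M]
    [RiemannianBundle (fun x : M ↦ TangentSpace (𝓡 n) x)] [MeasurableSpace M]
    (f : M → Plane) (K : ℝ≥0) (C : ℝ≥0∞) : Prop where
  lipschitz : LipschitzWith K f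
  ne_top : C ≠ ⊤
  map_le : (riemannianVolume n M).map f ≤ C • volume

section
variable [RiemannianBundle (fun x : M ↦ TangentSpace (𝓡 n) x)] [MeasurableSpace M] [BorelSpace M]
  {f : M → Plane} {K : ℝ≥0} {C : ℝ≥0∞} (hf : IsSpread n f K C)
include hf

lemma IsSpread.ae_notMem_criticalSet {ε : ℝ} (hε : 0 < ε) (y : Disk) :
    ∀ᵐ x ∂(riemannianVolume n M), f x ∉ criticalSet ε y := by
  have h1 : (riemannianVolume n M).map f (criticalSet ε y) = 0 := by
    refine le_antisymm ((hf.map_le _).trans_eq ?_) zero_le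
    simp [volume_criticalSet ε hε y]
  rw [Measure.map_apply hf.lipschitz.continuous.measurable (measurableSet_criticalSet ε y)] at h1
  rw [ae_iff]
  simp only [not_not]
  exact h1

lemma IsSpread.lintegral_comp {g : Plane → ℝ≥0∞} (hg : Measurable g) :
    ∫⁻ x, g (f x) ∂(riemannianVolume n M) = ∫⁻ w, g w ∂((riemannianVolume n M).map f) :=
  (lintegral_map hg hf.lipschitz.continuous.measurable).symm

end

variable [IsManifold (𝓡 n) ∞ M] [RiemannianBundle (fun x : M ↦ TangentSpace (𝓡 n) x)]
  [IsContinuousRiemannianBundle (EuclideanSpace ℝ (Fin n)) (fun x : M ↦ TangentSpace (𝓡 n) x)]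
  [IsRiemannianManifold (𝓡 n) M] [CompactSpace M] [MeasurableSpace M] [BorelSpace M]

lemma memH1_of_lipschitzWith {u : M → Plane} {K : ℝ≥0} (hu : LipschitzWith K u) {B : ℝ}
    (hB : ∀ x, ‖u x‖ ≤ B) : MemH1 n u := by
  have := isFiniteMeasure_riemannianVolume (n := n) (M := M)
  refine ⟨MemLp.of_bound hu.continuous.aestronglyMeasurable B (.of_forall hB),
    differential n u, hasWeakDifferential_differential hu, ?_⟩
  obtain ⟨C, hC⟩ := exists_norm_differential_le n M
  calc ∫⁻ x, ENNReal.ofReal (normSq (differential n u x)) ∂(riemannianVolume n M)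
      ≤ ∫⁻ x, ENNReal.ofReal (2 * (C * K : ℝ) ^ 2) ∂(riemannianVolume n M) :=
        lintegral_mono fun x ↦ ENNReal.ofReal_le_ofReal (normSq_le (by positivity) (hC u K hu x))
    _ < ⊤ := by
        rw [lintegral_const]
        exact ENNReal.mul_lt_top ENNReal.ofReal_lt_top (measure_lt_top _ _)

variable {f : M → Plane} {K : ℝ≥0} {C : ℝ≥0∞} (hf : IsSpread n f K C)
include hf

lemma IsSpread.ae_norm_weakDifferential_sub_le {L : ℝ}
    (hL : ∀ x v, ‖differential n f x v‖ ≤ L * ‖v‖) {ε : ℝ} (hε : 0 < ε) (y y₀ : Disk) :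
    ∀ᵐ x ∂(riemannianVolume n M), ∀ v,
      ‖weakDifferential n (vortexFamily ε y ∘ f - vortexFamily ε y₀ ∘ f) x v‖ ≤
        familyDist ε y₀ y (f x) * L * ‖v‖ := by
  have hlip := ((lipschitzWith_vortexFamily hε y).comp hf.lipschitz).sub
    ((lipschitzWith_vortexFamily hε y₀).comp hf.lipschitz)
  filter_upwards [weakDifferential_ae_eq (n := n) hlip, hf.lipschitz.ae_mdifferentiableAt (n := n),
    hf.ae_notMem_criticalSet hε y, hf.ae_notMem_criticalSet hε y₀] with x hx hfx hy hy₀ v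
  have h1 : weakDifferential n (vortexFamily ε y ∘ f - vortexFamily ε y₀ ∘ f) x v =
      fderiv ℝ (vortexFamily ε y - vortexFamily ε y₀) (f x) (differential n f x v) := by
    refine (congr($hx v)).trans ?_
    exact differential_comp (g := vortexFamily ε y - vortexFamily ε y₀) hfx
      ((differentiableAt_vortexFamily hε hy).sub (differentiableAt_vortexFamily hε hy₀)) v
  rw [h1, mul_assoc]
  refine (ContinuousLinearMap.le_opNorm _ _).trans (mul_le_mul ?_ (hL x v) (norm_nonneg _)
    (familyDist_nonneg _ _ _ _))
  exact le_add_of_nonneg_right (norm_nonneg _)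

lemma IsSpread.ae_weakDifferential_eq {ε : ℝ} (hε : 0 < ε) (y : Disk) :
    ∀ᵐ x ∂(riemannianVolume n M), ∀ v, weakDifferential n (vortexFamily ε y ∘ f) x v =
      fderiv ℝ (vortexFamily ε y) (f x) (differential n f x v) := by
  filter_upwards [weakDifferential_ae_eq (n := n)
    ((lipschitzWith_vortexFamily hε y).comp hf.lipschitz),
    hf.lipschitz.ae_mdifferentiableAt (n := n), hf.ae_notMem_criticalSet hε y] with x hx hfx hy v
  exact (congr($hx v)).trans (differential_comp hfx (differentiableAt_vortexFamily hε hy) v)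

/-- The pointwise distance is bounded by `c`, so its square is at most `c` times itself and
convergence of the first-power integral suffices. -/
lemma IsSpread.tendsto_h1Norm {ε : ℝ} (hε : 0 < ε) (y₀ : Disk) :
    Tendsto (fun y ↦ h1Norm n (vortexFamily ε y ∘ f - vortexFamily ε y₀ ∘ f)) (𝓝 y₀) (𝓝 0) := by
  have := isFiniteMeasure_riemannianVolume (n := n) (M := M)
  obtain ⟨C₀, hC₀⟩ := exists_norm_differential_le n M
  set L : ℝ := C₀ * K
  have hL0 : 0 ≤ L := by positivity
  have hL : ∀ x v, ‖differential n f x v‖ ≤ L * ‖v‖ := hC₀ f K hf.lipschitz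
  have hac : (riemannianVolume n M).map f ≪ volume :=
    Measure.absolutelyContinuous_of_le_smul hf.map_le
  set R : Disk → ℝ≥0∞ := fun y ↦
    ∫⁻ w, ENNReal.ofReal (familyDist ε y₀ y w) ∂((riemannianVolume n M).map f) with hR
  have hR0 : Tendsto R (𝓝 y₀) (𝓝 0) := tendsto_lintegral_familyDist hε y₀ hac
  set c : ℝ := 4 / ε + 2
  have hc : ∀ y w, familyDist ε y₀ y w ≤ c := fun y w ↦
    add_le_add (norm_fderiv_vortexFamily_sub_le hε y y₀ w) (norm_vortexFamily_sub_le_two y y₀ w)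
  have hmain : ∀ y, h1Norm n (vortexFamily ε y ∘ f - vortexFamily ε y₀ ∘ f) ≤
      (ENNReal.ofReal (c * (1 + 2 * L ^ 2)) * R y) ^ (1 / 2 : ℝ) := by
    intro y
    unfold h1Norm
    refine ENNReal.rpow_le_rpow ?_ (by norm_num)
    have hR' : R y = ∫⁻ x, ENNReal.ofReal (familyDist ε y₀ y (f x)) ∂(riemannianVolume n M) :=
      (hf.lintegral_comp (measurable_familyDist hε y₀ y).ennreal_ofReal).symm
    have hmeas : Measurable fun x ↦ ENNReal.ofReal (familyDist ε y₀ y (f x)) :=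
      ((measurable_familyDist hε y₀ y).comp hf.lipschitz.continuous.measurable).ennreal_ofReal
    have h1 : ∫⁻ x, ‖(vortexFamily ε y ∘ f - vortexFamily ε y₀ ∘ f) x‖ₑ ^ 2
        ∂(riemannianVolume n M) ≤ ENNReal.ofReal c * R y := by
      rw [hR', ← lintegral_const_mul _ hmeas]
      refine lintegral_mono fun x ↦ ?_
      rw [← ofReal_norm, ← ENNReal.ofReal_pow (norm_nonneg _), ← ENNReal.ofReal_mul (by positivity)]
      refine ENNReal.ofReal_le_ofReal ?_
      have h2 : ‖(vortexFamily ε y ∘ f - vortexFamily ε y₀ ∘ f) x‖ ≤ familyDist ε y₀ y (f x) :=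
        le_add_of_nonneg_left (norm_nonneg _)
      rw [sq]
      exact mul_le_mul (h2.trans (hc y _)) h2 (norm_nonneg _) (by positivity)
    have h2 : ∫⁻ x, ENNReal.ofReal (normSq (weakDifferential n
        (vortexFamily ε y ∘ f - vortexFamily ε y₀ ∘ f) x)) ∂(riemannianVolume n M) ≤
        ENNReal.ofReal (c * (2 * L ^ 2)) * R y := by
      rw [hR', ← lintegral_const_mul _ hmeas]
      refine lintegral_mono_ae ?_
      filter_upwards [hf.ae_norm_weakDifferential_sub_le hL hε y y₀] with x hx
      rw [← ENNReal.ofReal_mul (by positivity)]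
      refine ENNReal.ofReal_le_ofReal ((normSq_le
        (mul_nonneg (familyDist_nonneg _ _ _ _) hL0) hx).trans ?_)
      have h3 := hc y (f x)
      have h4 := familyDist_nonneg ε y₀ y (f x)
      have h5 : familyDist ε y₀ y (f x) ^ 2 ≤ c * familyDist ε y₀ y (f x) := by nlinarith
      calc 2 * (familyDist ε y₀ y (f x) * L) ^ 2 = 2 * L ^ 2 * familyDist ε y₀ y (f x) ^ 2 := by ring
        _ ≤ 2 * L ^ 2 * (c * familyDist ε y₀ y (f x)) := by gcongr
        _ = _ := by ring
    refine (add_le_add h1 h2).trans_eq ?_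
    rw [← add_mul, ← ENNReal.ofReal_add (by positivity) (by positivity)]
    congr 2
    ring
  refine tendsto_of_tendsto_of_tendsto_of_le_of_le tendsto_const_nhds ?_ (fun _ ↦ zero_le) hmain
  have h3 : Tendsto (fun y ↦ ENNReal.ofReal (c * (1 + 2 * L ^ 2)) * R y) (𝓝 y₀) (𝓝 0) := by
    have := ENNReal.Tendsto.const_mul (a := ENNReal.ofReal (c * (1 + 2 * L ^ 2))) hR0
      (Or.inr ENNReal.ofReal_ne_top)
    rwa [mul_zero] at this
  have h4 := (ENNReal.continuous_rpow_const (y := (1 / 2 : ℝ))).tendsto 0 |>.comp h3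
  rw [ENNReal.zero_rpow_of_pos (by norm_num)] at h4
  exact h4

lemma IsSpread.mem_families {ε : ℝ} (hε : 0 < ε) :
    (fun y ↦ vortexFamily ε y ∘ f) ∈ families n M := by
  refine ⟨fun y ↦ ?_, fun y₀ ↦ hf.tendsto_h1Norm hε y₀, fun y hy ↦ .of_forall fun x ↦
    vortexFamily_of_norm_eq_one hy _⟩
  exact memH1_of_lipschitzWith ((lipschitzWith_vortexFamily hε y).comp hf.lipschitz)
    (fun x ↦ norm_vortexFamily_le y _)

/-- The one-sided estimate $E(y)\le E(y_0)+c\,R(y)$ with $R(y)\to0$ is all that the existence of a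
maximum requires. -/
lemma IsSpread.upperSemicontinuous_energy {W : Plane → ℝ} (hW : IsPotential W) {ε : ℝ}
    (hε : 0 < ε) : UpperSemicontinuous fun y ↦ energy n W ε (vortexFamily ε y ∘ f) := by
  have := isFiniteMeasure_riemannianVolume (n := n) (M := M)
  obtain ⟨C₀, hC₀⟩ := exists_norm_differential_le n M
  set L : ℝ := C₀ * K
  have hL0 : 0 ≤ L := by positivity
  have hL : ∀ x v, ‖differential n f x v‖ ≤ L * ‖v‖ := hC₀ f K hf.lipschitz
  have hac : (riemannianVolume n M).map f ≪ volume :=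
    Measure.absolutelyContinuous_of_le_smul hf.map_le
  intro y₀ b hb
  set R : Disk → ℝ≥0∞ := fun y ↦
    ∫⁻ w, ENNReal.ofReal (familyDist ε y₀ y w) ∂((riemannianVolume n M).map f) with hR
  have hR0 : Tendsto R (𝓝 y₀) (𝓝 0) := tendsto_lintegral_familyDist hε y₀ hac
  -- The first term is $\frac12\cdot4\cdot\frac{2L}{\epsilon}\cdot L$ from `normSq_le_add`; the
  -- second comes from $W$ being 1-Lipschitz on the unit disk.
  set c : ℝ := 4 * L ^ 2 / ε + 1 / ε ^ 2
  have hc0 : 0 ≤ c := by positivity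
  have hle : ∀ y, energy n W ε (vortexFamily ε y ∘ f) ≤
      energy n W ε (vortexFamily ε y₀ ∘ f) + ENNReal.ofReal c * R y := by
    intro y
    have hR' : R y = ∫⁻ x, ENNReal.ofReal (familyDist ε y₀ y (f x)) ∂(riemannianVolume n M) :=
      (hf.lintegral_comp (measurable_familyDist hε y₀ y).ennreal_ofReal).symm
    have hmeas : Measurable fun x ↦ ENNReal.ofReal (familyDist ε y₀ y (f x)) :=
      ((measurable_familyDist hε y₀ y).comp hf.lipschitz.continuous.measurable).ennreal_ofReal
    unfold energy
    rw [hR', ← lintegral_const_mul _ hmeas, ← lintegral_add_right _ (hmeas.const_mul _)]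
    refine lintegral_mono_ae ?_
    filter_upwards [hf.ae_weakDifferential_eq hε y, hf.ae_weakDifferential_eq hε y₀,
      hf.ae_notMem_criticalSet hε y, hf.ae_notMem_criticalSet hε y₀] with x hx hx₀ hcy hcy₀
    rw [← ENNReal.ofReal_mul hc0]
    refine le_trans (ENNReal.ofReal_le_ofReal ?_) ENNReal.ofReal_add_le
    have hd := familyDist_nonneg ε y₀ y (f x)
    have hbd : ∀ y' : Disk, (∀ v, weakDifferential n (vortexFamily ε y' ∘ f) x v =
        fderiv ℝ (vortexFamily ε y') (f x) (differential n f x v)) →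
        ∀ v, ‖weakDifferential n (vortexFamily ε y' ∘ f) x v‖ ≤ 2 / ε * L * ‖v‖ := by
      intro y' h v
      rw [h v, mul_assoc]
      refine (ContinuousLinearMap.le_opNorm _ _).trans (mul_le_mul ?_ (hL x v) (norm_nonneg _)
        (by positivity))
      refine (norm_fderiv_le_of_lipschitz ℝ (lipschitzWith_vortexFamily hε y')).trans_eq ?_
      rw [Real.coe_toNNReal _ (by positivity)]
    have h1 := normSq_le_add (C := 2 / ε * L) (δ := familyDist ε y₀ y (f x) * L) (by positivity)
      (by positivity) (hbd y hx) (hbd y₀ hx₀) (fun v ↦ by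
        rw [hx v, hx₀ v, mul_assoc]
        have : fderiv ℝ (vortexFamily ε y) (f x) (differential n f x v) -
            fderiv ℝ (vortexFamily ε y₀) (f x) (differential n f x v) =
            fderiv ℝ (vortexFamily ε y - vortexFamily ε y₀) (f x) (differential n f x v) := by
          rw [fderiv_sub (differentiableAt_vortexFamily hε hcy)
            (differentiableAt_vortexFamily hε hcy₀)]
          rfl
        rw [this]
        refine (ContinuousLinearMap.le_opNorm _ _).trans (mul_le_mul ?_ (hL x v) (norm_nonneg _) hd)
        exact le_add_of_nonneg_right (norm_nonneg _))
    have h2 : W ((vortexFamily ε y ∘ f) x) ≤ W ((vortexFamily ε y₀ ∘ f) x) +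
        familyDist ε y₀ y (f x) := by
      have h3 := hW.abs_sub_le (norm_vortexFamily_le (ε := ε) y (f x))
        (norm_vortexFamily_le (ε := ε) y₀ (f x))
      have h4 : ‖vortexFamily ε y (f x) - vortexFamily ε y₀ (f x)‖ ≤ familyDist ε y₀ y (f x) :=
        le_add_of_nonneg_left (norm_nonneg _)
      simp only [Function.comp_apply]
      linarith [le_abs_self (W (vortexFamily ε y (f x)) - W (vortexFamily ε y₀ (f x)))]
    calc 1 / 2 * normSq (weakDifferential n (vortexFamily ε y ∘ f) x) +
          W ((vortexFamily ε y ∘ f) x) / ε ^ 2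
        ≤ 1 / 2 * (normSq (weakDifferential n (vortexFamily ε y₀ ∘ f) x) +
          4 * (2 / ε * L) * (familyDist ε y₀ y (f x) * L)) +
          (W ((vortexFamily ε y₀ ∘ f) x) + familyDist ε y₀ y (f x)) / ε ^ 2 := by gcongr
      _ = _ := by simp only [c]; ring
  have h3 : Tendsto (fun y ↦ energy n W ε (vortexFamily ε y₀ ∘ f) + ENNReal.ofReal c * R y) (𝓝 y₀)
      (𝓝 (energy n W ε (vortexFamily ε y₀ ∘ f))) := by
    have := (ENNReal.Tendsto.const_mul (a := ENNReal.ofReal c) hR0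
      (Or.inr ENNReal.ofReal_ne_top)).const_add (energy n W ε (vortexFamily ε y₀ ∘ f))
    rwa [mul_zero, add_zero] at this
  filter_upwards [h3.eventually (gt_mem_nhds hb)] with y hy
  exact (hle y).trans_lt hy

lemma IsSpread.exists_energy_max {W : Plane → ℝ} (hW : IsPotential W) {ε : ℝ} (hε : 0 < ε) :
    ∃ y₀ : Disk, ∀ y : Disk, energy n W ε (vortexFamily ε y ∘ f) ≤
      energy n W ε (vortexFamily ε y₀ ∘ f) := by
  have : Nonempty Disk := ⟨⟨0, by simp⟩⟩
  have : CompactSpace Disk := isCompact_iff_compactSpace.1 (isCompact_closedBall _ _)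
  obtain ⟨y₀, -, h⟩ := (hf.upperSemicontinuous_energy hW hε).upperSemicontinuousOn
    Set.univ |>.exists_isMaxOn Set.univ_nonempty isCompact_univ
  exact ⟨y₀, fun y ↦ h (Set.mem_univ y)⟩

lemma IsSpread.exists_energy_le {W : Plane → ℝ} (hW : IsPotential W) :
    ∃ A : ℝ, ∀ ε : ℝ, 0 < ε → ∀ y : Disk, energy n W ε (vortexFamily ε y ∘ f) ≤
      ENNReal.ofReal A * ((riemannianVolume n M) Set.univ +
        4 * C * volume (Metric.closedBall (0 : Plane) 1) * (⌈Real.logb 2 ε⁻¹⌉₊ + 1 : ℕ)) := by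
  obtain ⟨C₀, hC₀⟩ := exists_norm_differential_le n M
  set L : ℝ := C₀ * K
  have hL0 : 0 ≤ L := by positivity
  have hL : ∀ x v, ‖differential n f x v‖ ≤ L * ‖v‖ := hC₀ f K hf.lipschitz
  -- With $m=\max(\epsilon,|f+a|)$ the Dirichlet term is at most $\frac12\cdot2(2L/m)^2=4L^2/m^2$
  -- and the potential term at most $1/m^2$.
  refine ⟨4 * L ^ 2 + 1, fun ε hε y ↦ ?_⟩
  rcases y.norm_le.lt_or_eq with hy | hy
  · set a : Plane := (1 - ‖(y : Plane)‖)⁻¹ • (y : Plane)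
    have hmeas : Measurable fun w : Plane ↦ ENNReal.ofReal (1 / max ε ‖w + a‖ ^ 2) := by fun_prop
    have h0 := lintegral_one_div_max_sq_le hf.map_le hε a
    rw [← hf.lintegral_comp hmeas, Measure.map_apply hf.lipschitz.continuous.measurable
      MeasurableSet.univ, Set.preimage_univ] at h0
    have hmeas' : Measurable fun x ↦ ENNReal.ofReal (1 / max ε ‖f x + a‖ ^ 2) :=
      hmeas.comp hf.lipschitz.continuous.measurable
    refine le_trans ?_ (mul_le_mul_right h0 _)
    rw [← lintegral_const_mul _ hmeas']
    refine lintegral_mono_ae ?_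
    filter_upwards [hf.ae_weakDifferential_eq hε y] with x hx
    rw [← ENNReal.ofReal_mul (by positivity)]
    refine ENNReal.ofReal_le_ofReal ?_
    have hm : 0 < max ε ‖f x + a‖ := lt_max_of_lt_left hε
    have h1 := normSq_le (A := weakDifferential n (vortexFamily ε y ∘ f) x)
      (C := 2 / max ε ‖f x + a‖ * L) (by positivity) (fun v ↦ by
      rw [hx v, mul_assoc]
      refine (ContinuousLinearMap.le_opNorm _ _).trans (mul_le_mul ?_ (hL x v) (norm_nonneg _)
        (by positivity))
      exact norm_fderiv_le_of_lip' ℝ (by positivity)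
        (.of_forall fun w' ↦ norm_vortexFamily_sub_le hε hy (f x) w'))
    have h2 := hW.vortexFamily_div_le hε hy (f x)
    calc 1 / 2 * normSq (weakDifferential n (vortexFamily ε y ∘ f) x) +
          W ((vortexFamily ε y ∘ f) x) / ε ^ 2
        ≤ 1 / 2 * (2 * (2 / max ε ‖f x + a‖ * L) ^ 2) + 1 / max ε ‖f x + a‖ ^ 2 := by
          exact add_le_add (mul_le_mul_of_nonneg_left h1 (by norm_num)) h2
      _ = _ := by field_simp; ring
  · refine le_trans (le_of_eq ?_) zero_le
    unfold energy
    rw [lintegral_eq_zero_of_ae_eq_zero]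
    filter_upwards [hf.ae_weakDifferential_eq hε y] with x hx
    have e : vortexFamily ε y = fun _ ↦ (y : Plane) := funext fun w ↦ vortexFamily_of_norm_eq_one hy w
    have h1 := normSq_le (A := weakDifferential n (vortexFamily ε y ∘ f) x) le_rfl (fun v ↦ by
      rw [hx v, e]; simp)
    have h2 : W ((vortexFamily ε y ∘ f) x) = 0 := by
      simp only [Function.comp_apply, e]
      exact hW.eq_zero_of_norm_eq_one hy
    rw [h2, Pi.zero_apply, ENNReal.ofReal_eq_zero, zero_div]
    linarith

lemma IsSpread.limsup_energy_lt_top {W : Plane → ℝ} (hW : IsPotential W) :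
    limsup (fun ε : ℝ ↦ (⨆ y : Disk, energy n W ε (vortexFamily ε y ∘ f)) /
      ENNReal.ofReal |Real.log ε|) (𝓝[>] 0) < ⊤ := by
  have := isFiniteMeasure_riemannianVolume (n := n) (M := M)
  obtain ⟨A, hA⟩ := hf.exists_energy_le hW
  set B := 4 * C * volume (Metric.closedBall (0 : Plane) 1)
  have hB : B ≠ ⊤ := ENNReal.mul_ne_top (ENNReal.mul_ne_top (by simp) hf.ne_top)
    Metric.isBounded_closedBall.measure_lt_top.ne
  -- Rounding up and counting the scale zero give at most $\log_2(1/\epsilon)+2$ terms, and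
  -- $2\le2|\log\epsilon|$ once $\epsilon<e^{-1}$.
  set c : ℝ := 1 / Real.log 2 + 2
  refine lt_of_le_of_lt (limsup_le_of_le (h := ?_) (a := ENNReal.ofReal A *
    ((riemannianVolume n M) Set.univ + B * ENNReal.ofReal c))) ?_
  · have h1 : ∀ᶠ ε : ℝ in 𝓝[>] 0, ε < Real.exp (-1) :=
      nhdsWithin_le_nhds (gt_mem_nhds (Real.exp_pos _))
    filter_upwards [h1, self_mem_nhdsWithin] with ε hε1 hε
    have hε : 0 < ε := hε
    have hlog : 1 ≤ |Real.log ε| := by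
      have : Real.log ε ≤ -1 := by
        rw [← Real.log_exp (-1)]; exact Real.log_le_log hε hε1.le
      rw [abs_of_neg (by linarith)]; linarith
    have hl0 : ENNReal.ofReal |Real.log ε| ≠ 0 := by
      rw [Ne, ENNReal.ofReal_eq_zero]; linarith
    rw [ENNReal.div_le_iff hl0 ENNReal.ofReal_ne_top]
    refine iSup_le fun y ↦ (hA ε hε y).trans ?_
    have key : ∀ a b c : ℝ≥0∞, b ≤ c → a * b ≤ a * c := fun a b c h ↦ by gcongr
    rw [mul_assoc (ENNReal.ofReal A)]
    refine key _ _ _ ?_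
    rw [add_mul, mul_assoc B]
    refine add_le_add (le_mul_of_one_le_right' (by simpa using hlog)) (key B _ _ ?_)
    rw [← ENNReal.ofReal_natCast, ← ENNReal.ofReal_mul (by positivity)]
    refine ENNReal.ofReal_le_ofReal ?_
    have h2 : Real.logb 2 ε⁻¹ = |Real.log ε| / Real.log 2 := by
      rw [Real.logb, Real.log_inv, abs_of_neg]
      have : Real.log ε ≤ -1 := by
        rw [← Real.log_exp (-1)]; exact Real.log_le_log hε hε1.le
      linarith
    have hl2 : 0 < Real.log 2 := Real.log_pos (by norm_num)
    have h3 := (Nat.ceil_lt_add_one (a := Real.logb 2 ε⁻¹) (by rw [h2]; positivity)).le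
    push_cast
    have h4 : c * |Real.log ε| = |Real.log ε| / Real.log 2 + 2 * |Real.log ε| := by
      simp only [c]; ring
    rw [h4, ← h2]
    linarith
  · exact ENNReal.mul_lt_top ENNReal.ofReal_lt_top (ENNReal.add_lt_top.2 ⟨measure_lt_top _ _,
      ENNReal.mul_lt_top hB.lt_top ENNReal.ofReal_lt_top⟩)

lemma IsSpread.limsup_minMax_lt_top {W : Plane → ℝ} (hW : IsPotential W) :
    limsup (fun ε : ℝ ↦ minMax n M W ε / ENNReal.ofReal |Real.log ε|) (𝓝[>] 0) < ⊤ := by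
  refine lt_of_le_of_lt (limsup_le_limsup ?_) (hf.limsup_energy_lt_top hW)
  filter_upwards [self_mem_nhdsWithin] with ε hε
  gcongr
  exact iInf₂_le (fun y ↦ vortexFamily ε y ∘ f) (hf.mem_families hε)

end Core

/-! ### A coarea inequality in Euclidean space -/

section SlicedArea

variable {n : ℕ}

/-- Sylvester's identity; it reduces the Jacobian of `replaceCoords` to a $2\times2$ determinant. -/
lemma det_one_add_comp_comm {E F : Type*} [NormedAddCommGroup E] [NormedSpace ℝ E]
    [FiniteDimensional ℝ E] [NormedAddCommGroup F] [NormedSpace ℝ F] [FiniteDimensional ℝ F]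
    (A : E →L[ℝ] F) (B : F →L[ℝ] E) : (1 + B ∘L A).det = (1 + A ∘L B).det := by
  let b := Module.finBasis ℝ E
  let c := Module.finBasis ℝ F
  have h := Matrix.det_one_add_mul_comm (LinearMap.toMatrix c b B) (LinearMap.toMatrix b c A)
  rw [← LinearMap.toMatrix_comp, ← LinearMap.toMatrix_comp, ← LinearMap.toMatrix_one b,
    ← LinearMap.toMatrix_one c, ← map_add, ← map_add, LinearMap.det_toMatrix,
    LinearMap.det_toMatrix] at h
  exact h

/-- The projection of Euclidean space to a coordinate plane. -/
noncomputable def coordProj (i j : Fin n) : EuclideanSpace ℝ (Fin n) →L[ℝ] Plane :=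
  (EuclideanSpace.proj i : EuclideanSpace ℝ (Fin n) →L[ℝ] ℝ).smulRight (EuclideanSpace.single 0 1) +
  (EuclideanSpace.proj j : EuclideanSpace ℝ (Fin n) →L[ℝ] ℝ).smulRight (EuclideanSpace.single 1 1)

/-- The inclusion of a coordinate plane in Euclidean space. -/
noncomputable def coordInj (i j : Fin n) : Plane →L[ℝ] EuclideanSpace ℝ (Fin n) :=
  (EuclideanSpace.proj 0 : Plane →L[ℝ] ℝ).smulRight (EuclideanSpace.single i 1) +
  (EuclideanSpace.proj 1 : Plane →L[ℝ] ℝ).smulRight (EuclideanSpace.single j 1)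

@[simp] lemma coordProj_apply_zero (i j : Fin n) (z : EuclideanSpace ℝ (Fin n)) :
    coordProj i j z 0 = z i := by simp [coordProj]

@[simp] lemma coordProj_apply_one (i j : Fin n) (z : EuclideanSpace ℝ (Fin n)) :
    coordProj i j z 1 = z j := by simp [coordProj]

lemma coordInj_apply (i j k : Fin n) (w : Plane) :
    coordInj i j w k = (if k = i then w 0 else 0) + (if k = j then w 1 else 0) := by
  simp [coordInj]

lemma coordInj_apply_fst {i j : Fin n} (hij : i ≠ j) (w : Plane) : coordInj i j w i = w 0 := by
  simp [coordInj_apply, hij]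

lemma coordInj_apply_snd {i j : Fin n} (hij : i ≠ j) (w : Plane) : coordInj i j w j = w 1 := by
  simp [coordInj_apply, hij.symm]

lemma coordProj_coordInj {i j : Fin n} (hij : i ≠ j) (w : Plane) :
    coordProj i j (coordInj i j w) = w := by
  ext k
  fin_cases k
  · simp [coordInj_apply_fst hij]
  · simp [coordInj_apply_snd hij]

/-- The minor of a linear map to the plane with respect to two coordinates. -/
noncomputable def minor (i j : Fin n) (L : EuclideanSpace ℝ (Fin n) →L[ℝ] Plane) : ℝ :=
  L (EuclideanSpace.single i 1) 0 * L (EuclideanSpace.single j 1) 1 -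
    L (EuclideanSpace.single i 1) 1 * L (EuclideanSpace.single j 1) 0

/-- The map that replaces two coordinates by the components of `g`. -/
noncomputable def replaceCoords (i j : Fin n) (g : EuclideanSpace ℝ (Fin n) → Plane)
    (z : EuclideanSpace ℝ (Fin n)) : EuclideanSpace ℝ (Fin n) :=
  z + coordInj i j (g z - coordProj i j z)

/-- The derivative of `replaceCoords`. -/
noncomputable def replaceCoordsCLM (i j : Fin n) (L : EuclideanSpace ℝ (Fin n) →L[ℝ] Plane) :
    EuclideanSpace ℝ (Fin n) →L[ℝ] EuclideanSpace ℝ (Fin n) :=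
  1 + coordInj i j ∘L (L - coordProj i j)

lemma coordProj_replaceCoords {i j : Fin n} (hij : i ≠ j) (g : EuclideanSpace ℝ (Fin n) → Plane)
    (z : EuclideanSpace ℝ (Fin n)) : coordProj i j (replaceCoords i j g z) = g z := by
  rw [replaceCoords, map_add, coordProj_coordInj hij]; abel

lemma replaceCoords_apply_of_ne {i j k : Fin n} (hi : k ≠ i) (hj : k ≠ j)
    (g : EuclideanSpace ℝ (Fin n) → Plane) (z : EuclideanSpace ℝ (Fin n)) :
    replaceCoords i j g z k = z k := by
  rw [replaceCoords, PiLp.add_apply, coordInj_apply, if_neg hi, if_neg hj]; simp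

lemma hasFDerivWithinAt_replaceCoords (i j : Fin n) {g : EuclideanSpace ℝ (Fin n) → Plane}
    {L : EuclideanSpace ℝ (Fin n) →L[ℝ] Plane} {s : Set (EuclideanSpace ℝ (Fin n))}
    {z : EuclideanSpace ℝ (Fin n)} (h : HasFDerivWithinAt g L s z) :
    HasFDerivWithinAt (replaceCoords i j g) (replaceCoordsCLM i j L) s z :=
  (hasFDerivWithinAt_id z s).add ((coordInj i j).hasFDerivAt.comp_hasFDerivWithinAt z
    (h.sub (coordProj i j).hasFDerivWithinAt))

lemma det_replaceCoordsCLM {i j : Fin n} (hij : i ≠ j)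
    (L : EuclideanSpace ℝ (Fin n) →L[ℝ] Plane) : (replaceCoordsCLM i j L).det = minor i j L := by
  rw [replaceCoordsCLM, det_one_add_comp_comm]
  have : 1 + (L - coordProj i j) ∘L coordInj i j = L ∘L coordInj i j := by
    ext w : 1
    simp [coordProj_coordInj hij]
  rw [this, ContinuousLinearMap.det, ← LinearMap.det_toMatrix (EuclideanSpace.basisFun _ ℝ).toBasis,
    Matrix.det_fin_two]
  have h0 : coordInj i j (EuclideanSpace.single 0 1) = EuclideanSpace.single i 1 := by
    ext k; simp [coordInj_apply]
  have h1 : coordInj i j (EuclideanSpace.single 1 1) = EuclideanSpace.single j 1 := by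
    ext k; simp [coordInj_apply]
  simp [LinearMap.toMatrix_apply, h0, h1, minor]
  ring

/-- The coordinates other than two given ones. -/
abbrev Rest (i j : Fin n) : Type := {k : Fin n // ¬(k = i ∨ k = j)}

/-- The projection to the coordinates other than two given ones. -/
def restProj (i j : Fin n) (z : EuclideanSpace ℝ (Fin n)) : Rest i j → ℝ := fun k ↦ z k

lemma lipschitzWith_restProj (i j : Fin n) : LipschitzWith 1 (restProj i j) :=
  LipschitzWith.of_dist_le_mul fun z w ↦ by
    rw [NNReal.coe_one, one_mul]
    refine (dist_pi_le_iff dist_nonneg).2 fun k ↦ ?_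
    have := PiLp.norm_apply_le (z - w) (k : Fin n)
    simpa [restProj, dist_eq_norm] using this

lemma restProj_replaceCoords (i j : Fin n) (g : EuclideanSpace ℝ (Fin n) → Plane)
    (z : EuclideanSpace ℝ (Fin n)) : restProj i j (replaceCoords i j g z) = restProj i j z :=
  funext fun k ↦ replaceCoords_apply_of_ne (fun h ↦ k.2 (.inl h)) (fun h ↦ k.2 (.inr h)) g z

lemma card_rest {i j : Fin n} (hij : i ≠ j) : (Fintype.card (Rest i j) : ℝ) = n - 2 := by
  have h : Fintype.card {k : Fin n // k = i ∨ k = j} = 2 := by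
    rw [Fintype.card_subtype]
    have : Finset.univ.filter (fun k ↦ k = i ∨ k = j) = {i, j} := by ext; simp
    rw [this, Finset.card_pair hij]
  have h2 := Fintype.card_subtype_compl (fun k : Fin n ↦ k = i ∨ k = j)
  have h3 := Fintype.card_subtype_le (fun k : Fin n ↦ k = i ∨ k = j)
  rw [h, Fintype.card_fin] at h2 h3
  rw [h2, Nat.cast_sub h3, Nat.cast_two]

/-- The two given coordinates, numbered. -/
def pairEquiv {i j : Fin n} (hij : i ≠ j) : {k : Fin n // k = i ∨ k = j} ≃ Fin 2 where
  toFun k := if (k : Fin n) = i then 0 else 1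
  invFun a := if a = 0 then ⟨i, .inl rfl⟩ else ⟨j, .inr rfl⟩
  left_inv := by
    rintro ⟨k, rfl | rfl⟩
    · simp
    · simp [hij.symm]
  right_inv a := by
    fin_cases a
    · simp
    · simp [hij.symm]

lemma measurePreserving_coordProj_restProj {i j : Fin n} (hij : i ≠ j) :
    MeasurePreserving (fun z : EuclideanSpace ℝ (Fin n) ↦ (coordProj i j z, restProj i j z))
      volume (volume.prod volume) := by
  have h1 := volume_preserving_piEquivPiSubtypeProd (fun _ : Fin n ↦ ℝ) (fun k ↦ k = i ∨ k = j)
  have h2 := volume_measurePreserving_piCongrLeft (fun _ : Fin 2 ↦ ℝ) (pairEquiv hij)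
  have h3 := PiLp.volume_preserving_toLp (Fin 2)
  have h4 := ((h3.comp h2).prod (MeasurePreserving.id (volume : Measure (Rest i j → ℝ)))).comp
    (h1.comp (PiLp.volume_preserving_ofLp (Fin n)))
  refine (congrArg (fun F ↦ MeasurePreserving F volume (volume.prod volume)) ?_).mpr h4
  ext z : 1
  refine Prod.ext ?_ rfl
  ext k
  fin_cases k <;>
  simp [MeasurableEquiv.piCongrLeft, Equiv.piCongrLeft, Equiv.piCongrLeft', pairEquiv,
    MeasurableEquiv.piEquivPiSubtypeProd] <;>
  exact (eq_rec_constant _ _).symm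

lemma injective_coordProj_restProj (i j : Fin n) : Function.Injective
    (fun z : EuclideanSpace ℝ (Fin n) ↦ (coordProj i j z, restProj i j z)) := by
  intro z w h
  obtain ⟨h1, h2⟩ := Prod.mk.inj h
  ext k
  by_cases hk : k = i ∨ k = j
  · rcases hk with rfl | rfl
    · simpa using congrArg (fun v : Plane ↦ v 0) h1
    · simpa using congrArg (fun v : Plane ↦ v 1) h1
  · exact congrFun h2 ⟨k, hk⟩

/-- The volumes of the projections of the slices `s ∩ g⁻¹(w)`. -/
noncomputable def sliceVolume (i j : Fin n) (g : EuclideanSpace ℝ (Fin n) → Plane)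
    (s : Set (EuclideanSpace ℝ (Fin n))) (w : Plane) : ℝ≥0∞ :=
  volume (restProj i j '' (s ∩ g ⁻¹' {w}))

section Injective

variable {i j : Fin n} (hij : i ≠ j) {g : EuclideanSpace ℝ (Fin n) → Plane}
  {g' : EuclideanSpace ℝ (Fin n) → EuclideanSpace ℝ (Fin n) →L[ℝ] Plane}
  {s : Set (EuclideanSpace ℝ (Fin n))} (hs : MeasurableSet s)
  (hg : ∀ z ∈ s, HasFDerivWithinAt g (g' z) s z)
include hij hs hg

/-- The slices of a set on which `replaceCoords` is injective. -/
lemma exists_measurableSet_slices (hinj : Set.InjOn (replaceCoords i j g) s) :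
    ∃ T : Set (Plane × (Rest i j → ℝ)), MeasurableSet T ∧
      volume (replaceCoords i j g '' s) = (volume.prod volume) T ∧
      ∀ w, Prod.mk w ⁻¹' T = restProj i j '' (s ∩ g ⁻¹' {w}) := by
  have hm : MeasurableSet (replaceCoords i j g '' s) := measurable_image_of_fderivWithin hs
    (fun z hz ↦ hasFDerivWithinAt_replaceCoords i j (hg z hz)) hinj
  have hc : Continuous (fun z : EuclideanSpace ℝ (Fin n) ↦ (coordProj i j z, restProj i j z)) :=
    (coordProj i j).continuous.prodMk (lipschitzWith_restProj i j).continuous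
  have hi := injective_coordProj_restProj i j
  have hT := hm.image_of_continuousOn_injOn hc.continuousOn hi.injOn
  refine ⟨_, hT, ?_, fun w ↦ ?_⟩
  · rw [← (measurePreserving_coordProj_restProj hij).measure_preimage hT.nullMeasurableSet,
      hi.preimage_image]
  · ext r
    simp only [Set.mem_preimage, Set.mem_image, exists_exists_and_eq_and,
      coordProj_replaceCoords hij, restProj_replaceCoords, Prod.mk.injEq, Set.mem_inter_iff,
      Set.mem_singleton_iff, and_assoc]

lemma measurable_sliceVolume (hinj : Set.InjOn (replaceCoords i j g) s) :
    Measurable (sliceVolume i j g s) := by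
  obtain ⟨T, hT, -, h⟩ := exists_measurableSet_slices hij hs hg hinj
  have e : sliceVolume i j g s = fun w ↦ volume (Prod.mk w ⁻¹' T) :=
    funext fun w ↦ by rw [h, sliceVolume]
  rw [e]
  exact measurable_measure_prodMk_left hT

/-- The area formula for `replaceCoords`, whose Jacobian is the minor, combined with Fubini on the
image. That map keeps the other coordinates, so the slice of the image over `w` is the projection of
$s\cap g^{-1}(w)$. -/
lemma mul_volume_le_lintegral_sliceVolume {c : ℝ≥0} (hinj : Set.InjOn (replaceCoords i j g) s)
    (hc : ∀ z ∈ s, c ≤ |minor i j (g' z)|) :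
    c * volume s ≤ ∫⁻ w, sliceVolume i j g s w := by
  obtain ⟨T, hT, hT', h⟩ := exists_measurableSet_slices hij hs hg hinj
  rw [Measure.prod_apply hT] at hT'
  simp only [h] at hT'
  refine le_trans ?_ hT'.le
  rw [← lintegral_abs_det_fderiv_eq_addHaar_image volume hs
    (fun z hz ↦ hasFDerivWithinAt_replaceCoords i j (hg z hz)) hinj, ← setLIntegral_const]
  refine setLIntegral_mono' hs fun z hz ↦ ?_
  rw [det_replaceCoordsCLM hij, ← ENNReal.ofReal_coe_nnreal]
  exact ENNReal.ofReal_le_ofReal (hc z hz)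

end Injective

/-- A quantitative form of the coarea inequality: a set is decomposed into pieces on which two
coordinates can be replaced by the components of the map. -/
theorem exists_pieces_mul_volume_le {i j : Fin n} (hij : i ≠ j)
    {g : EuclideanSpace ℝ (Fin n) → Plane}
    {g' : EuclideanSpace ℝ (Fin n) → EuclideanSpace ℝ (Fin n) →L[ℝ] Plane}
    {s : Set (EuclideanSpace ℝ (Fin n))} (hs : MeasurableSet s)
    (hg : ∀ z ∈ s, HasFDerivWithinAt g (g' z) s z) {c : ℝ≥0} (hc0 : 0 < c)
    (hc : ∀ z ∈ s, c ≤ |minor i j (g' z)|) :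
    ∃ t : ℕ → Set (EuclideanSpace ℝ (Fin n)), Pairwise (Function.onFun Disjoint t) ∧
      (∀ k, MeasurableSet (t k)) ∧ (∀ k, t k ⊆ s) ∧
      c * volume s ≤ ∫⁻ w, ∑' k, sliceVolume i j g (t k) w := by
  classical
  rcases s.eq_empty_or_nonempty with rfl | hne
  · exact ⟨fun _ ↦ ∅, fun _ _ _ ↦ by simp [Function.onFun], by simp, by simp, by simp⟩
  have : Nonempty (Fin n) := ⟨i⟩
  -- A map approximated by an invertible $A$ to within half of $\|A^{-1}\|^{-1}$ is injective. The
  -- value 1 for singular $A$ plays no role: the partition uses only derivatives at points of `s`,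
  -- where the minor is nonzero.
  let r : (EuclideanSpace ℝ (Fin n) →L[ℝ] EuclideanSpace ℝ (Fin n)) → ℝ≥0 := fun A ↦
    if h : A.det ≠ 0 then
      ‖((A.toContinuousLinearEquivOfDetNeZero h).symm :
        EuclideanSpace ℝ (Fin n) →L[ℝ] EuclideanSpace ℝ (Fin n))‖₊⁻¹ / 2 else 1
  have hr0 : ∀ A : EuclideanSpace ℝ (Fin n) ≃L[ℝ] EuclideanSpace ℝ (Fin n),
      0 < ‖(A.symm : EuclideanSpace ℝ (Fin n) →L[ℝ] EuclideanSpace ℝ (Fin n))‖₊⁻¹ := fun A ↦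
    inv_pos.2 A.nnnorm_symm_pos
  have hr : ∀ A, r A ≠ 0 := fun A ↦ by
    by_cases h : A.det ≠ 0
    · simp only [r, dif_pos h]
      exact (half_pos (hr0 _)).ne'
    · simp only [r, dif_neg h]
      exact one_ne_zero
  obtain ⟨t, A, hd, ht, hst, hA, hA'⟩ := exists_partition_approximatesLinearOn_of_hasFDerivWithinAt
    (replaceCoords i j g) s _ (fun z hz ↦ hasFDerivWithinAt_replaceCoords i j (hg z hz)) r hr
  have hinj : ∀ k, Set.InjOn (replaceCoords i j g) (s ∩ t k) := fun k ↦ by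
    obtain ⟨y, hy, hAy⟩ := hA' hne k
    have hdet : (A k).det ≠ 0 := by
      rw [hAy, det_replaceCoordsCLM hij]
      exact abs_pos.1 (lt_of_lt_of_le (by exact_mod_cast hc0) (hc y hy))
    have h := hA k
    simp only [r, dif_pos hdet] at h
    have h' : ApproximatesLinearOn (replaceCoords i j g)
      ((A k).toContinuousLinearEquivOfDetNeZero hdet :
        EuclideanSpace ℝ (Fin n) →L[ℝ] EuclideanSpace ℝ (Fin n)) (s ∩ t k) _ := h
    exact h'.injOn (.inr (half_lt_self (hr0 _)))
  have hg' : ∀ k, ∀ z ∈ s ∩ t k, HasFDerivWithinAt g (g' z) (s ∩ t k) z := fun k z hz ↦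
    (hg z hz.1).mono Set.inter_subset_left
  have hd' : Pairwise (Function.onFun Disjoint fun k ↦ s ∩ t k) := fun k l hkl ↦
    (hd hkl).mono Set.inter_subset_right Set.inter_subset_right
  refine ⟨fun k ↦ s ∩ t k, hd', fun k ↦ hs.inter (ht k), fun k ↦ Set.inter_subset_left, ?_⟩
  rw [lintegral_tsum fun k ↦
    (measurable_sliceVolume hij (hs.inter (ht k)) (hg' k) (hinj k)).aemeasurable]
  have hU : s = ⋃ k, s ∩ t k := by rw [← Set.inter_iUnion, Set.inter_eq_left.2 hst]
  conv_lhs => rw [hU]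
  rw [measure_iUnion hd' fun k ↦ hs.inter (ht k), ← ENNReal.tsum_mul_left]
  exact ENNReal.tsum_le_tsum fun k ↦ mul_volume_le_lintegral_sliceVolume hij (hs.inter (ht k))
    (hg' k) (hinj k) fun z hz ↦ hc z hz.1

end SlicedArea

/-! ### Lipschitz maps with Jacobian and fibre bounds are spread -/

section Coarea

variable {n : ℕ} {M : Type*} [EMetricSpace M] [ChartedSpace (EuclideanSpace ℝ (Fin n)) M]

/-- If all minors were smaller, `wedgeNorm_le_of_minors_le` would put the Jacobian strictly below
`δ`; the `+ 1` in the denominator makes the inequality strict. -/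
lemma exists_le_abs_minor [IsManifold (𝓡 n) ∞ M]
    [RiemannianBundle (fun x : M ↦ TangentSpace (𝓡 n) x)] {f : M → Plane} {x₀ : M} {z : EuclideanSpace ℝ (Fin n)}
    (hz : z ∈ (extChartAt (𝓡 n) x₀).target)
    (hd : DifferentiableAt ℝ (fun z ↦ f ((extChartAt (𝓡 n) x₀).symm z)) z) {C δ : ℝ} (hC : 0 ≤ C)
    (hδ : 0 < δ) (h : ∀ v, ‖v‖ ≤ C * ‖coordFrame n x₀ z v‖)
    (hJ : δ ≤ jacobian n f ((extChartAt (𝓡 n) x₀).symm z)) :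
    ∃ i j : Fin n, δ / (n ^ 2 * C ^ 2 + 1) ≤
      |minor i j (fderiv ℝ (fun z ↦ f ((extChartAt (𝓡 n) x₀).symm z)) z)| := by
  by_contra! hcon
  have hη : 0 ≤ δ / (n ^ 2 * C ^ 2 + 1) := by positivity
  have hcomp : ∀ (a : Fin 2) (v : EuclideanSpace ℝ (Fin n)),
      mfderiv (𝓡 n) 𝓘(ℝ, ℝ) (fun p ↦ f p a) ((extChartAt (𝓡 n) x₀).symm z)
        (coordFrame n x₀ z v) =
      fderiv ℝ (fun z ↦ f ((extChartAt (𝓡 n) x₀).symm z)) z v a := fun a v ↦ by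
    have h1 := mfderiv_comp_coordFrame (fun p ↦ f p a) x₀ hz v
    have h2 := ((EuclideanSpace.proj a : Plane →L[ℝ] ℝ).hasFDerivAt.comp z hd.hasFDerivAt).fderiv
    exact h1.trans congr($h2 v)
  have e : ∀ a b c d a' b' c' d' η : ℝ, a = a' → b = b' → c = c' → d = d' →
      |a' * b' - d' * c'| ≤ η → |a * b - c * d| ≤ η := by
    rintro a b c d _ _ _ _ η rfl rfl rfl rfl h
    rwa [mul_comm c d]
  have h1 := wedgeNorm_le_of_minors_le hz hC hη h
    (mfderiv (𝓡 n) 𝓘(ℝ, ℝ) (fun p ↦ f p 0) ((extChartAt (𝓡 n) x₀).symm z))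
    (mfderiv (𝓡 n) 𝓘(ℝ, ℝ) (fun p ↦ f p 1) ((extChartAt (𝓡 n) x₀).symm z)) fun i j ↦ by
      have := (hcon i j).le
      rw [minor] at this
      exact e _ _ _ _ _ _ _ _ _ (hcomp 0 _) (hcomp 1 _) (hcomp 0 _) (hcomp 1 _) this
  have h2 := hJ.trans h1
  have h3 : n ^ 2 * C ^ 2 * (δ / (n ^ 2 * C ^ 2 + 1)) < δ := by
    rw [← mul_div_assoc, div_lt_iff₀ (by positivity)]
    nlinarith
  linarith

variable [MeasurableSpace M] [BorelSpace M]

/-- Lebesgue measure on the remaining coordinates is $\mathcal H^{n-2}$, and the chart followed by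
the projection is `L`-Lipschitz. The pieces of the fibre are disjoint, so their Hausdorff measures
add up to at most that of the whole fibre. -/
lemma tsum_sliceVolume_le {f : M → Plane} (hf : Continuous f) (x₀ : M) {U : Set M} {L : ℝ≥0}
    (hL : LipschitzOnWith L (extChartAt (𝓡 n) x₀) U) {i j : Fin n} (hij : i ≠ j)
    {t : ℕ → Set (EuclideanSpace ℝ (Fin n))} (hd : Pairwise (Function.onFun Disjoint t))
    (ht : ∀ k, MeasurableSet (t k)) (htarget : ∀ k, t k ⊆ (extChartAt (𝓡 n) x₀).target)
    (hU : ∀ k, ∀ z ∈ t k, (extChartAt (𝓡 n) x₀).symm z ∈ U) (w : Plane) :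
    ∑' k, sliceVolume i j (fun z ↦ f ((extChartAt (𝓡 n) x₀).symm z)) (t k) w ≤
      (L : ℝ≥0∞) ^ ((n : ℝ) - 2) * μH[(n : ℝ) - 2] (f ⁻¹' {w}) := by
  set φ := extChartAt (𝓡 n) x₀
  set P : ℕ → Set M := fun k ↦ (φ.source ∩ φ ⁻¹' t k) ∩ f ⁻¹' {w}
  have hP : ∀ k, MeasurableSet (P k) := fun k ↦
    (measurableSet_source_inter_preimage x₀ (ht k)).inter (hf.measurable (measurableSet_singleton w))
  have hPU : ∀ k, P k ⊆ U := fun k p hp ↦ by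
    have := hU k _ hp.1.2
    rwa [φ.left_inv hp.1.1] at this
  have hPd : Pairwise (Function.onFun Disjoint P) := fun k l hkl ↦
    Set.disjoint_left.2 fun p hp hp' ↦ Set.disjoint_left.1 (hd hkl) hp.1.2 hp'.1.2
  have hdim : (0 : ℝ) ≤ (n : ℝ) - 2 := by rw [← card_rest hij]; positivity
  have key : ∀ k, sliceVolume i j (fun z ↦ f (φ.symm z)) (t k) w ≤
      (L : ℝ≥0∞) ^ ((n : ℝ) - 2) * μH[(n : ℝ) - 2] (P k) := fun k ↦ by
    have himg : restProj i j '' (t k ∩ (fun z ↦ f (φ.symm z)) ⁻¹' {w}) ⊆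
        (restProj i j ∘ φ) '' P k := by
      rintro _ ⟨z, hz, rfl⟩
      have hz' := htarget k hz.1
      refine ⟨φ.symm z, ⟨⟨φ.map_target hz', ?_⟩, hz.2⟩, ?_⟩
      · rw [Set.mem_preimage, φ.right_inv hz']; exact hz.1
      · rw [Function.comp_apply, φ.right_inv hz']
    rw [sliceVolume, ← hausdorffMeasure_pi_real, card_rest hij]
    refine (measure_mono himg).trans ?_
    have h1 := ((lipschitzWith_restProj i j).comp_lipschitzOnWith (hL.mono (hPU k)))
    rw [one_mul] at h1
    exact h1.hausdorffMeasure_image_le hdim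
  refine (ENNReal.tsum_le_tsum key).trans ?_
  rw [ENNReal.tsum_mul_left, ← measure_iUnion hPd hP]
  exact mul_le_mul_right (measure_mono (Set.iUnion_subset fun k ↦ Set.inter_subset_right)) _

variable [IsManifold (𝓡 n) ∞ M] [RiemannianBundle (fun x : M ↦ TangentSpace (𝓡 n) x)]
  [IsContinuousRiemannianBundle (EuclideanSpace ℝ (Fin n)) (fun x : M ↦ TangentSpace (𝓡 n) x)]

lemma exists_isSpread_of_chart [CompactSpace M] {f : M → Plane} {K : ℝ≥0} (hf : LipschitzWith K f)
    (h : ∀ x₀ : M, ∃ N ∈ 𝓝 (extChartAt (𝓡 n) x₀ x₀), ∃ D : ℝ≥0, ∀ B : Set Plane, MeasurableSet B →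
      volume (N ∩ (extChartAt (𝓡 n) x₀).target ∩ {z | f ((extChartAt (𝓡 n) x₀).symm z) ∈ B}) ≤
        D * volume B) :
    ∃ C, IsSpread n f K C := by
  choose N hN D hD using h
  obtain ⟨t, r, C, hr, -, hC⟩ := exists_chart_cover N hN
  refine ⟨C * ∑ x ∈ t, (D x : ℝ≥0∞), hf, ?_, Measure.le_iff.2 fun B hB ↦ ?_⟩
  · exact ENNReal.mul_ne_top ENNReal.coe_ne_top (ENNReal.sum_ne_top.2 fun _ _ ↦ ENNReal.coe_ne_top)
  rw [Measure.map_apply hf.continuous.measurable hB, Measure.smul_apply, smul_eq_mul, mul_assoc,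
    Finset.sum_mul]
  refine (hC _ (hf.continuous.measurable hB)).trans (mul_le_mul_right ?_ _)
  refine Finset.sum_le_sum fun x _ ↦ (measure_mono ?_).trans (hD x B hB)
  exact fun z hz ↦ ⟨⟨((hr x).2 hz.1).2, ((hr x).2 hz.1).1⟩, hz.2⟩

variable [IsRiemannianManifold (𝓡 n) M]

theorem exists_isSpread_of_jacobian_of_hausdorffMeasure [CompactSpace M] {f : M → Plane} {K : ℝ≥0}
    (hf : LipschitzWith K f) {δ : ℝ} (hδ : 0 < δ)
    (hJ : ∀ᵐ x ∂(riemannianVolume n M), δ ≤ jacobian n f x) {H : ℝ≥0}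
    (hH : ∀ z : Plane, μH[(n : ℝ) - 2] (f ⁻¹' {z}) ≤ H) : ∃ C, IsSpread n f K C := by
  refine exists_isSpread_of_chart hf fun x₀ ↦ ?_
  obtain ⟨L, hL0, U, hU, hL⟩ := eventually_edist_extChartAt_le (n := n) x₀
  obtain ⟨C, hC0, hC⟩ := eventually_norm_le_coordFrame (n := n) x₀
  have hsymm : Tendsto (extChartAt (𝓡 n) x₀).symm (𝓝 (extChartAt (𝓡 n) x₀ x₀)) (𝓝 x₀) := by
    have := continuousAt_extChartAt_symm (I := 𝓡 n) x₀
    rwa [ContinuousAt, extChartAt_to_inv] at this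
  obtain ⟨N, hN, hNo, hx₀⟩ := mem_nhds_iff.1 ((hsymm.eventually hU).and hC)
  obtain ⟨c, hc⟩ : ∃ c : ℝ≥0, (c : ℝ) = δ / (n ^ 2 * C ^ 2 + 1) :=
    ⟨_, Real.coe_toNNReal _ (by positivity)⟩
  have hc0 : 0 < c := by rw [← NNReal.coe_pos, hc]; positivity
  set D : ℝ≥0 := L ^ ((n : ℝ) - 2) * H with hDdef
  set φ := extChartAt (𝓡 n) x₀
  set g : EuclideanSpace ℝ (Fin n) → Plane := fun z ↦ f (φ.symm z)
  -- One contribution `D / c` for each ordered pair of coordinates whose minor may be the large one.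
  refine ⟨N, hNo.mem_nhds hx₀, n * (n * (D / c)), fun B hB ↦ ?_⟩
  have hS₀ : MeasurableSet (N ∩ φ.target ∩ {z | g z ∈ B}) := by
    have := hNo.measurableSet.inter (measurableSet_target_inter_preimage (n := n) x₀
      (hf.continuous.measurable hB))
    rwa [← Set.inter_assoc] at this
  set S₀ := N ∩ φ.target ∩ {z | g z ∈ B}
  set S : Fin n → Fin n → Set (EuclideanSpace ℝ (Fin n)) := fun i j ↦
    S₀ ∩ ({z | DifferentiableAt ℝ g z} ∩ {z | c ≤ |minor i j (fderiv ℝ g z)|})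
  have hS : ∀ i j, MeasurableSet (S i j) := fun i j ↦ by
    refine hS₀.inter ((measurableSet_of_differentiableAt ℝ g).inter ?_)
    have h1 : ∀ (k : Fin n) (a : Fin 2),
        Measurable fun z ↦ fderiv ℝ g z (EuclideanSpace.single k 1) a := fun k a ↦
      (EuclideanSpace.proj a : Plane →L[ℝ] ℝ).continuous.measurable.comp
        (measurable_fderiv_apply_const ℝ g _)
    refine measurableSet_le measurable_const (_root_.continuous_abs.measurable.comp ?_)
    exact ((h1 i 0).mul (h1 j 1)).sub ((h1 i 1).mul (h1 j 0))
  have hae : volume S₀ ≤ ∑ i, ∑ j, volume (S i j) := by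
    have h1 := ae_chart_of_ae_riemannianVolume hJ x₀
    have h2 := ae_chart_of_ae_riemannianVolume (hf.ae_mdifferentiableAt (n := n)) x₀
    rw [ae_restrict_iff' (isOpen_extChartAt_target x₀).measurableSet] at h1 h2
    have h3 : volume S₀ ≤ volume (⋃ i, ⋃ j, S i j) := by
      refine measure_mono_ae ?_
      filter_upwards [h1, h2] with z hz1 hz2 hz
      have hd := (mdifferentiableAt_iff_chart f x₀ hz.1.2).1 (hz2 hz.1.2)
      obtain ⟨i, j, hij⟩ := exists_le_abs_minor hz.1.2 hd C.2 hδ (hN hz.1.1).2 (hz1 hz.1.2)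
      exact Set.mem_iUnion₂.2 ⟨i, j, hz, hd, hc.trans_le hij⟩
    refine h3.trans ((measure_iUnion_fintype_le _ _).trans (Finset.sum_le_sum fun i _ ↦
      measure_iUnion_fintype_le _ _))
  have hbound : ∀ i j, volume (S i j) ≤ (D / c : ℝ≥0) * volume B := fun i j ↦ by
    rcases eq_or_ne i j with rfl | hij
    · have : S i i = ∅ := by
        refine Set.eq_empty_of_forall_notMem fun z hz ↦ ?_
        have h1 : (c : ℝ) ≤ |minor i i (fderiv ℝ g z)| := hz.2.2
        rw [minor, mul_comm, sub_self, abs_zero] at h1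
        exact absurd h1 (not_le.2 (by exact_mod_cast hc0))
      simp [this]
    obtain ⟨t, htd, htm, hts, ht⟩ := exists_pieces_mul_volume_le hij (hS i j)
      (fun z hz ↦ (hz.2.1.hasFDerivAt).hasFDerivWithinAt) hc0 (fun z hz ↦ hz.2.2)
    have h1 : ∫⁻ w, ∑' k, sliceVolume i j g (t k) w ≤ D * volume B := by
      rw [← lintegral_indicator_const hB]
      refine lintegral_mono fun w ↦ ?_
      by_cases hw : w ∈ B
      · rw [Set.indicator_of_mem hw]
        refine (tsum_sliceVolume_le hf.continuous x₀ hL hij htd htm (fun k z hz ↦ (hts k hz).1.1.2)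
          (fun k z hz ↦ (hN (hts k hz).1.1.1).1) w).trans ?_
        rw [hDdef, ENNReal.coe_mul, ENNReal.coe_rpow_of_ne_zero hL0.ne']
        exact mul_le_mul_right (hH w) _
      · rw [Set.indicator_of_notMem hw]
        refine (ENNReal.tsum_eq_zero.2 fun k ↦ ?_).le
        have : t k ∩ g ⁻¹' {w} = ∅ := Set.eq_empty_of_forall_notMem fun z hz ↦
          hw ((show g z = w from hz.2) ▸ (hts k hz.1).1.2)
        rw [sliceVolume, this, Set.image_empty, measure_empty]
    rw [ENNReal.coe_div hc0.ne', ENNReal.div_eq_inv_mul, mul_assoc, mul_comm, ← div_eq_mul_inv]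
    refine (ENNReal.le_div_iff_mul_le (.inl (by exact_mod_cast hc0.ne')) (.inl ENNReal.coe_ne_top)).2
      ?_
    rw [mul_comm]
    exact ht.trans h1
  refine hae.trans ((Finset.sum_le_sum fun i _ ↦ Finset.sum_le_sum fun j _ ↦
    hbound i j).trans_eq ?_)
  simp [mul_assoc]

end Coarea

/-! ### A sawtooth function -/

section Zigzag

/-- The distance to the integers. -/
noncomputable def zigzag (t : ℝ) : ℝ := |t - round t|

lemma zigzag_nonneg (t : ℝ) : 0 ≤ zigzag t := abs_nonneg _

lemma zigzag_le (t : ℝ) : zigzag t ≤ 1 / 2 := abs_sub_round t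

lemma lipschitzWith_zigzag : LipschitzWith 1 zigzag := by
  refine LipschitzWith.of_le_add fun t u ↦ ?_
  rw [zigzag, zigzag, Real.dist_eq]
  have h1 := round_le t (round u)
  have h2 := abs_add_le (t - u) (u - round u)
  rw [sub_add_sub_cancel] at h2
  linarith

lemma eventually_zigzag_eq (t₀ : ℝ) : ∃ P : Finset (ℝ × ℝ), (∀ q ∈ P, q.1 = 1 ∨ q.1 = -1) ∧
    ∀ᶠ t in 𝓝 t₀, ∃ q ∈ P, zigzag t = q.1 * (t - q.2) := by
  -- For $|t-t_0|<1$ the nearest integer to $t$ is within $3/2$ of $t_0$.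
  refine ⟨({1, -1} : Finset ℝ) ×ˢ (Finset.Icc ⌊t₀ - 2⌋ ⌈t₀ + 2⌉).image (fun m : ℤ ↦ (m : ℝ)), ?_, ?_⟩
  · rintro ⟨s, m⟩ hq
    simpa using (Finset.mem_product.1 hq).1
  filter_upwards [Metric.ball_mem_nhds t₀ one_pos] with t ht
  rw [Metric.mem_ball, Real.dist_eq, abs_lt] at ht
  have h := abs_le.1 (abs_sub_round t)
  have hm : ((round t : ℤ) : ℝ) ∈
      (Finset.Icc ⌊t₀ - 2⌋ ⌈t₀ + 2⌉).image (fun m : ℤ ↦ (m : ℝ)) := by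
    refine Finset.mem_image_of_mem _ (Finset.mem_Icc.2 ⟨?_, ?_⟩)
    · have := Int.floor_le (t₀ - 2)
      exact_mod_cast (by linarith : ((⌊t₀ - 2⌋ : ℤ) : ℝ) ≤ round t)
    · have := Int.le_ceil (t₀ + 2)
      exact_mod_cast (by linarith : (round t : ℝ) ≤ ((⌈t₀ + 2⌉ : ℤ) : ℝ))
  rcases abs_choice (t - round t) with h1 | h1
  · exact ⟨(1, round t), Finset.mem_product.2 ⟨by simp, hm⟩, by rw [zigzag, h1, one_mul]⟩
  · exact ⟨(-1, round t), Finset.mem_product.2 ⟨by simp, hm⟩, by rw [zigzag, h1]; ring⟩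

end Zigzag

/-! ### Selections of submersions -/

section Selection

section Normed

variable {E F : Type*} [NormedAddCommGroup E] [NormedSpace ℝ E] [NormedAddCommGroup F]
  [NormedSpace ℝ F]

/-- With a right inverse $R$ of $T_0$, the map $TR$ is near the identity and hence invertible. -/
lemma eventually_surjective [FiniteDimensional ℝ F] {T₀ : E →L[ℝ] F}
    (h : Function.Surjective T₀) : ∀ᶠ T : E →L[ℝ] F in 𝓝 T₀, Function.Surjective T := by
  have := FiniteDimensional.complete ℝ F
  obtain ⟨R', hR'⟩ := (T₀ : E →ₗ[ℝ] F).exists_rightInverse_of_surjective (LinearMap.range_eq_top.2 h)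
  obtain ⟨R, hR⟩ : ∃ R : F →L[ℝ] E, T₀ ∘L R = 1 :=
    ⟨LinearMap.toContinuousLinearMap R', by ext v; exact congr($hR' v)⟩
  have hc : Continuous fun T : E →L[ℝ] F ↦ (T ∘L R : F →L[ℝ] F) :=
    continuous_id.clm_comp continuous_const
  have h1 : {A : F →L[ℝ] F | IsUnit A} ∈ 𝓝 (T₀ ∘L R) := by
    refine Units.isOpen.mem_nhds ?_
    rw [hR]
    exact isUnit_one
  filter_upwards [hc.continuousAt.preimage_mem_nhds h1] with T hT v
  obtain ⟨A, hA⟩ := hT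
  refine ⟨R ((A⁻¹ : (F →L[ℝ] F)ˣ).1 v), ?_⟩
  have h2 : (T ∘L R) ((A⁻¹ : (F →L[ℝ] F)ˣ).1 v) = v := by
    rw [← show (A : F →L[ℝ] F) = T ∘L R from hA]
    exact congr($(A.mul_inv) v)
  exact h2

lemma surjective_prod_smul {A : E →L[ℝ] F} {γ : E →L[ℝ] ℝ} {c : ℝ} (hc : c ≠ 0)
    (h : Function.Surjective (A.prod γ)) : Function.Surjective (A.prod (c • γ)) := by
  rintro ⟨v, t⟩
  obtain ⟨u, hu⟩ := h (v, c⁻¹ * t)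
  obtain ⟨h1, h2⟩ := Prod.mk.inj hu
  refine ⟨u, Prod.ext h1 ?_⟩
  change c * γ u = t
  rw [show γ u = c⁻¹ * t from h2, mul_inv_cancel_left₀ hc]

lemma surjective_prod_of_ker {A : E →L[ℝ] F} (hA : Function.Surjective A) {γ : E →L[ℝ] ℝ} {v : E}
    (hv : A v = 0) (hγ : γ v ≠ 0) : Function.Surjective (A.prod γ) := by
  rintro ⟨w, t⟩
  obtain ⟨u, rfl⟩ := hA w
  refine ⟨u + ((t - γ u) / γ v) • v, Prod.ext ?_ ?_⟩
  · change A (u + _ • v) = A u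
    rw [map_add, map_smul, hv, smul_zero, add_zero]
  · change γ (u + _ • v) = t
    rw [map_add, map_smul, smul_eq_mul, div_mul_cancel₀ _ hγ]
    ring

/-- `G` is near `z₀` a selection of finitely many `C¹` submersions. -/
def IsSubmersiveSelection (G : E → F) (z₀ : E) : Prop :=
  ∃ S : Set (E → F), S.Finite ∧
    (∀ g ∈ S, ContDiffAt ℝ 1 g z₀ ∧ Function.Surjective (fderiv ℝ g z₀)) ∧
    ∀ᶠ z in 𝓝 z₀, ∃ g ∈ S, G z = g z

lemma isSubmersiveSelection_of_forall {ι : Type*} {t : Set ι} (ht : t.Finite) {G : ι → E → F}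
    {H : E → F} {z₀ : E} (hG : ∀ i ∈ t, IsSubmersiveSelection (G i) z₀)
    (hH : ∀ᶠ z in 𝓝 z₀, ∃ i ∈ t, H z = G i z) : IsSubmersiveSelection H z₀ := by
  choose! S hS hg hGS using hG
  refine ⟨⋃ i ∈ t, S i, ht.biUnion hS, fun g hg' ↦ ?_, ?_⟩
  · obtain ⟨i, hi, hgi⟩ := Set.mem_iUnion₂.1 hg'
    exact hg i hi g hgi
  · filter_upwards [hH, (eventually_all_finite ht).2 hGS] with z ⟨i, hi, hz⟩ h
    obtain ⟨g, hg, hgz⟩ := h i hi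
    exact ⟨g, Set.mem_iUnion₂.2 ⟨i, hi, hg⟩, hz.trans hgz⟩

lemma IsSubmersiveSelection.congr {G H : E → F} {z₀ : E} (hG : IsSubmersiveSelection G z₀)
    (h : H =ᶠ[𝓝 z₀] G) : IsSubmersiveSelection H z₀ :=
  isSubmersiveSelection_of_forall (t := {()}) (G := fun _ ↦ G) (Set.finite_singleton _)
    (fun _ _ ↦ hG) (h.mono fun _ hz ↦ ⟨(), rfl, hz⟩)

lemma IsSubmersiveSelection.comp {E' : Type*} [NormedAddCommGroup E'] [NormedSpace ℝ E']
    {G : E → F} {τ : E' → E} {w₀ : E'} (hG : IsSubmersiveSelection G (τ w₀))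
    (hτ : ContDiffAt ℝ 1 τ w₀) (hs : Function.Surjective (fderiv ℝ τ w₀)) :
    IsSubmersiveSelection (G ∘ τ) w₀ := by
  obtain ⟨S, hS, hg, hGS⟩ := hG
  refine ⟨(· ∘ τ) '' S, hS.image _, ?_, ?_⟩
  · rintro _ ⟨g, hgS, rfl⟩
    refine ⟨(hg g hgS).1.comp w₀ hτ, ?_⟩
    rw [fderiv_comp w₀ ((hg g hgS).1.differentiableAt one_ne_zero)
      (hτ.differentiableAt one_ne_zero)]
    exact (hg g hgS).2.comp hs
  · filter_upwards [hτ.continuousAt.eventually hGS] with w ⟨g, hg, hw⟩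
    exact ⟨g ∘ τ, ⟨g, hg, rfl⟩, hw⟩

lemma IsSubmersiveSelection.clm_comp {F' : Type*} [NormedAddCommGroup F'] [NormedSpace ℝ F']
    {G : E → F} {z₀ : E} (hG : IsSubmersiveSelection G z₀) {L : F →L[ℝ] F'}
    (hL : Function.Surjective L) : IsSubmersiveSelection (fun z ↦ L (G z)) z₀ := by
  obtain ⟨S, hS, hg, hGS⟩ := hG
  refine ⟨(fun g z ↦ L (g z)) '' S, hS.image _, ?_, ?_⟩
  · rintro _ ⟨g, hgS, rfl⟩
    refine ⟨L.contDiff.contDiffAt.comp z₀ (hg g hgS).1, ?_⟩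
    have := (L.hasFDerivAt.comp z₀ ((hg g hgS).1.differentiableAt one_ne_zero).hasFDerivAt).fderiv
    change Function.Surjective (fderiv ℝ (L ∘ g) z₀)
    rw [this]
    exact hL.comp (hg g hgS).2
  · filter_upwards [hGS] with z ⟨g, hg, hz⟩
    exact ⟨_, ⟨g, hg, rfl⟩, congrArg L hz⟩

end Normed

variable {E F : Type*} [NormedAddCommGroup E] [InnerProductSpace ℝ E] [FiniteDimensional ℝ E]
  [NormedAddCommGroup F] [NormedSpace ℝ F] [FiniteDimensional ℝ F]

/-- By dimension each kernel contains a nonzero vector, and some functional is nonzero on finitely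
many nonzero vectors at once. -/
lemma exists_forall_surjective_prod {S : Set (E →L[ℝ] F)} (hS : S.Finite)
    (hs : ∀ A ∈ S, Function.Surjective A) (hd : Module.finrank ℝ F < Module.finrank ℝ E) :
    ∃ β : E →L[ℝ] ℝ, ∀ A ∈ S, Function.Surjective (A.prod β) := by
  have hker : ∀ A : S, ∃ v : E, A.1 v = 0 ∧ v ≠ 0 := fun A ↦ by
    have := LinearMap.ker_ne_bot_of_finrank_lt (f := (A.1 : E →ₗ[ℝ] F)) hd
    obtain ⟨v, hv, hv0⟩ := (Submodule.ne_bot_iff _).1 this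
    exact ⟨v, hv, hv0⟩
  choose v hv hv0 using hker
  have := hS.to_subtype
  obtain ⟨β, hβ⟩ := Module.exists_dual_forall_apply_ne_zero (K := ℝ) v hv0
  exact ⟨LinearMap.toContinuousLinearMap β, fun A hA ↦
    surjective_prod_of_ker (hs A hA) (hv ⟨A, hA⟩) (hβ ⟨A, hA⟩)⟩

/-- A submersive selection can be extended by one real component that is at least `1` near the
centre of a given ball and at most `0` outside it. -/
lemma IsSubmersiveSelection.exists_prod {G : E → F} {z₀ : E} (hG : IsSubmersiveSelection G z₀)
    (hd : Module.finrank ℝ F < Module.finrank ℝ E) {U : Set E} (hU : U ∈ 𝓝 z₀) :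
    ∃ r : ℝ, 0 < r ∧ Metric.closedBall z₀ r ⊆ U ∧ ∃ Q : E → ℝ, LocallyLipschitz Q ∧
      (∀ z, ‖z - z₀‖ ≤ r / 2 → 1 ≤ Q z) ∧ (∀ z, r ≤ ‖z - z₀‖ → Q z ≤ 0) ∧
      ∀ z, ‖z - z₀‖ < r → IsSubmersiveSelection (fun z ↦ (G z, Q z)) z := by
  obtain ⟨S, hS, hg, hGS⟩ := hG
  obtain ⟨β, hβ⟩ := exists_forall_surjective_prod (S := (fun g ↦ fderiv ℝ g z₀) '' S) (hS.image _)
    (by rintro _ ⟨g, h, rfl⟩; exact (hg g h).2) hd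
  have h1 : ∀ g ∈ S, ∀ᶠ p : E × (E →L[ℝ] ℝ) in 𝓝 (z₀, β),
      ContDiffAt ℝ 1 g p.1 ∧ Function.Surjective ((fderiv ℝ g p.1).prod p.2) := fun g h ↦ by
    have hc : ContinuousAt (fun p : E × (E →L[ℝ] ℝ) ↦ (fderiv ℝ g p.1).prod p.2) (z₀, β) := by
      have e : (fun p : E × (E →L[ℝ] ℝ) ↦ (fderiv ℝ g p.1).prod p.2) = fun p ↦
          ContinuousLinearMap.inl ℝ F ℝ ∘L fderiv ℝ g p.1 +
            ContinuousLinearMap.inr ℝ F ℝ ∘L p.2 := by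
        ext p v <;> simp
      rw [e]
      have h2 : ContinuousAt (fun p : E × (E →L[ℝ] ℝ) ↦ fderiv ℝ g p.1) (z₀, β) :=
        ContinuousAt.comp (f := Prod.fst) ((hg g h).1.continuousAt_fderiv one_ne_zero)
          continuousAt_fst
      exact (continuousAt_const.clm_comp h2).add (continuousAt_const.clm_comp continuousAt_snd)
    refine Eventually.and ?_ (hc.eventually (eventually_surjective (hβ _ ⟨g, h, rfl⟩)))
    exact continuousAt_fst.eventually ((hg g h).1.eventually (by simp))
  -- Transversality is open: it persists for base points within `ρ` of `z₀` and covectors within `ρ`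
  -- of `β`.
  obtain ⟨ρ, hρ, h2⟩ := Metric.eventually_nhds_iff_ball.1 ((eventually_all_finite hS).2 h1)
  obtain ⟨r₁, hr₁, hU'⟩ := Metric.nhds_basis_closedBall.mem_iff.1 hU
  obtain ⟨r₂, hr₂, h3⟩ := Metric.eventually_nhds_iff_ball.1 hGS.eventually_nhds
  set r := min (min r₁ r₂) ρ
  have hr : 0 < r := lt_min (lt_min hr₁ hr₂) hρ
  -- The sawtooth is so steep that $dq/c$, of norm at most $\frac4{r^2}\cdot
  -- r\cdot\frac{r\rho}8=\rho/2$, moves the covector `β` by less than `ρ`.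
  set c : ℝ := 8 / (r * ρ)
  have hc : 0 < c := by positivity
  set q : E → ℝ := fun z ↦ 2 * (1 - ‖z - z₀‖ ^ 2 / r ^ 2)
  have hq : ContDiff ℝ 1 q := by
    refine contDiff_const.mul (contDiff_const.sub (ContDiff.div_const ?_ _))
    exact (contDiff_id.sub contDiff_const).norm_sq ℝ
  have hq' : ∀ z, HasFDerivAt q (-(4 / r ^ 2) • innerSL ℝ (z - z₀)) z := fun z ↦ by
    have h4 := ((hasStrictFDerivAt_norm_sq (z - z₀)).hasFDerivAt.comp z
      ((hasFDerivAt_id z).sub_const z₀))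
    have h5 := ((h4.const_mul (1 / r ^ 2)).const_sub 1).const_mul 2
    refine (h5.congr_of_eventuallyEq (.of_forall fun w ↦ ?_)).congr_fderiv ?_
    · simp [q, div_eq_inv_mul]
    · ext v
      simp
      ring
  -- The shifted sawtooth lies in $[-\frac12,0]$, while $q\ge\frac32$ on the half ball and $q\le0$
  -- outside the ball.
  set Q : E → ℝ := fun z ↦ q z + zigzag (c * β z) - 1 / 2
  refine ⟨r, hr, (Metric.closedBall_subset_closedBall ((min_le_left _ _).trans (min_le_left _ _))).trans
    hU', Q, ?_, fun z hz ↦ ?_, fun z hz ↦ ?_, fun z hz ↦ ?_⟩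
  · have h4 : LocallyLipschitz fun z ↦ zigzag (c * β z) :=
      (lipschitzWith_zigzag.comp (c • β).lipschitz).locallyLipschitz
    exact (hq.locallyLipschitz.add h4).sub (LocallyLipschitz.const _)
  · have h4 : ‖z - z₀‖ ^ 2 / r ^ 2 ≤ 1 / 4 := by
      rw [div_le_iff₀ (by positivity)]
      nlinarith [norm_nonneg (z - z₀)]
    have := zigzag_nonneg (c * β z)
    simp only [Q, q]
    linarith
  · have h4 : 1 ≤ ‖z - z₀‖ ^ 2 / r ^ 2 := by
      rw [le_div_iff₀ (by positivity)]
      nlinarith [norm_nonneg (z - z₀)]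
    have := zigzag_le (c * β z)
    simp only [Q, q]
    linarith
  obtain ⟨P, hP, hPz⟩ := eventually_zigzag_eq (c * β z)
  refine ⟨(fun p : (E → F) × (ℝ × ℝ) ↦ fun w ↦
    (p.1 w, q w + p.2.1 * (c * β w - p.2.2) - 1 / 2)) '' (S ×ˢ (P : Set (ℝ × ℝ))),
    (hS.prod P.finite_toSet).image _, ?_, ?_⟩
  · rintro _ ⟨⟨g, s, m⟩, ⟨hgS, hs⟩, rfl⟩
    have hs' : s = 1 ∨ s = -1 := hP _ hs
    have hz' : z ∈ Metric.ball z₀ ρ := by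
      rw [Metric.mem_ball, dist_eq_norm]; exact hz.trans_le (min_le_right _ _)
    have hg1 : ContDiffAt ℝ 1 g z := (h2 (z, β) (by
      rw [← ball_prod_same]; exact ⟨hz', Metric.mem_ball_self hρ⟩) g hgS).1
    have hd' : HasFDerivAt (fun w ↦ q w + s * (c * β w - m) - 1 / 2)
        ((s * c) • (β + (s / c * -(4 / r ^ 2)) • innerSL ℝ (z - z₀))) z := by
      have h5 := ((hq' z).add (((β.hasFDerivAt (x := z)).const_mul c).sub_const m |>.const_mul s)).sub_const
        (1 / 2 : ℝ)
      refine h5.congr_fderiv ?_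
      have hss : s * s = 1 := by rcases hs' with rfl | rfl <;> norm_num
      have e : s * c * (s / c * -(4 / r ^ 2)) = -(4 / r ^ 2) := by
        field_simp
        rw [sq, hss]
      rw [smul_add, smul_smul (s * c), e, smul_smul s c, add_comm]
    have hcd : ContDiff ℝ 1 (fun w ↦ q w + s * (c * β w - m) - 1 / 2) :=
      (hq.add (contDiff_const.mul ((contDiff_const.mul β.contDiff).sub contDiff_const))).sub
        contDiff_const
    refine ⟨hg1.prodMk hcd.contDiffAt, ?_⟩
    rw [((hg1.differentiableAt one_ne_zero).hasFDerivAt.prodMk hd').fderiv]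
    refine surjective_prod_smul (mul_ne_zero (by rcases hs' with rfl | rfl <;> norm_num) hc.ne') ?_
    refine (h2 (z, _) ?_ g hgS).2
    rw [← ball_prod_same]
    refine ⟨hz', ?_⟩
    rw [Metric.mem_ball, dist_eq_norm, add_sub_cancel_left, norm_smul, innerSL_apply_norm]
    have e : ‖s / c * -(4 / r ^ 2)‖ = ρ / (2 * r) := by
      rw [norm_mul, norm_div, norm_neg, Real.norm_of_nonneg hc.le,
        Real.norm_of_nonneg (by positivity : 0 ≤ 4 / r ^ 2)]
      have : ‖s‖ = 1 := by rcases hs' with rfl | rfl <;> norm_num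
      rw [this]
      simp only [c]
      field_simp
      norm_num
    rw [e]
    calc ρ / (2 * r) * ‖z - z₀‖ ≤ ρ / (2 * r) * r := by gcongr
      _ = ρ / 2 := by field_simp
      _ < ρ := half_lt_self hρ
  · have hz' : z ∈ Metric.ball z₀ r₂ := by
      rw [Metric.mem_ball, dist_eq_norm]
      exact hz.trans_le ((min_le_left _ _).trans (min_le_right _ _))
    have hcont : ContinuousAt (fun w ↦ c * β w) z := by fun_prop
    filter_upwards [h3 z hz', hcont.eventually hPz] with w ⟨g, hgS, hw⟩ ⟨p, hp, hpw⟩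
    refine ⟨_, ⟨(g, p), ⟨hgS, hp⟩, rfl⟩, ?_⟩
    exact Prod.ext hw (by simp only [Q, hpw])

end Selection

/-! ### Submersive selections spread volume -/

section LocalSpread

variable {n : ℕ}

/-- The determinant of $(Lu,Lv)$ is a combination of the minors, and it is 1 when $Lu$, $Lv$ are the
standard basis. -/
lemma exists_minor_ne_zero {L : EuclideanSpace ℝ (Fin n) →L[ℝ] Plane}
    (hL : Function.Surjective L) : ∃ i j, minor i j L ≠ 0 := by
  by_contra! hcon
  obtain ⟨u, hu⟩ := hL (EuclideanSpace.single 0 1)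
  obtain ⟨v, hv⟩ := hL (EuclideanSpace.single 1 1)
  have key : ∀ (w : EuclideanSpace ℝ (Fin n)) (a : Fin 2),
      L w a = ∑ i, w i * L (EuclideanSpace.single i 1) a := fun w a ↦ by
    conv_lhs => rw [← (EuclideanSpace.basisFun (Fin n) ℝ).sum_repr w]
    simp
  have h1 : L u 0 * L v 1 - L u 1 * L v 0 = 0 := by
    rw [key u, key u, key v, key v, Finset.sum_mul_sum, Finset.sum_mul_sum,
      ← Finset.sum_sub_distrib]
    refine Finset.sum_eq_zero fun i _ ↦ ?_
    rw [← Finset.sum_sub_distrib]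
    refine Finset.sum_eq_zero fun j _ ↦ ?_
    have := hcon i j
    rw [minor] at this
    linear_combination u i * v j * this
  rw [hu, hv] at h1
  simp at h1

lemma continuous_minor (i j : Fin n) :
    Continuous fun L : EuclideanSpace ℝ (Fin n) →L[ℝ] Plane ↦ minor i j L := by
  unfold minor
  fun_prop

/-- A `C¹` submersion to the plane spreads volume near each point. -/
lemma exists_volume_inter_preimage_le {g : EuclideanSpace ℝ (Fin n) → Plane}
    {z₀ : EuclideanSpace ℝ (Fin n)} (hg : ContDiffAt ℝ 1 g z₀)
    (hs : Function.Surjective (fderiv ℝ g z₀)) :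
    ∃ N ∈ 𝓝 z₀, ∃ D : ℝ≥0, ∀ B : Set Plane, MeasurableSet B →
      volume (N ∩ g ⁻¹' B) ≤ D * volume B := by
  obtain ⟨i, j, hm⟩ := exists_minor_ne_zero hs
  have hij : i ≠ j := by
    rintro rfl
    exact hm (by rw [minor, mul_comm, sub_self])
  have hstrict : HasStrictFDerivAt (replaceCoords i j g) (replaceCoordsCLM i j (fderiv ℝ g z₀)) z₀ :=
    (hasStrictFDerivAt_id z₀).add ((coordInj i j).hasStrictFDerivAt.comp z₀
      ((hg.hasStrictFDerivAt one_ne_zero).sub (coordProj i j).hasStrictFDerivAt))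
  have hdet : (replaceCoordsCLM i j (fderiv ℝ g z₀)).det ≠ 0 := by rwa [det_replaceCoordsCLM hij]
  set A := (replaceCoordsCLM i j (fderiv ℝ g z₀)).toContinuousLinearEquivOfDetNeZero hdet
  have hstrict' : HasStrictFDerivAt (replaceCoords i j g)
    (A : EuclideanSpace ℝ (Fin n) →L[ℝ] EuclideanSpace ℝ (Fin n)) z₀ := hstrict
  set Φ := hstrict'.toOpenPartialHomeomorph (replaceCoords i j g)
  have h1 : Φ.source ∈ 𝓝 z₀ :=
    Φ.open_source.mem_nhds hstrict'.mem_toOpenPartialHomeomorph_source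
  have hinj : Set.InjOn (replaceCoords i j g) Φ.source := Φ.injOn
  obtain ⟨c, hc0, hc⟩ : ∃ c : ℝ≥0, 0 < c ∧ (c : ℝ) < |minor i j (fderiv ℝ g z₀)| := by
    obtain ⟨c, hc0, hc⟩ := exists_between (abs_pos.2 hm)
    exact ⟨⟨c, hc0.le⟩, hc0, hc⟩
  have h2 : ∀ᶠ z in 𝓝 z₀, (c : ℝ) < |minor i j (fderiv ℝ g z)| :=
    ((continuous_minor i j).abs.continuousAt.comp
      (hg.continuousAt_fderiv one_ne_zero)).eventually (lt_mem_nhds hc)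
  have h3 : ∀ᶠ z in 𝓝 z₀, ContDiffAt ℝ 1 g z := hg.eventually (by simp)
  obtain ⟨r, hr, hN⟩ := Metric.mem_nhds_iff.1 (inter_mem h1 (h2.and h3))
  set N := Metric.ball z₀ r
  have hcont : ContinuousOn g N := fun z hz ↦ (hN hz).2.2.continuousAt.continuousWithinAt
  -- Every slice projects into this bounded set, so no fibre estimate is needed here.
  set D := volume (restProj i j '' N)
  have hD : D ≠ ⊤ :=
    ((lipschitzWith_restProj i j).isBounded_image Metric.isBounded_ball).measure_lt_top.ne
  refine ⟨N, Metric.ball_mem_nhds z₀ hr, D.toNNReal / c, fun B hB ↦ ?_⟩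
  have hmeas : MeasurableSet (N ∩ g ⁻¹' B) :=
    hcont.measurableSet_inter_preimage Metric.isOpen_ball.measurableSet hB
  have h4 := mul_volume_le_lintegral_sliceVolume (c := c) hij hmeas
    (fun z hz ↦ ((hN hz.1).2.2.differentiableAt one_ne_zero).hasFDerivAt.hasFDerivWithinAt)
    (hinj.mono fun z hz ↦ (hN hz.1).1) (fun z hz ↦ (hN hz.1).2.1.le)
  have h5 : ∫⁻ w, sliceVolume i j g (N ∩ g ⁻¹' B) w ≤ D * volume B := by
    rw [← lintegral_indicator_const hB]
    refine lintegral_mono fun w ↦ ?_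
    by_cases hw : w ∈ B
    · rw [Set.indicator_of_mem hw]
      exact measure_mono (Set.image_mono fun z hz ↦ hz.1.1)
    · rw [Set.indicator_of_notMem hw]
      have : N ∩ g ⁻¹' B ∩ g ⁻¹' {w} = ∅ := Set.eq_empty_of_forall_notMem fun z hz ↦
        hw ((show g z = w from hz.2) ▸ hz.1.2)
      rw [sliceVolume, this, Set.image_empty, measure_empty]
  rw [ENNReal.coe_div hc0.ne', ENNReal.coe_toNNReal hD, ENNReal.div_eq_inv_mul, mul_assoc, mul_comm,
    ← div_eq_mul_inv]
  refine (ENNReal.le_div_iff_mul_le (.inl (by exact_mod_cast hc0.ne')) (.inl ENNReal.coe_ne_top)).2 ?_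
  rw [mul_comm]
  exact h4.trans h5

lemma IsSubmersiveSelection.exists_volume_le {G : EuclideanSpace ℝ (Fin n) → Plane}
    {z₀ : EuclideanSpace ℝ (Fin n)} (hG : IsSubmersiveSelection G z₀) :
    ∃ N ∈ 𝓝 z₀, ∃ D : ℝ≥0, ∀ B : Set Plane, MeasurableSet B →
      volume (N ∩ G ⁻¹' B) ≤ D * volume B := by
  obtain ⟨S, hS, hg, hGS⟩ := hG
  choose! N hN D hD using fun g (h : g ∈ S) ↦ exists_volume_inter_preimage_le (hg g h).1 (hg g h).2
  refine ⟨{z | ∃ g ∈ S, G z = g z} ∩ ⋂ g ∈ S, N g, inter_mem hGS ((biInter_mem hS).2 hN),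
    ∑ g ∈ hS.toFinset, D g, fun B hB ↦ ?_⟩
  calc volume _ ≤ volume (⋃ g ∈ hS.toFinset, N g ∩ g ⁻¹' B) := by
        refine measure_mono ?_
        rintro z ⟨⟨⟨g, hg, hz⟩, hzN⟩, hzB⟩
        refine Set.mem_iUnion₂.2 ⟨g, hS.mem_toFinset.2 hg, Set.mem_iInter₂.1 hzN g hg, ?_⟩
        rw [Set.mem_preimage, ← hz]
        exact hzB
    _ ≤ ∑ g ∈ hS.toFinset, volume (N g ∩ g ⁻¹' B) := measure_biUnion_finset_le _ _
    _ ≤ ∑ g ∈ hS.toFinset, D g * volume B :=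
        Finset.sum_le_sum fun g hg ↦ hD g (hS.mem_toFinset.1 hg) B hB
    _ = _ := by rw [← Finset.sum_mul, ENNReal.ofNNReal_finsetSum]

end LocalSpread

/-! ### From locally Lipschitz to Lipschitz -/

section CompactLipschitz

/-- Points closer than a Lebesgue number lie in a common set of the cover; for the others the
diameter of the image divided by a lower bound for the distance serves as constant. -/
lemma _root_.LocallyLipschitz.exists_lipschitzWith_of_compactSpace {X Y : Type*} [PseudoEMetricSpace X]
    [CompactSpace X] [PseudoMetricSpace Y] {f : X → Y} (hf : LocallyLipschitz f) :
    ∃ K, LipschitzWith K f := by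
  have hc := hf.continuous
  choose K t ht hK using hf
  obtain ⟨s, -, hs⟩ := isCompact_univ.elim_nhds_subcover (fun x ↦ interior (t x))
    fun x _ ↦ interior_mem_nhds.2 (ht x)
  obtain ⟨δ, hδ, hδt⟩ := lebesgue_number_lemma_of_emetric (ι := s) (c := fun x ↦ interior (t x))
    isCompact_univ (fun x ↦ isOpen_interior) (fun x hx ↦ by
      obtain ⟨i, hi, hxi⟩ := Set.mem_iUnion₂.1 (hs hx)
      exact Set.mem_iUnion.2 ⟨⟨i, hi⟩, hxi⟩)
  obtain ⟨D, hD⟩ : ∃ D : ℝ≥0, ∀ x y, edist (f x) (f y) ≤ D := by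
    have h := (isCompact_range hc).isBounded.ediam_ne_top
    exact ⟨(Metric.ediam (Set.range f)).toNNReal, fun x y ↦ by
      rw [ENNReal.coe_toNNReal h]
      exact Metric.edist_le_ediam_of_mem (Set.mem_range_self x) (Set.mem_range_self y)⟩
  obtain ⟨η, hη0, hη⟩ : ∃ η : ℝ≥0, 0 < η ∧ (η : ℝ≥0∞) < δ := by
    obtain ⟨η, h1, h2⟩ := ENNReal.lt_iff_exists_nnreal_btwn.1 hδ
    exact ⟨η, by exact_mod_cast h1, h2⟩
  refine ⟨max (s.sup K) (D / η), fun x y ↦ ?_⟩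
  rcases lt_or_ge (edist y x) δ with h | h
  · obtain ⟨i, hi⟩ := hδt x (Set.mem_univ x)
    refine (hK i (interior_subset (hi (Metric.mem_eball_self hδ))) (interior_subset (hi h))).trans ?_
    gcongr
    exact (Finset.le_sup (f := K) i.2).trans (le_max_left _ _)
  · refine (hD x y).trans ?_
    rw [edist_comm]
    calc (D : ℝ≥0∞) = ((D / η : ℝ≥0) : ℝ≥0∞) * η := by
          rw [← ENNReal.coe_mul, div_mul_cancel₀ _ hη0.ne']
      _ ≤ _ := by
          gcongr
          · exact le_max_right _ _
          · exact hη.le.trans h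

end CompactLipschitz

/-! ### A spread map on every compact manifold -/

section Construction

variable {n : ℕ} {M : Type*} [EMetricSpace M] [ChartedSpace (EuclideanSpace ℝ (Fin n)) M]

lemma eventually_symm_mem_source (x y : M) {p : M} (hx : p ∈ (extChartAt (𝓡 n) x).source)
    (hy : p ∈ (extChartAt (𝓡 n) y).source) :
    ∀ᶠ w in 𝓝 (extChartAt (𝓡 n) y p), (extChartAt (𝓡 n) y).symm w ∈ (extChartAt (𝓡 n) x).source := by
  have h := continuousAt_extChartAt_symm' (I := 𝓡 n) hy
  refine h.eventually_mem ?_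
  rw [(extChartAt (𝓡 n) y).left_inv hy]
  exact (isOpen_extChartAt_source x).mem_nhds hx

variable [IsManifold (𝓡 n) ∞ M]

lemma contDiffAt_transition (x y : M) {p : M} (hx : p ∈ (extChartAt (𝓡 n) x).source)
    (hy : p ∈ (extChartAt (𝓡 n) y).source) :
    ContDiffAt ℝ 1 (fun w ↦ extChartAt (𝓡 n) x ((extChartAt (𝓡 n) y).symm w))
      (extChartAt (𝓡 n) y p) := by
  rw [← contMDiffAt_iff_contDiffAt]
  have h1 : ContMDiffAt 𝓘(ℝ, EuclideanSpace ℝ (Fin n)) (𝓡 n) 1 (extChartAt (𝓡 n) y).symm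
      (extChartAt (𝓡 n) y p) :=
    (contMDiffOn_extChartAt_symm (n := 1) (I := 𝓡 n) y).contMDiffAt
      ((isOpen_extChartAt_target y).mem_nhds ((extChartAt (𝓡 n) y).map_source hy))
  have h2 : ContMDiffAt (𝓡 n) 𝓘(ℝ, EuclideanSpace ℝ (Fin n)) 1 (extChartAt (𝓡 n) x)
      ((extChartAt (𝓡 n) y).symm (extChartAt (𝓡 n) y p)) := by
    rw [(extChartAt (𝓡 n) y).left_inv hy]
    exact contMDiffAt_extChartAt' (by simpa [extChartAt_source] using hx)
  exact h2.comp _ h1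

lemma surjective_fderiv_transition (x y : M) {p : M} (hx : p ∈ (extChartAt (𝓡 n) x).source)
    (hy : p ∈ (extChartAt (𝓡 n) y).source) : Function.Surjective
      (fderiv ℝ (fun w ↦ extChartAt (𝓡 n) x ((extChartAt (𝓡 n) y).symm w))
        (extChartAt (𝓡 n) y p)) := by
  have h1 := ((contDiffAt_transition x y hx hy).differentiableAt one_ne_zero).hasFDerivAt
  have h2 := ((contDiffAt_transition y x hy hx).differentiableAt one_ne_zero).hasFDerivAt
  have e : extChartAt (𝓡 n) y p =
      extChartAt (𝓡 n) y ((extChartAt (𝓡 n) x).symm (extChartAt (𝓡 n) x p)) := by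
    rw [(extChartAt (𝓡 n) x).left_inv hx]
  have h3 : HasFDerivAt (fun w ↦ extChartAt (𝓡 n) x ((extChartAt (𝓡 n) y).symm w))
      (fderiv ℝ (fun w ↦ extChartAt (𝓡 n) x ((extChartAt (𝓡 n) y).symm w)) (extChartAt (𝓡 n) y p))
      (extChartAt (𝓡 n) y ((extChartAt (𝓡 n) x).symm (extChartAt (𝓡 n) x p))) := by
    rwa [← e]
  have h4 := h3.comp (extChartAt (𝓡 n) x p) h2
  have h5 : (fun w ↦ extChartAt (𝓡 n) x ((extChartAt (𝓡 n) y).symm w)) ∘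
      (fun w ↦ extChartAt (𝓡 n) y ((extChartAt (𝓡 n) x).symm w)) =ᶠ[𝓝 (extChartAt (𝓡 n) x p)] id := by
    filter_upwards [eventually_symm_mem_source y x hy hx, (isOpen_extChartAt_target x).mem_nhds
      ((extChartAt (𝓡 n) x).map_source hx)] with w hw hw'
    simp only [Function.comp_apply, (extChartAt (𝓡 n) y).left_inv hw,
      (extChartAt (𝓡 n) x).right_inv hw', id]
  have h6 := h4.unique ((hasFDerivAt_id _).congr_of_eventuallyEq h5)
  exact fun v ↦ ⟨_, congr($h6 v)⟩

lemma IsSubmersiveSelection.change_chart {F : Type*} [NormedAddCommGroup F] [NormedSpace ℝ F]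
    (x y : M) {p : M} (hx : p ∈ (extChartAt (𝓡 n) x).source)
    (hy : p ∈ (extChartAt (𝓡 n) y).source) {G : EuclideanSpace ℝ (Fin n) → F}
    (hG : IsSubmersiveSelection G (extChartAt (𝓡 n) x p)) :
    IsSubmersiveSelection (fun w ↦ G (extChartAt (𝓡 n) x ((extChartAt (𝓡 n) y).symm w)))
      (extChartAt (𝓡 n) y p) := by
  refine IsSubmersiveSelection.comp (G := G) ?_ (contDiffAt_transition x y hx hy)
    (surjective_fderiv_transition x y hx hy)
  rwa [(extChartAt (𝓡 n) y).left_inv hy]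

variable [RiemannianBundle (fun x : M ↦ TangentSpace (𝓡 n) x)]
  [IsContinuousRiemannianBundle (EuclideanSpace ℝ (Fin n)) (fun x : M ↦ TangentSpace (𝓡 n) x)]
  [IsRiemannianManifold (𝓡 n) M]

lemma locallyLipschitzOn_extChartAt (x : M) :
    LocallyLipschitzOn (extChartAt (𝓡 n) x).source (extChartAt (𝓡 n) x) := by
  intro p hp
  have hp' := mem_extChartAt_source (I := 𝓡 n) p
  obtain ⟨C, -, U, hU, hC⟩ := eventually_edist_extChartAt_le (n := n) p
  obtain ⟨K, t, ht, hK⟩ := (contDiffAt_transition x p hp hp').exists_lipschitzOnWith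
  have ht' : extChartAt (𝓡 n) p ⁻¹' t ∈ 𝓝 p :=
    (continuousAt_extChartAt (I := 𝓡 n) p).preimage_mem_nhds ht
  refine ⟨K * C, U ∩ (extChartAt (𝓡 n) p ⁻¹' t ∩ (extChartAt (𝓡 n) p).source),
    mem_nhdsWithin_of_mem_nhds (inter_mem hU (inter_mem ht' (extChartAt_source_mem_nhds p))), ?_⟩
  have h := hK.comp (hC.mono Set.inter_subset_left)
    (s := U ∩ (extChartAt (𝓡 n) p ⁻¹' t ∩ (extChartAt (𝓡 n) p).source)) fun q hq ↦ hq.2.1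
  intro q hq q' hq'
  have := h hq hq'
  simpa only [Function.comp_apply, (extChartAt (𝓡 n) p).left_inv hq.2.2,
    (extChartAt (𝓡 n) p).left_inv hq'.2.2] using this

/-- The positive part of a function on a chart, extended by zero. -/
noncomputable def chartBump (x : M) (Q : EuclideanSpace ℝ (Fin n) → ℝ) (p : M) : ℝ :=
  open Classical in if p ∈ (extChartAt (𝓡 n) x).source then max 0 (Q (extChartAt (𝓡 n) x p)) else 0

/-- Near a point outside the chart domain the bump vanishes identically, because it is supported in
the compact, hence closed, image of the coordinate ball. -/
lemma locallyLipschitz_chartBump (x : M) {Q : EuclideanSpace ℝ (Fin n) → ℝ} {r : ℝ}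
    (hr : Metric.closedBall (extChartAt (𝓡 n) x x) r ⊆ (extChartAt (𝓡 n) x).target)
    (hQ : LocallyLipschitz Q) (hQ0 : ∀ z, r ≤ ‖z - extChartAt (𝓡 n) x x‖ → Q z ≤ 0) :
    LocallyLipschitz (chartBump x Q) := by
  intro p
  by_cases hp : p ∈ (extChartAt (𝓡 n) x).source
  · obtain ⟨C, U, hU, hC⟩ := locallyLipschitzOn_extChartAt x hp
    rw [(isOpen_extChartAt_source x).nhdsWithin_eq hp] at hU
    obtain ⟨K, t, ht, hK⟩ := (hQ.const_max 0) (extChartAt (𝓡 n) x p)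
    have ht' : extChartAt (𝓡 n) x ⁻¹' t ∈ 𝓝 p :=
      (continuousAt_extChartAt' (I := 𝓡 n) hp).preimage_mem_nhds ht
    refine ⟨K * C, U ∩ (extChartAt (𝓡 n) x ⁻¹' t ∩ (extChartAt (𝓡 n) x).source),
      inter_mem hU (inter_mem ht' ((isOpen_extChartAt_source x).mem_nhds hp)), ?_⟩
    have h := hK.comp (hC.mono Set.inter_subset_left)
      (s := U ∩ (extChartAt (𝓡 n) x ⁻¹' t ∩ (extChartAt (𝓡 n) x).source)) fun q hq ↦ hq.2.1
    intro q hq q' hq'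
    rw [chartBump, if_pos hq.2.2, chartBump, if_pos hq'.2.2]
    exact h hq hq'
  · have hcomp : IsCompact ((extChartAt (𝓡 n) x).symm '' Metric.closedBall (extChartAt (𝓡 n) x x) r) :=
      (isCompact_closedBall _ _).image_of_continuousOn ((continuousOn_extChartAt_symm x).mono hr)
    refine ⟨0, _, hcomp.isClosed.isOpen_compl.mem_nhds ?_, ?_⟩
    · rintro ⟨z, hz, rfl⟩
      exact hp ((extChartAt (𝓡 n) x).map_target (hr hz))
    have h0 : ∀ q ∈ ((extChartAt (𝓡 n) x).symm '' Metric.closedBall (extChartAt (𝓡 n) x x) r)ᶜ,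
        chartBump x Q q = 0 := fun q hq ↦ by
      by_cases hq' : q ∈ (extChartAt (𝓡 n) x).source
      · rw [chartBump, if_pos hq']
        refine max_eq_left (hQ0 _ (le_of_lt (not_le.1 fun hle ↦ hq ?_)))
        exact ⟨_, by rwa [Metric.mem_closedBall, dist_eq_norm], (extChartAt (𝓡 n) x).left_inv hq'⟩
      · rw [chartBump, if_neg hq']
    intro q hq q' hq'
    simp [h0 q hq, h0 q' hq']

/-- A map that is locally a submersive selection can be extended by one Lipschitz component. -/
theorem exists_submersiveSelection_prod [CompactSpace M] {F : Type*} [NormedAddCommGroup F]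
    [NormedSpace ℝ F] [FiniteDimensional ℝ F] (hd : Module.finrank ℝ F < n) {A : M → F}
    (hA : ∀ x, IsSubmersiveSelection (fun z ↦ A ((extChartAt (𝓡 n) x).symm z))
      (extChartAt (𝓡 n) x x)) :
    ∃ f : M → ℝ, LocallyLipschitz f ∧ ∀ x, IsSubmersiveSelection
      (fun z ↦ (A ((extChartAt (𝓡 n) x).symm z), f ((extChartAt (𝓡 n) x).symm z)))
      (extChartAt (𝓡 n) x x) := by
  rcases isEmpty_or_nonempty M with hM | hM
  · exact ⟨fun _ ↦ 0, LocallyLipschitz.const 0, fun x ↦ hM.elim x⟩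
  choose r hr hrt Q hQ hQ1 hQ0 hQs using fun x ↦ (hA x).exists_prod
    (by rwa [finrank_euclideanSpace_fin]) (extChartAt_target_mem_nhds (I := 𝓡 n) x)
  have hlip : ∀ x, LocallyLipschitz (chartBump x (Q x)) := fun x ↦
    locallyLipschitz_chartBump x (hrt x) (hQ x) (hQ0 x)
  have hV : ∀ x : M, ∀ᶠ p in 𝓝 x, 1 ≤ chartBump x (Q x) p := fun x ↦ by
    have h1 := (continuousAt_extChartAt (I := 𝓡 n) x).preimage_mem_nhds
      (Metric.closedBall_mem_nhds _ (half_pos (hr x)))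
    filter_upwards [h1, extChartAt_source_mem_nhds (I := 𝓡 n) x] with p hp hp'
    rw [chartBump, if_pos hp']
    refine le_max_of_le_right (hQ1 x _ ?_)
    rwa [← dist_eq_norm]
  obtain ⟨t, -, ht⟩ := isCompact_univ.elim_nhds_subcover
    (fun x ↦ {p | 1 ≤ chartBump x (Q x) p}) fun x _ ↦ hV x
  have hcover : ∀ p, ∃ x ∈ t, 1 ≤ chartBump x (Q x) p := fun p ↦ by
    obtain ⟨x, hx, hp⟩ := Set.mem_iUnion₂.1 (ht (Set.mem_univ p))
    exact ⟨x, hx, hp⟩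
  have hne : t.Nonempty := by
    obtain ⟨x, hx, -⟩ := hcover hM.some
    exact ⟨x, hx⟩
  -- A maximum again selects among the bumps, as a sum would not. Some bump is at least 1
  -- everywhere, so the maximum is attained by a positive bump, hence inside a ball where `Q`
  -- complements `A`.
  set f : M → ℝ := t.sup' hne fun x ↦ chartBump x (Q x)
  have hf : LocallyLipschitz f :=
    Finset.sup'_induction hne _ (fun _ h _ h' ↦ h.max h') fun x _ ↦ hlip x
  have hfap : ∀ p, f p = t.sup' hne fun x ↦ chartBump x (Q x) p := Finset.sup'_apply hne _
  have hf1 : ∀ p, 1 ≤ f p := fun p ↦ by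
    obtain ⟨x, hx, hp⟩ := hcover p
    rw [hfap]
    exact hp.trans (Finset.le_sup' (fun x ↦ chartBump x (Q x) p) hx)
  have hfx : ∀ p, ∃ x ∈ t, f p = chartBump x (Q x) p := fun p ↦ by
    rw [hfap]
    exact Finset.exists_mem_eq_sup' hne _
  refine ⟨f, hf, fun y ↦ ?_⟩
  have hy := mem_extChartAt_source (I := 𝓡 n) y
  have hact : ∀ x p, 0 < chartBump x (Q x) p → p ∈ (extChartAt (𝓡 n) x).source ∧
      chartBump x (Q x) p = Q x (extChartAt (𝓡 n) x p) ∧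
      ‖extChartAt (𝓡 n) x p - extChartAt (𝓡 n) x x‖ < r x := fun x p h ↦ by
    have hp : p ∈ (extChartAt (𝓡 n) x).source := by
      by_contra hp
      rw [chartBump, if_neg hp] at h
      exact lt_irrefl _ h
    rw [chartBump, if_pos hp] at h ⊢
    have h2 : 0 < Q x (extChartAt (𝓡 n) x p) := (lt_max_iff.1 h).resolve_left (lt_irrefl _)
    exact ⟨hp, max_eq_right h2.le, not_le.1 fun hle ↦ (hQ0 x _ hle).not_gt h2⟩
  have hsymm : Tendsto (extChartAt (𝓡 n) y).symm (𝓝 (extChartAt (𝓡 n) y y)) (𝓝 y) := by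
    have := continuousAt_extChartAt_symm (I := 𝓡 n) y
    rwa [ContinuousAt, extChartAt_to_inv] at this
  refine isSubmersiveSelection_of_forall (t := {x | x ∈ t ∧ 0 < chartBump x (Q x) y})
    (t.finite_toSet.subset fun x hx ↦ hx.1)
    (G := fun x w ↦ (A ((extChartAt (𝓡 n) y).symm w),
      Q x (extChartAt (𝓡 n) x ((extChartAt (𝓡 n) y).symm w)))) (fun x hx ↦ ?_) ?_
  · obtain ⟨hp, -, hp'⟩ := hact x y hx.2
    refine ((hQs x _ hp').change_chart x y hp hy).congr ?_
    filter_upwards [eventually_symm_mem_source x y hp hy] with w hw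
    rw [(extChartAt (𝓡 n) x).left_inv hw]
  -- Bumps that vanish at `y` stay below 1 nearby and cannot be the maximum.
  · have h1 : ∀ᶠ p in 𝓝 y, ∀ x ∈ t, ¬ 0 < chartBump x (Q x) y → chartBump x (Q x) p < 1 := by
      refine (eventually_all_finset t).2 fun x _ ↦ ?_
      by_cases h : 0 < chartBump x (Q x) y
      · exact .of_forall fun p h' ↦ absurd h h'
      · refine ((hlip x).continuous.continuousAt.eventually
          (gt_mem_nhds ((not_lt.1 h).trans_lt one_pos))).mono fun p hp _ ↦ hp
    filter_upwards [hsymm.eventually h1] with w hw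
    obtain ⟨x, hx, hfx'⟩ := hfx ((extChartAt (𝓡 n) y).symm w)
    have h2 : 1 ≤ chartBump x (Q x) ((extChartAt (𝓡 n) y).symm w) := hfx' ▸ hf1 _
    refine ⟨x, ⟨hx, not_not.1 fun h ↦ (hw x hx h).not_ge h2⟩, ?_⟩
    rw [hfx', (hact x _ (one_pos.trans_le h2)).2.1]

theorem exists_isSpread [CompactSpace M] [MeasurableSpace M] [BorelSpace M] (hn : 2 ≤ n) :
    ∃ (f : M → Plane) (K : ℝ≥0) (C : ℝ≥0∞), IsSpread n f K C := by
  -- The induction starts from the map to a point, trivially a submersion; its two steps need $0<n$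
  -- and $1<n$.
  obtain ⟨f₁, hf₁, h₁⟩ := exists_submersiveSelection_prod (n := n) (M := M)
    (F := EuclideanSpace ℝ (Fin 0)) (A := fun _ ↦ 0)
    (by rw [finrank_euclideanSpace_fin]; omega) fun x ↦
      ⟨{fun _ ↦ 0}, Set.finite_singleton _, by
        rintro _ rfl
        exact ⟨contDiffAt_const, Function.surjective_to_subsingleton _⟩,
        .of_forall fun z ↦ ⟨_, rfl, rfl⟩⟩
  obtain ⟨f₂, hf₂, h₂⟩ := exists_submersiveSelection_prod (n := n) (M := M)
    (F := EuclideanSpace ℝ (Fin 0) × ℝ) (A := fun p ↦ (0, f₁ p))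
    (by rw [Module.finrank_prod, finrank_euclideanSpace_fin, Module.finrank_self]; omega) h₁
  set L : (EuclideanSpace ℝ (Fin 0) × ℝ) × ℝ →L[ℝ] Plane :=
    (ContinuousLinearMap.snd ℝ _ ℝ ∘L ContinuousLinearMap.fst ℝ _ ℝ).smulRight
      (EuclideanSpace.single 0 1) +
    (ContinuousLinearMap.snd ℝ _ ℝ).smulRight (EuclideanSpace.single 1 1)
  have hL : Function.Surjective L := fun w ↦ ⟨((0, w 0), w 1), by
    ext k; fin_cases k <;> simp [L]⟩
  obtain ⟨K, hK⟩ := (L.lipschitz.locallyLipschitz.comp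
    (((LocallyLipschitz.const (0 : EuclideanSpace ℝ (Fin 0))).prodMk hf₁).prodMk
      hf₂)).exists_lipschitzWith_of_compactSpace
  obtain ⟨C, hC⟩ := exists_isSpread_of_chart (n := n) hK fun x ↦ by
    obtain ⟨N, hN, D, hD⟩ := ((h₂ x).clm_comp hL).exists_volume_le
    refine ⟨N, hN, D, fun B hB ↦ le_trans (measure_mono ?_) (hD B hB)⟩
    exact fun z hz ↦ ⟨hz.1.1, hz.2⟩
  exact ⟨_, K, C, hC⟩

end Construction

end

end GinzburgLandau

theorem mainTheorem7 {n : ℕ} (hn : 2 ≤ n)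
    {M : Type*} [EMetricSpace M] [CompactSpace M] [MeasurableSpace M] [BorelSpace M]
    [ChartedSpace (EuclideanSpace ℝ (Fin n)) M] [IsManifold (𝓡 n) ∞ M]
    [RiemannianBundle (fun x : M ↦ TangentSpace (𝓡 n) x)]
    [IsContMDiffRiemannianBundle (𝓡 n) ∞ (EuclideanSpace ℝ (Fin n))
      (fun x : M ↦ TangentSpace (𝓡 n) x)]
    [IsRiemannianManifold (𝓡 n) M]
    (W : GinzburgLandau.Plane → ℝ) (hW : GinzburgLandau.IsPotential W) :
    (∀ f : M → GinzburgLandau.Plane,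
      (∃ K : ℝ≥0, LipschitzWith K f) →
      (∃ C : ℝ, 0 < C ∧
        ∀ᵐ x ∂(GinzburgLandau.riemannianVolume n M), C⁻¹ ≤ GinzburgLandau.jacobian n f x) →
      (∃ C : ℝ≥0, ∀ z : GinzburgLandau.Plane, μH[(n : ℝ) - 2] (f ⁻¹' {z}) ≤ C) →
      (∀ ε : ℝ, 0 < ε →
        (fun y ↦ GinzburgLandau.vortexFamily ε y ∘ f) ∈ GinzburgLandau.families n M ∧
        ∃ y₀ : GinzburgLandau.Disk, ∀ y : GinzburgLandau.Disk,
          GinzburgLandau.energy n W ε (GinzburgLandau.vortexFamily ε y ∘ f) ≤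
            GinzburgLandau.energy n W ε (GinzburgLandau.vortexFamily ε y₀ ∘ f)) ∧
      limsup (fun ε : ℝ ↦
        (⨆ y : GinzburgLandau.Disk,
          GinzburgLandau.energy n W ε (GinzburgLandau.vortexFamily ε y ∘ f)) /
            ENNReal.ofReal |Real.log ε|) (𝓝[>] 0) < ⊤) ∧
    limsup (fun ε : ℝ ↦ GinzburgLandau.minMax n M W ε / ENNReal.ofReal |Real.log ε|)
      (𝓝[>] 0) < ⊤ := by
  have := GinzburgLandau.isContinuousRiemannianBundle_of_isContMDiff (n := n) (M := M)
  refine ⟨?_, ?_⟩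
  · rintro f ⟨K, hK⟩ ⟨C, hC, hJ⟩ ⟨H, hH⟩
    obtain ⟨D, hD⟩ := GinzburgLandau.exists_isSpread_of_jacobian_of_hausdorffMeasure hK
      (inv_pos.2 hC) hJ hH
    exact ⟨fun ε hε ↦ ⟨hD.mem_families hε, hD.exists_energy_max hW hε⟩, hD.limsup_energy_lt_top hW⟩
  · obtain ⟨f, K, C, hf⟩ := GinzburgLandau.exists_isSpread (n := n) (M := M) hn
    exact hf.limsup_minMax_lt_top hW
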